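/- **Setting.** Let $q\ge 1$ and $k\ge 0$ be integers. For $f:\mathbb{R}^q\to\mathbb{R}$ and $\alpha\in\mathbb{N}^q$ write $D^\alpha f=\partial^{|\alpha|_1}f/(\partial x_1^{\alpha_1}\cdots\partial x_q^{\alpha_q})$, and let $\mathbb{F}_q^k(\mathbb{R}^q)$ be the set of all $f$ for which $D^\alpha f$ exists and is continuous on $\mathbb{R}^q$ whenever $\alpha_i\le k$ for all $i$. For $i\ge 1$ let $\mathcal{G}^i\subset\mathbb{R}$ be the set of the roots of the Hermite polynomial of degree $2^i-1$ (orthogonal for the weight $e^{-x^2}$), and let $\mathbb{Q}^i$ be the Gauss–Hermite quadrature rule with nodes $\mathcal{G}^i$ for $\int_{\mathbb{R}}g(x)e^{-x^2}\,dx$, whose weights are the integrals of the Lagrange basis polynomials of $\mathcal{G}^i$ against $e^{-x^2}$. For $p\ge q$ the Smolyak sparse-grid Gauss–Hermite quadrature is $$\mathbb{Q}_q^p=\sum_{p-q<|\mathbf{i}|_1\le p}(-1)^{p-|\mathbf{i}|_1}\binom{q-1}{p-|\mathbf{i}|_1}\,\mathbb{Q}^{i_1}\otimes\cdots\otimes\mathbb{Q}^{i_q},$$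 the sum being over multi-indices with $i_1,\dots,i_q\ge 1$, and $\mathcal{N}_Q=\mathcal{N}_Q(q,p)$ denotes the number of distinct points in the union of the grids $\mathcal{G}^{i_1}\times\cdots\times\mathcal{G}^{i_q}$ over these multi-indices. **Theorem.** There is an integer $p_0$ depending only on $q$ and $k$, and for every real $M$ there is a constant $C_{q,k}$ depending only on $q$, $k$ and $M$, such that the following holds for every $f\in\mathbb{F}_q^k(\mathbb{R}^q)$ satisfying $$|D^\alpha f(x)|\le M\quad\text{for all }x\in\mathbb{R}^q\text{ and all }\alpha\text{ with }\max_i\alpha_i=k .$$ The function $f(x)e^{-x^\top x}$ is integrable on $\mathbb{R}^q$, and the estimate $$\left|\int_{\mathbb{R}^q}f(x)e^{-x^\top x}\,dx-\mathbb{Q}_q^p[f]\right|\le C_{q,k}\,\mathcal{N}_Q^{-k/2}\,(\log\mathcal{N}_Q)^{(k/2+1)(q-1)}$$ holds 1. for all $p\ge\max(p_0,q)$; and 2. if moreover $|f(x)|\le M$ for all $x\in\mathbb{R}^q$, for all $p\ge q$, with $p>q$ required when $q\ge 2$. (For $q=1$ the logarithmic factor is $1$.) -/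

import Mathlib

open scoped Polynomial

noncomputable section

namespace SparseGH

/-! ### Mixed partial derivatives and the class of functions with `D^α f` continuous, `α_i ≤ k` -/

/-- The partial derivative `∂g/∂x_j`. -/
def partialDeriv {q : ℕ} (j : Fin q) (g : (Fin q → ℝ) → ℝ) : (Fin q → ℝ) → ℝ :=
  fun x => deriv (fun t : ℝ => g (Function.update x j t)) (x j)

/-- `D^α f = ∂^{|α|} f / (∂x_1^{α_1} ⋯ ∂x_q^{α_q})`: the derivatives in the last variable are taken
first, those in the first variable last. -/
def mixedPartial {q : ℕ} (α : Fin q → ℕ) (f : (Fin q → ℝ) → ℝ) : (Fin q → ℝ) → ℝ :=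
  (List.finRange q).foldr (fun j g => (partialDeriv j)^[α j] g) f

/-- The class `𝔽_q^k(ℝ^q)` of functions `f : ℝ^q → ℝ` such that `D^α f` exists and is continuous
whenever `α_i ≤ k` for all `i`. Existence is spelled out: for such `α` with `α_j < k`, the function
`D^α f` has at every point a (genuine) partial derivative in `x_j`, and it is `D^(α + e_j) f`
(by continuity the order of differentiation does not matter). -/
structure MemF (q k : ℕ) (f : (Fin q → ℝ) → ℝ) : Prop where
  continuous_mixedPartial : ∀ α : Fin q → ℕ, (∀ i, α i ≤ k) → Continuous (mixedPartial α f)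
  hasDerivAt_mixedPartial : ∀ α : Fin q → ℕ, (∀ i, α i ≤ k) → ∀ j, α j < k → ∀ x : Fin q → ℝ,
    HasDerivAt (fun t : ℝ => mixedPartial α f (Function.update x j t))
      (mixedPartial (Function.update α j (α j + 1)) f x) (x j)

/-! ### One-dimensional Gauss–Hermite quadrature for the weight `exp (-x²)` -/

/-- The (physicists') Hermite polynomials, orthogonal on `ℝ` for the weight `exp (-x²)`:
`H_0 = 1`, `H_{n+1} = 2 X H_n - H_n'`. -/
def hermiteH : ℕ → ℝ[X]
  | 0 => 1
  | n + 1 => 2 * Polynomial.X * hermiteH n - Polynomial.derivative (hermiteH n)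

/-- The level-`i` Gauss–Hermite grid: the roots of the Hermite polynomial of order `2^i - 1`. -/
def grid (i : ℕ) : Finset ℝ := (hermiteH (2 ^ i - 1)).roots.toFinset

/-- The Gauss–Hermite weight of the node `x` of the level-`i` grid: the integral of the Lagrange
basis polynomial of that node against `exp (-t²)`. -/
def weight (i : ℕ) (x : ℝ) : ℝ :=
  ∫ t : ℝ, (Lagrange.basis (grid i) id x).eval t * Real.exp (-t ^ 2)

/-! ### Tensor products and the Smolyak sparse-grid rule -/

/-- The tensor grid of the levels `i_1, …, i_q`. -/
def tensorGrid {q : ℕ} (i : Fin q → ℕ) : Finset (Fin q → ℝ) :=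
  Fintype.piFinset fun j => grid (i j)

/-- The tensor product `Q^{i_1} ⊗ ⋯ ⊗ Q^{i_q}` of one-dimensional Gauss–Hermite rules. -/
def tensorQuad {q : ℕ} (i : Fin q → ℕ) (f : (Fin q → ℝ) → ℝ) : ℝ :=
  ∑ x ∈ tensorGrid i, (∏ j, weight (i j) (x j)) * f x

/-- The multi-indices `i` with `i_j ≥ 1` for all `j` and `p - q < |i|_1 ≤ p`. (Each `i_j` is then
at most `p`.) -/
def levels (q p : ℕ) : Finset (Fin q → ℕ) :=
  (Fintype.piFinset fun _ : Fin q => Finset.Icc 1 p).filter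
    fun i => p < (∑ j, i j) + q ∧ ∑ j, i j ≤ p

/-- The Smolyak sparse-grid Gauss–Hermite quadrature
`Q_q^p = ∑_{p-q<|i|≤p} (-1)^(p-|i|) * choose (q-1) (p-|i|) * Q^{i_1} ⊗ ⋯ ⊗ Q^{i_q}`. -/
def sparseQuad (q p : ℕ) (f : (Fin q → ℝ) → ℝ) : ℝ :=
  ∑ i ∈ levels q p,
    (-1 : ℝ) ^ (p - ∑ j, i j) * ((q - 1).choose (p - ∑ j, i j) : ℝ) * tensorQuad i f

open Classical in
/-- The set of (distinct) quadrature points used by `Q_q^p`. -/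
def sparseNodes (q p : ℕ) : Finset (Fin q → ℝ) := (levels q p).biUnion tensorGrid

/-- The number `N_Q(q,p)` of quadrature points used by `Q_q^p`. -/
def numNodes (q p : ℕ) : ℕ := (sparseNodes q p).card

/-- The quadrature error `|∫ f(x) exp (-xᵀx) dx - Q_q^p[f]|`. -/
def quadError (q p : ℕ) (f : (Fin q → ℝ) → ℝ) : ℝ :=
  |(∫ x : Fin q → ℝ, f x * Real.exp (-∑ j, x j ^ 2)) - sparseQuad q p f|

/-- The rate `N_Q^(-k/2) * (log N_Q)^((k/2+1)(q-1))`, with `N_Q = N_Q(q,p)`. -/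
def rate (q k p : ℕ) : ℝ :=
  (numNodes q p : ℝ) ^ (-((k : ℝ) / 2)) *
    Real.log (numNodes q p : ℝ) ^ (((k : ℝ) / 2 + 1) * ((q : ℝ) - 1))

end SparseGH

end

/-!
Write `Q^i` for the one-dimensional rule of level `i`, with `n = 2^i - 1` nodes, put `Q^0 = 0` and
`Δ^i = Q^i - Q^{i-1}`. The Smolyak rule is the sum of `Δ^{i_1} ⊗ ⋯ ⊗ Δ^{i_q}` over `|i| ≤ p`
(`sum_diffQuad_simplexIndex`), and the full tensor rule of level `N` is the sum over `i_j ≤ N`. The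
full tensor rules converge to the integral, so the error of the Smolyak rule is the sum of the
difference rules with `|i| > p`, and everything depends on the size of `Δ^i`.

*One variable.* If `|g^(k)| ≤ M`, the `n`-point rule has error `O(M n^(-k/2))`
(`exists_hermiteQuad_error_le`). By exactness in degree less than `2 n`, the error for `g` is the
error for the remainder `r` of its Hermite expansion of degree less than `2 n`. Parseval's identity
and `H_n' = 2 n H_{n-1}` bound the Gaussian `L²` norms of `r` and `r'` by multiples of `M n^(-k/2)`
and `M n^(-(k-1)/2)` (`TameChain.exists_hermite_remainder`). The rule applied to `|r|` is compared
with an integral: with `h = n^(-1/2)`, the value `|r(x)|` is at most the average of `|r| + h |r'|`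
over an interval of length `h`, and the rule gives to an interval of radius `h` around `s` a mass of
at most `O(h exp (-3 s² / 4))` (`exists_hermiteQuad_local_le`). For `s⁴ ≤ n` this mass bound comes
from the exactness of the rule on a nonnegative polynomial concentrated near `s`, built from
`(T_N(u) / u)²` with the Chebyshev polynomial `T_N`. For larger `s` it comes from
`Q(exp (b x²)) ≤ ∫ exp (b x²) exp (-x²)` for `0 ≤ b < 1`, which holds because the rule underestimates
all moments (`hermiteQuad_pow_le`).

*Several variables.* Induction on the number of variables, splitting off the last one, turns bounds
of functionals of one variable by derivatives of order `α_j` into a bound of their tensor product by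
`D^α` (`abs_tensorSum_le`). As `D^α` takes the derivatives in the last variable first, no exchange of
derivatives is needed. A `Δ^i` of high level is `O(2^(-k i / 2))` relative to the `k`-th derivative.
One of low level may fail to annihilate the polynomials of degree less than `k`, and is bounded by
the function itself. If `|i| > p ≥ q (k + 2)`, some `i_j` is large, so the derivative that occurs
satisfies `max α = k` and is bounded by `M`. Summing over `|i| > p` gives the error
`O(M 2^(-k p / 2) p^(q-1))` (`exists_quadError_le`). For `k = 0` and for small `p` a bound of the
function itself is used instead (`quadError_le_of_bounded`).

*The rate.* From `2^(p-q) ≤ N_Q ≤ q p^(q-1) 2^p` one gets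
`2^(-k p / 2) p^(q-1) = O(N_Q^(-k/2) (log N_Q)^((k/2+1)(q-1)))` (`exists_le_rate`); for `q ≥ 2` and
`p = q` there is only one node and the right-hand side vanishes.
-/

noncomputable section

namespace SparseGH

open MeasureTheory Filter Topology

/-! ### Continuous functions of polynomial growth -/

/-- A continuous function `g : ℝ → ℝ` of polynomial growth. -/
structure Tame (g : ℝ → ℝ) : Prop where
  continuous : Continuous g
  growth : ∃ (C : ℝ) (d : ℕ), ∀ x, |g x| ≤ C * (1 + x ^ 2) ^ d

namespace Tame

variable {f g : ℝ → ℝ}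

theorem const (c : ℝ) : Tame fun _ => c :=
  ⟨continuous_const, |c|, 0, fun x => by simp⟩

theorem id : Tame fun x => x :=
  ⟨continuous_id, 1, 1, fun x => by
    rw [abs_le]; constructor <;> nlinarith [sq_nonneg (x - 1), sq_nonneg (x + 1)]⟩

theorem growth_nonneg (hg : Tame g) :
    ∃ (C : ℝ) (d : ℕ), 0 ≤ C ∧ ∀ x, |g x| ≤ C * (1 + x ^ 2) ^ d := by
  obtain ⟨C, d, h⟩ := hg.growth
  exact ⟨C, d, by simpa using (abs_nonneg _).trans (h 0), h⟩

theorem add (hf : Tame f) (hg : Tame g) : Tame fun x => f x + g x := by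
  obtain ⟨C, d, hC, h⟩ := hf.growth_nonneg
  obtain ⟨C', d', hC', h'⟩ := hg.growth_nonneg
  refine ⟨hf.continuous.add hg.continuous, C + C', d + d', fun x => ?_⟩
  have h1 : (1 : ℝ) ≤ 1 + x ^ 2 := by nlinarith [sq_nonneg x]
  calc |f x + g x| ≤ |f x| + |g x| := abs_add_le _ _
    _ ≤ C * (1 + x ^ 2) ^ (d + d') + C' * (1 + x ^ 2) ^ (d + d') := by
        refine add_le_add ((h x).trans ?_) ((h' x).trans ?_)
        · exact mul_le_mul_of_nonneg_left (pow_le_pow_right₀ h1 (by omega)) hC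
        · exact mul_le_mul_of_nonneg_left (pow_le_pow_right₀ h1 (by omega)) hC'
    _ = _ := by ring

theorem mul (hf : Tame f) (hg : Tame g) : Tame fun x => f x * g x := by
  obtain ⟨C, d, hC, h⟩ := hf.growth_nonneg
  obtain ⟨C', d', hC', h'⟩ := hg.growth_nonneg
  refine ⟨hf.continuous.mul hg.continuous, C * C', d + d', fun x => ?_⟩
  rw [abs_mul]
  calc |f x| * |g x| ≤ (C * (1 + x ^ 2) ^ d) * (C' * (1 + x ^ 2) ^ d') :=
        mul_le_mul (h x) (h' x) (abs_nonneg _) (by positivity)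
    _ = _ := by ring

theorem const_mul (c : ℝ) (hg : Tame g) : Tame fun x => c * g x := (const c).mul hg

theorem sub (hf : Tame f) (hg : Tame g) : Tame fun x => f x - g x := by
  simpa [sub_eq_add_neg] using hf.add (hg.const_mul (-1))

theorem pow (hg : Tame g) (n : ℕ) : Tame fun x => g x ^ n := by
  induction n with
  | zero => simpa using const 1
  | succ n ih => simpa [pow_succ] using ih.mul hg

theorem abs (hg : Tame g) : Tame fun x => |g x| := by
  obtain ⟨C, d, h⟩ := hg.growth
  exact ⟨hg.continuous.abs, C, d, fun x => by simpa using h x⟩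

theorem sum {ι : Type*} (s : Finset ι) {F : ι → ℝ → ℝ} (h : ∀ i ∈ s, Tame (F i)) :
    Tame fun x => ∑ i ∈ s, F i x := by
  classical
  induction s using Finset.induction_on with
  | empty => simpa using const 0
  | insert a s ha ih =>
    simp only [Finset.sum_insert ha]
    exact (h a (by simp)).add (ih fun i hi => h i (by simp [hi]))

theorem eval (P : ℝ[X]) : Tame fun x => P.eval x := by
  simp only [Polynomial.eval_eq_sum_range]
  exact sum _ fun i _ => (id.pow i).const_mul _

/-- Polynomial growth is dominated by every Gaussian growth `exp (c x²)`. -/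
theorem le_exp (hg : Tame g) {c : ℝ} (hc : 0 < c) :
    ∃ K, 0 ≤ K ∧ ∀ x, |g x| ≤ K * Real.exp (c * x ^ 2) := by
  obtain ⟨C, d, hC, h⟩ := hg.growth_nonneg
  refine ⟨C * (d.factorial * (c⁻¹) ^ d * Real.exp c), by positivity, fun x => (h x).trans ?_⟩
  have h1 := Real.pow_div_factorial_le_exp (c * (1 + x ^ 2)) (by positivity) d
  rw [div_le_iff₀ (by positivity), mul_pow] at h1
  have h2 : (1 + x ^ 2) ^ d ≤ d.factorial * (c⁻¹) ^ d * Real.exp c * Real.exp (c * x ^ 2) := by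
    calc (1 + x ^ 2) ^ d = (c⁻¹) ^ d * (c ^ d * (1 + x ^ 2) ^ d) := by
          rw [← mul_assoc, ← mul_pow, inv_mul_cancel₀ hc.ne', one_pow, one_mul]
      _ ≤ (c⁻¹) ^ d * (Real.exp (c * (1 + x ^ 2)) * d.factorial) :=
          mul_le_mul_of_nonneg_left h1 (by positivity)
      _ = _ := by rw [mul_add, mul_one, Real.exp_add]; ring
  calc C * (1 + x ^ 2) ^ d ≤ C * (d.factorial * (c⁻¹) ^ d * Real.exp c * Real.exp (c * x ^ 2)) :=
        mul_le_mul_of_nonneg_left h2 hC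
    _ = _ := by ring

theorem integrable_exp (hg : Tame g) {c : ℝ} (hc : 0 < c) :
    Integrable fun x => g x * Real.exp (-(c * x ^ 2)) := by
  obtain ⟨K, hK, h⟩ := hg.le_exp (half_pos hc)
  refine ((integrable_exp_neg_mul_sq (half_pos hc)).const_mul K).mono'
    ((hg.continuous.mul (by fun_prop)).aestronglyMeasurable) (ae_of_all _ fun x => ?_)
  rw [Real.norm_eq_abs, abs_mul, Real.abs_exp]
  calc |g x| * Real.exp (-(c * x ^ 2))
      ≤ K * Real.exp (c / 2 * x ^ 2) * Real.exp (-(c * x ^ 2)) :=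
        mul_le_mul_of_nonneg_right (h x) (Real.exp_pos _).le
    _ = K * Real.exp (-(c / 2) * x ^ 2) := by rw [mul_assoc, ← Real.exp_add]; ring_nf

theorem integrable (hg : Tame g) : Integrable fun x => g x * Real.exp (-x ^ 2) := by
  simpa using hg.integrable_exp one_pos

end Tame

/-! ### Hermite polynomials -/

theorem hermiteH_succ (n : ℕ) :
    hermiteH (n + 1) = 2 * Polynomial.X * hermiteH n - Polynomial.derivative (hermiteH n) := rfl

theorem derivative_hermiteH_succ (n : ℕ) :
    Polynomial.derivative (hermiteH (n + 1)) = (2 * ((n : ℝ[X]) + 1)) * hermiteH n := by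
  induction n with
  | zero => simp [hermiteH]
  | succ n ih =>
    rw [hermiteH_succ (n + 1), Polynomial.derivative_sub, Polynomial.derivative_mul, ih]
    have h2 : Polynomial.derivative ((2 * ((n : ℝ[X]) + 1)) * hermiteH n) =
        (2 * ((n : ℝ[X]) + 1)) * Polynomial.derivative (hermiteH n) := by
      rw [Polynomial.derivative_mul]; simp
    rw [h2, hermiteH_succ n]
    simp
    ring

/-- The three-term recurrence. -/
theorem hermiteH_add_two (n : ℕ) :
    hermiteH (n + 2) = 2 * Polynomial.X * hermiteH (n + 1) - (2 * ((n : ℝ[X]) + 1)) * hermiteH n := by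
  rw [hermiteH_succ (n + 1), derivative_hermiteH_succ]

theorem natDegree_leadingCoeff_hermiteH (n : ℕ) :
    (hermiteH n).natDegree = n ∧ (hermiteH n).leadingCoeff = 2 ^ n := by
  have key : ∀ n, (hermiteH n).natDegree ≤ n ∧ (hermiteH n).coeff n = 2 ^ n := by
    intro n
    induction n with
    | zero => simp [hermiteH]
    | succ n ih =>
      have h1 : Polynomial.natDegree (Polynomial.derivative (hermiteH n)) ≤ n :=
        (Polynomial.natDegree_derivative_le _).trans (by omega)
      have e : 2 * Polynomial.X * hermiteH n = Polynomial.C 2 * (Polynomial.X * hermiteH n) := by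
        rw [mul_assoc]; rfl
      rw [hermiteH_succ, e]
      constructor
      · refine (Polynomial.natDegree_sub_le _ _).trans (max_le ?_ (by omega))
        refine (Polynomial.natDegree_C_mul_le _ _).trans ?_
        refine Polynomial.natDegree_mul_le.trans ?_
        rw [Polynomial.natDegree_X]
        have := ih.1
        omega
      · rw [Polynomial.coeff_sub, Polynomial.coeff_C_mul, Polynomial.coeff_X_mul, ih.2,
          Polynomial.coeff_eq_zero_of_natDegree_lt (by omega), pow_succ]
        ring
  have h : (hermiteH n).natDegree = n :=
    Polynomial.natDegree_eq_of_le_of_coeff_ne_zero (key n).1 (by rw [(key n).2]; positivity)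
  exact ⟨h, by rw [Polynomial.leadingCoeff, h, (key n).2]⟩

theorem natDegree_hermiteH (n : ℕ) : (hermiteH n).natDegree = n :=
  (natDegree_leadingCoeff_hermiteH n).1

theorem hermiteH_ne_zero (n : ℕ) : hermiteH n ≠ 0 := by
  intro h
  have := (natDegree_leadingCoeff_hermiteH n).2
  rw [h] at this
  simp at this
  exact absurd this (by positivity)

/-! ### Integration against `exp (-x²)` -/

/-- The integral of `g` against the weight `exp (-x²)`. -/
def gaussInt (g : ℝ → ℝ) : ℝ := ∫ x, g x * Real.exp (-x ^ 2)

theorem gaussInt_add {f g : ℝ → ℝ} (hf : Tame f) (hg : Tame g) :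
    gaussInt (fun x => f x + g x) = gaussInt f + gaussInt g := by
  simp only [gaussInt, add_mul]
  exact integral_add hf.integrable hg.integrable

theorem gaussInt_sub {f g : ℝ → ℝ} (hf : Tame f) (hg : Tame g) :
    gaussInt (fun x => f x - g x) = gaussInt f - gaussInt g := by
  simp only [gaussInt, sub_mul]
  exact integral_sub hf.integrable hg.integrable

theorem gaussInt_const_mul (c : ℝ) (g : ℝ → ℝ) :
    gaussInt (fun x => c * g x) = c * gaussInt g := by
  simp only [gaussInt, mul_assoc]
  exact integral_const_mul _ _

theorem gaussInt_sum {ι : Type*} (s : Finset ι) {F : ι → ℝ → ℝ} (h : ∀ i ∈ s, Tame (F i)) :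
    gaussInt (fun x => ∑ i ∈ s, F i x) = ∑ i ∈ s, gaussInt (F i) := by
  simp only [gaussInt, Finset.sum_mul]
  exact integral_finsetSum _ fun i hi => (h i hi).integrable

theorem gaussInt_nonneg {g : ℝ → ℝ} (h : ∀ x, 0 ≤ g x) : 0 ≤ gaussInt g :=
  integral_nonneg fun x => mul_nonneg (h x) (Real.exp_pos _).le

theorem gaussInt_mono {f g : ℝ → ℝ} (hf : Tame f) (hg : Tame g) (h : ∀ x, f x ≤ g x) :
    gaussInt f ≤ gaussInt g :=
  integral_mono hf.integrable hg.integrable fun x =>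
    mul_le_mul_of_nonneg_right (h x) (Real.exp_pos _).le

theorem abs_gaussInt_le (g : ℝ → ℝ) : |gaussInt g| ≤ gaussInt fun x => |g x| := by
  refine (abs_integral_le_integral_abs (f := fun x => g x * Real.exp (-x ^ 2))).trans (le_of_eq ?_)
  simp [gaussInt, abs_mul]

theorem gaussInt_one : gaussInt (fun _ => 1) = √Real.pi := by
  simpa [gaussInt] using integral_gaussian 1

theorem gaussInt_const (c : ℝ) : gaussInt (fun _ => c) = c * √Real.pi := by
  rw [← gaussInt_one, ← gaussInt_const_mul, mul_one]

/-- Integration by parts for the Gaussian weight. -/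
theorem gaussInt_mul_hermiteH_succ (n : ℕ) {g g' : ℝ → ℝ} (hd : ∀ x, HasDerivAt g (g' x) x)
    (hg : Tame g) (hg' : Tame g') :
    gaussInt (fun x => g x * (hermiteH (n + 1)).eval x) =
      gaussInt (fun x => g' x * (hermiteH n).eval x) := by
  have hv : ∀ x, HasDerivAt (fun x => (hermiteH n).eval x * Real.exp (-x ^ 2))
      (-((hermiteH (n + 1)).eval x * Real.exp (-x ^ 2))) x := by
    intro x
    have h1 := (hermiteH n).hasDerivAt x
    have h2 : HasDerivAt (fun x : ℝ => Real.exp (-x ^ 2)) (Real.exp (-x ^ 2) * (-(2 * x))) x := by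
      simpa using ((hasDerivAt_pow 2 x).neg).exp
    refine (h1.mul h2).congr_deriv ?_
    rw [hermiteH_succ]
    simp
    ring
  have h := integral_mul_deriv_eq_deriv_mul_of_integrable (u := g) (u' := g')
    (v := fun x => (hermiteH n).eval x * Real.exp (-x ^ 2))
    (v' := fun x => -((hermiteH (n + 1)).eval x * Real.exp (-x ^ 2)))
    (fun x _ => hd x) (fun x _ => hv x) ?_ ?_ ?_
  · simp only [gaussInt]
    simp only [mul_neg, integral_neg, neg_inj, ← mul_assoc] at h
    exact h
  · simpa [Pi.mul_def, mul_assoc] using (hg.mul (Tame.eval (hermiteH (n + 1)))).integrable.neg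
  · simpa [Pi.mul_def, mul_assoc] using (hg'.mul (Tame.eval (hermiteH n))).integrable
  · simpa [Pi.mul_def, mul_assoc] using (hg.mul (Tame.eval (hermiteH n))).integrable

theorem gaussInt_poly_mul_hermiteH_succ (n : ℕ) (P : ℝ[X]) :
    gaussInt (fun x => P.eval x * (hermiteH (n + 1)).eval x) =
      gaussInt (fun x => (Polynomial.derivative P).eval x * (hermiteH n).eval x) :=
  gaussInt_mul_hermiteH_succ n (fun x => P.hasDerivAt x) (Tame.eval _) (Tame.eval _)

/-- `H_n` is orthogonal to all polynomials of degree less than `n`. -/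
theorem gaussInt_poly_mul_hermiteH_eq_zero (n : ℕ) (P : ℝ[X]) (hP : P.degree < n) :
    gaussInt (fun x => P.eval x * (hermiteH n).eval x) = 0 := by
  induction n generalizing P with
  | zero =>
    have : P = 0 := by simpa using hP
    simp [this, gaussInt]
  | succ n ih =>
    rw [gaussInt_poly_mul_hermiteH_succ]
    refine ih _ ?_
    rw [Polynomial.degree_lt_iff_coeff_zero] at hP ⊢
    intro m hm
    rw [Polynomial.coeff_derivative, hP (m + 1) (by omega), zero_mul]

/-- The squared norm of `H_n` for the weight `exp (-x²)`. -/
def hermiteNorm (n : ℕ) : ℝ := √Real.pi * 2 ^ n * n.factorial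

theorem hermiteNorm_pos (n : ℕ) : 0 < hermiteNorm n := by
  unfold hermiteNorm; positivity

theorem hermiteNorm_succ (n : ℕ) : hermiteNorm (n + 1) = 2 * (n + 1) * hermiteNorm n := by
  simp only [hermiteNorm, Nat.factorial_succ]; push_cast; ring

theorem gaussInt_hermiteH_mul_self (n : ℕ) :
    gaussInt (fun x => (hermiteH n).eval x * (hermiteH n).eval x) = hermiteNorm n := by
  induction n with
  | zero => simpa [hermiteH, hermiteNorm] using gaussInt_one
  | succ n ih =>
    rw [gaussInt_poly_mul_hermiteH_succ, derivative_hermiteH_succ, hermiteNorm_succ, ← ih,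
      ← gaussInt_const_mul]
    congr 1; ext x
    simp; ring

theorem gaussInt_hermiteH_mul_of_ne {m n : ℕ} (h : m ≠ n) :
    gaussInt (fun x => (hermiteH m).eval x * (hermiteH n).eval x) = 0 := by
  rcases lt_or_gt_of_ne h with h | h
  · refine gaussInt_poly_mul_hermiteH_eq_zero n _ ?_
    rw [Polynomial.degree_eq_natDegree (hermiteH_ne_zero m), natDegree_hermiteH]
    exact_mod_cast h
  · simp only [mul_comm ((hermiteH m).eval _)]
    refine gaussInt_poly_mul_hermiteH_eq_zero m _ ?_
    rw [Polynomial.degree_eq_natDegree (hermiteH_ne_zero n), natDegree_hermiteH]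
    exact_mod_cast h

theorem eq_zero_of_gaussInt_eq_zero {g : ℝ → ℝ} (hg : Tame g) (h0 : ∀ x, 0 ≤ g x)
    (h : gaussInt g = 0) (x : ℝ) : g x = 0 := by
  have h1 := (integral_eq_zero_iff_of_nonneg
    (fun x => mul_nonneg (h0 x) (Real.exp_pos (-x ^ 2)).le) hg.integrable).1 h
  have h2 := (Continuous.ae_eq_iff_eq volume (hg.continuous.mul (by fun_prop))
    continuous_const).1 h1
  have h3 : g x * Real.exp (-x ^ 2) = 0 := congrFun h2 x
  exact (mul_eq_zero.1 h3).resolve_right (Real.exp_pos _).ne'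

/-! ### Gauss–Hermite nodes -/

/-- The nodes of the `n`-point Gauss–Hermite rule. -/
def hermiteRoots (n : ℕ) : Finset ℝ := (hermiteH n).roots.toFinset

theorem mem_hermiteRoots {n : ℕ} {x : ℝ} : x ∈ hermiteRoots n ↔ (hermiteH n).eval x = 0 := by
  simp [hermiteRoots, hermiteH_ne_zero]

/-- Consecutive Hermite polynomials have no common root. -/
theorem hermiteH_eval_ne_zero_of_eval_succ (n : ℕ) (x : ℝ) (h : (hermiteH (n + 1)).eval x = 0) :
    (hermiteH n).eval x ≠ 0 := by
  induction n with
  | zero => simp [hermiteH]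
  | succ n ih =>
    intro h0
    apply ih h0
    rw [hermiteH_add_two] at h
    simp only [Polynomial.eval_sub, Polynomial.eval_mul, h0] at h
    simp at h
    rcases h with h | h
    · exact absurd h (by positivity)
    · exact h

theorem nodup_roots_hermiteH (n : ℕ) : (hermiteH n).roots.Nodup := by
  rw [Multiset.nodup_iff_count_le_one]
  intro x
  rw [Polynomial.count_roots]
  by_contra! h
  rw [Polynomial.one_lt_rootMultiplicity_iff_isRoot (hermiteH_ne_zero n)] at h
  cases n with
  | zero => simp [hermiteH] at h
  | succ n =>
    refine hermiteH_eval_ne_zero_of_eval_succ n x h.1 ?_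
    have h2 := h.2
    rw [derivative_hermiteH_succ] at h2
    simp at h2
    rcases h2 with h | h
    · exact absurd h (by positivity)
    · exact h

/-- `H_n` has `n` distinct real roots: otherwise its product with the nodal polynomial of its
roots, a polynomial of constant sign, would have integral zero. -/
theorem card_hermiteRoots (n : ℕ) : (hermiteRoots n).card = n := by
  rw [hermiteRoots, Multiset.toFinset_card_of_nodup (nodup_roots_hermiteH n)]
  obtain ⟨G, hG, hdeg, hroots⟩ := Polynomial.exists_prod_multiset_X_sub_C_mul (hermiteH n)
  set P := ((hermiteH n).roots.map fun a => Polynomial.X - Polynomial.C a).prod with hP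
  rw [natDegree_hermiteH] at hdeg
  by_contra hne
  have hlt : Multiset.card (hermiteH n).roots < n := by omega
  have hP0 : P ≠ 0 := fun h => hermiteH_ne_zero n (by rw [← hG, h, zero_mul])
  have hG0 : G ≠ 0 := fun h => hermiteH_ne_zero n (by rw [← hG, h, mul_zero])
  have hPdeg : P.degree < n := by
    rw [Polynomial.degree_eq_natDegree hP0, hP,
      Polynomial.natDegree_multiset_prod_X_sub_C_eq_card]
    exact_mod_cast hlt
  have hzero := gaussInt_poly_mul_hermiteH_eq_zero n P hPdeg
  have hGne : ∀ x, G.eval x ≠ 0 := by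
    intro x hx
    have : x ∈ G.roots := (Polynomial.mem_roots hG0).2 hx
    simp [hroots] at this
  have hsign : (∀ x, 0 ≤ G.eval x) ∨ (∀ x, 0 ≤ -G.eval x) := by
    by_contra! hcon
    obtain ⟨⟨a, ha⟩, ⟨b, hb⟩⟩ := hcon
    obtain ⟨c, hc⟩ := mem_range_of_exists_le_of_exists_ge G.continuous
      ⟨a, ha.le⟩ ⟨b, by linarith⟩
    exact hGne c hc
  have hmain : ∀ σ : ℝ, σ ≠ 0 → (∀ x, 0 ≤ σ * G.eval x) → False := by
    intro σ hσ hs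
    have h1 : gaussInt (fun x => (σ * G.eval x) * (P.eval x) ^ 2) = 0 := by
      rw [← mul_zero σ, ← hzero, ← gaussInt_const_mul]
      congr 1; ext x
      rw [← hG, Polynomial.eval_mul]; ring
    have h2 := eq_zero_of_gaussInt_eq_zero
      (((Tame.eval G).const_mul σ).mul ((Tame.eval P).pow 2))
      (fun x => mul_nonneg (hs x) (sq_nonneg _)) h1
    apply hP0
    refine Polynomial.funext fun x => ?_
    have h3 := h2 x
    simpa [hσ, hGne x] using h3
  rcases hsign with h | h
  · exact hmain 1 one_ne_zero (by simpa using h)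
  · exact hmain (-1) (by norm_num) (by simpa using h)

/-! ### The Gauss–Hermite rule -/

/-- The weight of the node `x` of the `n`-point Gauss–Hermite rule. -/
def hermiteWeight (n : ℕ) (x : ℝ) : ℝ :=
  gaussInt fun t => (Lagrange.basis (hermiteRoots n) id x).eval t

/-- The `n`-point Gauss–Hermite rule. -/
def hermiteQuad (n : ℕ) (g : ℝ → ℝ) : ℝ := ∑ x ∈ hermiteRoots n, hermiteWeight n x * g x

theorem hermiteQuad_add (n : ℕ) (f g : ℝ → ℝ) :
    hermiteQuad n (fun x => f x + g x) = hermiteQuad n f + hermiteQuad n g := by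
  simp [hermiteQuad, mul_add, Finset.sum_add_distrib]

theorem hermiteQuad_sub (n : ℕ) (f g : ℝ → ℝ) :
    hermiteQuad n (fun x => f x - g x) = hermiteQuad n f - hermiteQuad n g := by
  simp [hermiteQuad, mul_sub, Finset.sum_sub_distrib]

theorem hermiteQuad_const_mul (n : ℕ) (c : ℝ) (g : ℝ → ℝ) :
    hermiteQuad n (fun x => c * g x) = c * hermiteQuad n g := by
  simp only [hermiteQuad, Finset.mul_sum]
  exact Finset.sum_congr rfl fun x _ => by ring

theorem hermiteQuad_sum (n : ℕ) {ι : Type*} (s : Finset ι) (F : ι → ℝ → ℝ) :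
    hermiteQuad n (fun x => ∑ i ∈ s, F i x) = ∑ i ∈ s, hermiteQuad n (F i) := by
  simp only [hermiteQuad, Finset.mul_sum]
  exact Finset.sum_comm

/-- The Gauss–Hermite rule is exact for polynomials of degree less than `2 n`. -/
theorem hermiteQuad_eq_gaussInt (n : ℕ) (P : ℝ[X]) (hP : P.degree < (2 * n : ℕ)) :
    hermiteQuad n (fun x => P.eval x) = gaussInt fun x => P.eval x := by
  have hinj : Set.InjOn (id : ℝ → ℝ) (hermiteRoots n) := Set.injOn_id _
  have hlow : ∀ B : ℝ[X], B.degree < n →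
      hermiteQuad n (fun x => B.eval x) = gaussInt fun x => B.eval x := by
    intro B hB
    have hB' := Lagrange.eq_interpolate hinj (f := B) (by rwa [card_hermiteRoots])
    have hev : ∀ x, B.eval x = ∑ y ∈ hermiteRoots n,
        B.eval y * (Lagrange.basis (hermiteRoots n) id y).eval x := by
      intro x
      conv_lhs => rw [hB', Lagrange.interpolate_apply]
      simp [Polynomial.eval_finsetSum]
    conv_rhs => rw [show (fun x => B.eval x) = _ from funext hev]
    rw [gaussInt_sum _ fun y _ => (Tame.eval _).const_mul _]
    refine Finset.sum_congr rfl fun y _ => ?_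
    rw [gaussInt_const_mul, hermiteWeight, mul_comm]
  have hmod : (P % hermiteH n).degree < n := by
    have := Polynomial.degree_mod_lt P (hermiteH_ne_zero n)
    rwa [Polynomial.degree_eq_natDegree (hermiteH_ne_zero n), natDegree_hermiteH] at this
  have hdiv : (P / hermiteH n).degree < n := by
    by_cases hle : (hermiteH n).degree ≤ P.degree
    · have h1 := Polynomial.degree_add_div (hermiteH_ne_zero n) hle
      rw [Polynomial.degree_eq_natDegree (hermiteH_ne_zero n), natDegree_hermiteH] at h1
      rw [← h1] at hP
      by_cases hd : (P / hermiteH n) = 0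
      · rw [hd, Polynomial.degree_zero]; exact WithBot.bot_lt_coe _
      rw [Polynomial.degree_eq_natDegree hd] at hP ⊢
      have h2 : n + (P / hermiteH n).natDegree < 2 * n := by exact_mod_cast hP
      exact_mod_cast (by omega : (P / hermiteH n).natDegree < n)
    · rw [(Polynomial.div_eq_zero_iff (hermiteH_ne_zero n)).2 (not_le.1 hle),
        Polynomial.degree_zero]
      exact WithBot.bot_lt_coe _
  have hsplit : ∀ x, P.eval x = (P / hermiteH n).eval x * (hermiteH n).eval x
      + (P % hermiteH n).eval x := by
    intro x
    conv_lhs => rw [← EuclideanDomain.div_add_mod P (hermiteH n)]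
    simp [mul_comm]
  have h1 : hermiteQuad n (fun x => P.eval x) =
      hermiteQuad n (fun x => (P % hermiteH n).eval x) := by
    refine Finset.sum_congr rfl fun x hx => ?_
    dsimp only
    rw [hsplit x, mem_hermiteRoots.1 hx]; simp
  rw [h1, hlow _ hmod, show (fun x => P.eval x) = _ from funext hsplit,
    gaussInt_add ((Tame.eval _).mul (Tame.eval _)) (Tame.eval _),
    gaussInt_poly_mul_hermiteH_eq_zero n _ hdiv, zero_add]

theorem hermiteWeight_nonneg (n : ℕ) {x : ℝ} (hx : x ∈ hermiteRoots n) :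
    0 ≤ hermiteWeight n x := by
  set B := Lagrange.basis (hermiteRoots n) id x with hB
  have hinj : Set.InjOn (id : ℝ → ℝ) (hermiteRoots n) := Set.injOn_id _
  have hn : 0 < n := by
    rw [← card_hermiteRoots n]; exact Finset.card_pos.2 ⟨x, hx⟩
  have hdeg : (B * B).degree < (2 * n : ℕ) := by
    have h1 := Lagrange.degree_basis hinj hx
    rw [card_hermiteRoots, ← hB] at h1
    rw [Polynomial.degree_mul, h1]
    exact_mod_cast (by omega : (n - 1) + (n - 1) < 2 * n)
  have h := hermiteQuad_eq_gaussInt n (B * B) hdeg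
  have h2 : hermiteQuad n (fun y => (B * B).eval y) = hermiteWeight n x := by
    rw [hermiteQuad, Finset.sum_eq_single x]
    · have : B.eval x = 1 := Lagrange.eval_basis_self hinj hx
      simp [this]
    · intro y hy hyx
      have : B.eval y = 0 := Lagrange.eval_basis_of_ne (v := id) hyx.symm hy
      simp [this]
    · exact fun h => absurd hx h
  rw [← h2, h]
  exact gaussInt_nonneg fun t => by rw [Polynomial.eval_mul]; exact mul_self_nonneg _

theorem hermiteQuad_mono (n : ℕ) {f g : ℝ → ℝ} (h : ∀ x ∈ hermiteRoots n, f x ≤ g x) :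
    hermiteQuad n f ≤ hermiteQuad n g :=
  Finset.sum_le_sum fun x hx => mul_le_mul_of_nonneg_left (h x hx) (hermiteWeight_nonneg n hx)

theorem abs_hermiteQuad_le (n : ℕ) (g : ℝ → ℝ) :
    |hermiteQuad n g| ≤ hermiteQuad n fun x => |g x| := by
  refine (Finset.abs_sum_le_sum_abs _ _).trans (le_of_eq ?_)
  refine Finset.sum_congr rfl fun x hx => ?_
  rw [abs_mul, abs_of_nonneg (hermiteWeight_nonneg n hx)]

theorem hermiteQuad_one {n : ℕ} (hn : 0 < n) : hermiteQuad n (fun _ => 1) = √Real.pi := by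
  have := hermiteQuad_eq_gaussInt n 1 (by
    rw [Polynomial.degree_one]; exact_mod_cast (by omega : 0 < 2 * n))
  simpa [gaussInt_one] using this

/-! ### Gauss–Hermite quadrature of Gaussian growth -/

/-- Multiplication by `x` on Hermite coefficients. -/
def hermiteShift (c : ℕ → ℝ) (j : ℕ) : ℝ :=
  (if j = 0 then 0 else c (j - 1) / 2) + (j + 1) * c (j + 1)

theorem mul_sum_hermiteH (l : ℕ) (c : ℕ → ℝ) (hc : ∀ j, l < j → c j = 0) (x : ℝ) :
    x * ∑ j ∈ Finset.range (l + 1), c j * (hermiteH j).eval x =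
      ∑ j ∈ Finset.range (l + 2), hermiteShift c j * (hermiteH j).eval x := by
  have hrec : ∀ j, x * (hermiteH j).eval x =
      (hermiteH (j + 1)).eval x / 2 + j * (hermiteH (j - 1)).eval x := by
    intro j
    cases j with
    | zero => simp [hermiteH]
    | succ j => rw [hermiteH_add_two]; simp; ring
  simp only [hermiteShift, add_mul, Finset.sum_add_distrib]
  rw [Finset.sum_range_succ' (fun j => (if j = 0 then 0 else c (j - 1) / 2) *
    (hermiteH j).eval x)]
  have h2 : ∑ j ∈ Finset.range (l + 2), ((j : ℝ) + 1) * c (j + 1) * (hermiteH j).eval x =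
      ∑ j ∈ Finset.range (l + 1), (j : ℝ) * c j * (hermiteH (j - 1)).eval x := by
    rw [Finset.sum_range_succ, Finset.sum_range_succ, Finset.sum_range_succ' (n := l)]
    simp [hc (l + 1), hc (l + 2)]
  simp only [add_mul] at h2
  rw [← Finset.sum_add_distrib, h2, Finset.mul_sum]
  simp only [Nat.add_eq_zero_iff, one_ne_zero, and_false, if_false, add_tsub_cancel_right,
    if_true, zero_mul, add_zero, ← Finset.sum_add_distrib]
  refine Finset.sum_congr rfl fun j _ => ?_
  linear_combination c j * hrec j

theorem hermiteShift_nonneg {c : ℕ → ℝ} (h : ∀ j, 0 ≤ c j) (j : ℕ) : 0 ≤ hermiteShift c j := by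
  unfold hermiteShift
  have h1 := h (j - 1)
  have h2 := h (j + 1)
  split_ifs <;> positivity

theorem hermiteShift_mono {b c : ℕ → ℝ} (h : ∀ j, b j ≤ c j) (j : ℕ) :
    hermiteShift b j ≤ hermiteShift c j := by
  unfold hermiteShift
  have h1 := h (j - 1)
  have h2 := mul_le_mul_of_nonneg_left (h (j + 1)) (by positivity : (0 : ℝ) ≤ (j : ℝ) + 1)
  split_ifs <;> linarith

/-- The Hermite coefficients `a` of `x^l`, and those, `b`, of its remainder modulo `H_n`: since
`x H_j = H_{j+1} / 2 + j H_{j-1}` has nonnegative coefficients, dropping the multiples of `H_n`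
only makes the coefficients smaller. -/
theorem exists_hermite_coeffs (n l : ℕ) : ∃ a b : ℕ → ℝ, (∀ j, 0 ≤ b j) ∧ (∀ j, b j ≤ a j) ∧
    (∀ j, l < j → a j = 0) ∧ (∀ j, n ≤ j → b j = 0) ∧
    (∀ x, x ^ l = ∑ j ∈ Finset.range (l + 1), a j * (hermiteH j).eval x) ∧
    (∀ x ∈ hermiteRoots n, x ^ l = ∑ j ∈ Finset.range (l + 1), b j * (hermiteH j).eval x) := by
  induction l with
  | zero =>
    refine ⟨fun j => if j = 0 then 1 else 0, fun j => if j = 0 ∧ 0 < n then 1 else 0,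
      fun j => by positivity, fun j => ?_, fun j hj => by simp; omega,
      fun j hj => by simp; omega, fun x => by simp [hermiteH], fun x hx => ?_⟩
    · dsimp only; split_ifs <;> first | omega | norm_num
    · have hn : 0 < n := by
        rw [← card_hermiteRoots n]; exact Finset.card_pos.2 ⟨x, hx⟩
      simp [hermiteH, hn]
  | succ l ih =>
    obtain ⟨a, b, hb0, hba, ha, hb, hxa, hxb⟩ := ih
    have hbl : ∀ j, l < j → b j = 0 := fun j hj =>
      le_antisymm ((hba j).trans (ha j hj).le) (hb0 j)
    refine ⟨hermiteShift a, fun j => if j < n then hermiteShift b j else 0, fun j => ?_,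
      fun j => ?_, fun j hj => ?_, fun j hj => ?_, fun x => ?_, fun x hx => ?_⟩
    · dsimp only; split_ifs
      · exact hermiteShift_nonneg hb0 j
      · exact le_rfl
    · dsimp only; split_ifs
      · exact hermiteShift_mono hba j
      · exact hermiteShift_nonneg (fun j => (hb0 j).trans (hba j)) j
    · simp [hermiteShift, ha (j - 1) (by omega), ha (j + 1) (by omega)]
    · simp [hj]
    · rw [pow_succ', hxa, mul_sum_hermiteH l a ha]
    · rw [pow_succ', hxb x hx, mul_sum_hermiteH l b hbl]
      refine Finset.sum_congr rfl fun j _ => ?_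
      dsimp only
      split_ifs with hj
      · rfl
      · rcases (not_lt.1 hj).eq_or_lt with rfl | hj
        · rw [mem_hermiteRoots.1 hx]; simp
        · simp [hermiteShift, hb (j - 1) (by omega), hb (j + 1) (by omega)]

theorem gaussInt_hermiteH {j : ℕ} (hj : 0 < j) : gaussInt (fun x => (hermiteH j).eval x) = 0 := by
  have := gaussInt_hermiteH_mul_of_ne (m := 0) (n := j) (by omega)
  simpa [hermiteH] using this

/-- Gauss–Hermite quadrature underestimates the moments. -/
theorem hermiteQuad_pow_le (n l : ℕ) :
    hermiteQuad n (fun x => x ^ l) ≤ gaussInt fun x => x ^ l := by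
  obtain ⟨a, b, hb0, hba, ha, hb, hxa, hxb⟩ := exists_hermite_coeffs n l
  have h1 : gaussInt (fun x => x ^ l) = a 0 * √Real.pi := by
    rw [show (fun x : ℝ => x ^ l) = _ from funext hxa,
      gaussInt_sum _ fun y _ => (Tame.eval _).const_mul _, Finset.sum_range_succ']
    rw [Finset.sum_eq_zero]
    · simp [hermiteH, gaussInt_const]
    · intro j _; rw [gaussInt_const_mul, gaussInt_hermiteH (by omega), mul_zero]
  have h2 : hermiteQuad n (fun x => x ^ l) = b 0 * √Real.pi := by
    have : hermiteQuad n (fun x => x ^ l) = hermiteQuad n (fun x =>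
        ∑ j ∈ Finset.range (l + 1), b j * (hermiteH j).eval x) :=
      Finset.sum_congr rfl fun x hx => congrArg _ (hxb x hx)
    rw [this, hermiteQuad_sum, Finset.sum_range_succ']
    simp only [hermiteQuad_const_mul]
    rw [Finset.sum_eq_zero]
    · rcases Nat.eq_zero_or_pos n with rfl | hn
      · simp [hb 0 le_rfl]
      · simp [hermiteH, hermiteQuad_one hn]
    · intro j _
      by_cases hj : n ≤ j + 1
      · simp [hb _ hj]
      · rw [hermiteQuad_eq_gaussInt, gaussInt_hermiteH (by omega), mul_zero]
        rw [Polynomial.degree_eq_natDegree (hermiteH_ne_zero _), natDegree_hermiteH]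
        exact_mod_cast (by omega : j + 1 < 2 * n)
  rw [h1, h2]
  exact mul_le_mul_of_nonneg_right (hba 0) (Real.sqrt_nonneg _)

/-- Gauss–Hermite quadrature underestimates the integral of `exp (b x²)`, as it does for the partial
sums of the power series. -/
theorem hermiteQuad_exp_le (n : ℕ) {b : ℝ} (hb : 0 ≤ b) (hb1 : b < 1) :
    hermiteQuad n (fun x => Real.exp (b * x ^ 2)) ≤ √(Real.pi / (1 - b)) := by
  have hsum : ∀ x : ℝ, Tendsto (fun N => ∑ m ∈ Finset.range N, (b * x ^ 2) ^ m / m.factorial)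
      atTop (𝓝 (Real.exp (b * x ^ 2))) := by
    intro x
    rw [Real.exp_eq_exp_ℝ]
    exact (NormedSpace.expSeries_div_hasSum_exp (b * x ^ 2)).tendsto_sum_nat
  have hlim : Tendsto (fun N => hermiteQuad n fun x =>
      ∑ m ∈ Finset.range N, (b * x ^ 2) ^ m / m.factorial) atTop
      (𝓝 (hermiteQuad n fun x => Real.exp (b * x ^ 2))) :=
    tendsto_finsetSum _ fun x _ => (hsum x).const_mul _
  refine le_of_tendsto' hlim fun N => ?_
  have hrw : ∀ m, (fun x : ℝ => (b * x ^ 2) ^ m / m.factorial) =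
      fun x => (b ^ m / m.factorial) * x ^ (2 * m) := by
    intro m; ext x; rw [mul_pow, ← pow_mul]; ring
  have htame : ∀ m, Tame fun x : ℝ => (b * x ^ 2) ^ m / m.factorial := by
    intro m; rw [hrw]; exact (Tame.id.pow _).const_mul _
  have h1 : hermiteQuad n (fun x => ∑ m ∈ Finset.range N, (b * x ^ 2) ^ m / m.factorial) ≤
      gaussInt (fun x => ∑ m ∈ Finset.range N, (b * x ^ 2) ^ m / m.factorial) := by
    rw [hermiteQuad_sum, gaussInt_sum _ fun m _ => htame m]
    refine Finset.sum_le_sum fun m _ => ?_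
    rw [hrw, hermiteQuad_const_mul, gaussInt_const_mul]
    exact mul_le_mul_of_nonneg_left (hermiteQuad_pow_le n _) (by positivity)
  refine h1.trans ?_
  rw [← integral_gaussian]
  refine integral_mono (Tame.sum _ fun m _ => htame m).integrable
    (integrable_exp_neg_mul_sq (by linarith)) fun x => ?_
  have h2 := Real.sum_le_exp_of_nonneg (x := b * x ^ 2) (by positivity) N
  calc _ ≤ Real.exp (b * x ^ 2) * Real.exp (-x ^ 2) :=
        mul_le_mul_of_nonneg_right h2 (Real.exp_pos _).le
    _ = _ := by rw [← Real.exp_add]; ring_nf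

/-! ### A polynomial kernel concentrated near the origin -/

theorem abs_sin_nat_mul_le (N : ℕ) (θ : ℝ) : |Real.sin (N * θ)| ≤ N * |Real.sin θ| := by
  induction N with
  | zero => simp
  | succ N ih =>
    push_cast
    rw [add_mul, one_mul, Real.sin_add, add_mul, one_mul]
    refine (abs_add_le _ _).trans (add_le_add ?_ ?_)
    · rw [abs_mul]
      exact (mul_le_of_le_one_right (abs_nonneg _) (Real.abs_cos_le_one _)).trans ih
    · rw [abs_mul]
      exact mul_le_of_le_one_left (abs_nonneg _) (Real.abs_cos_le_one _)

/-- For odd `N`, `|T_N(sin θ)| = |sin (N θ)|`. -/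
theorem abs_chebyshev_sin (m : ℕ) (θ : ℝ) :
    |(Polynomial.Chebyshev.T ℝ ((2 * m + 1 : ℕ) : ℤ)).eval (Real.sin θ)| =
      |Real.sin ((2 * m + 1 : ℕ) * θ)| := by
  rw [← Real.cos_pi_div_two_sub, Polynomial.Chebyshev.T_real_cos]
  have : (((2 * m + 1 : ℕ) : ℤ) : ℝ) * (Real.pi / 2 - θ) =
      (Real.pi / 2 - (2 * m + 1 : ℕ) * θ) + m * Real.pi := by push_cast; ring
  rw [this, Real.cos_add_nat_mul_pi, Real.cos_pi_div_two_sub, abs_mul]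
  simp

theorem abs_chebyshev_le_mul (m : ℕ) {u : ℝ} (hu : |u| ≤ 1) :
    |(Polynomial.Chebyshev.T ℝ ((2 * m + 1 : ℕ) : ℤ)).eval u| ≤ (2 * m + 1 : ℕ) * |u| := by
  have h := abs_le.1 hu
  rw [← Real.sin_arcsin h.1 h.2, abs_chebyshev_sin]
  exact abs_sin_nat_mul_le _ _

theorem two_div_pi_mul_abs_le_abs_sin {x : ℝ} (hx : |x| ≤ Real.pi / 2) :
    2 / Real.pi * |x| ≤ |Real.sin x| := by
  have h := Real.mul_le_sin (abs_nonneg x) hx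
  rcases abs_cases x with ⟨h1, _⟩ | ⟨h1, _⟩
  · rw [h1] at h ⊢
    exact h.trans (le_abs_self _)
  · rw [h1] at h ⊢
    rw [Real.sin_neg] at h
    exact h.trans (neg_le_abs _)

theorem mul_le_abs_chebyshev (m : ℕ) {u : ℝ} (hu : (2 * m + 1 : ℕ) * |u| ≤ 1) :
    2 / Real.pi * ((2 * m + 1 : ℕ) * |u|) ≤
      |(Polynomial.Chebyshev.T ℝ ((2 * m + 1 : ℕ) : ℤ)).eval u| := by
  have hN : (1 : ℝ) ≤ (2 * m + 1 : ℕ) := by exact_mod_cast (by omega : 1 ≤ 2 * m + 1)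
  have hu1 : |u| ≤ 1 := (le_mul_of_one_le_left (abs_nonneg _) hN).trans hu
  have h := abs_le.1 hu1
  have hs := Real.sin_arcsin h.1 h.2
  set θ := Real.arcsin u with hθ
  have hθ1 : |θ| ≤ Real.pi / 2 :=
    abs_le.2 ⟨Real.neg_pi_div_two_le_arcsin u, Real.arcsin_le_pi_div_two u⟩
  have hθ2 := two_div_pi_mul_abs_le_abs_sin hθ1
  have hθ3 : |u| ≤ |θ| := by rw [← hs]; exact Real.abs_sin_le_abs
  rw [← hs, abs_chebyshev_sin, hs]
  have hpi := Real.pi_pos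
  have habs : |((2 * m + 1 : ℕ) : ℝ) * θ| = (2 * m + 1 : ℕ) * |θ| := by
    rw [abs_mul, Nat.abs_cast]
  have hle : |((2 * m + 1 : ℕ) : ℝ) * θ| ≤ Real.pi / 2 := by
    rw [hs] at hθ2
    have : |θ| ≤ Real.pi / 2 * |u| := by
      calc |θ| = Real.pi / 2 * (2 / Real.pi * |θ|) := by field_simp
        _ ≤ _ := mul_le_mul_of_nonneg_left hθ2 (by positivity)
    rw [habs]
    calc _ ≤ ((2 * m + 1 : ℕ) : ℝ) * (Real.pi / 2 * |u|) :=
          mul_le_mul_of_nonneg_left this (by positivity)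
      _ = Real.pi / 2 * ((2 * m + 1 : ℕ) * |u|) := by ring
      _ ≤ Real.pi / 2 * 1 := mul_le_mul_of_nonneg_left hu (by positivity)
      _ = _ := mul_one _
  refine le_trans ?_ (two_div_pi_mul_abs_le_abs_sin hle)
  rw [habs]
  gcongr

theorem chebyshev_le_two_mul_pow (n : ℕ) {u : ℝ} (hu : 1 ≤ u) :
    (Polynomial.Chebyshev.T ℝ (n : ℤ)).eval u ≤ (2 * u) ^ n := by
  induction n with
  | zero => simp
  | succ n ih =>
    cases n with
    | zero => simp; linarith
    | succ n =>
      have h0 := Polynomial.Chebyshev.one_le_eval_T_real (n : ℤ) hu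
      have h1 : (Polynomial.Chebyshev.T ℝ ((n + 1 + 1 : ℕ) : ℤ)).eval u =
          2 * u * (Polynomial.Chebyshev.T ℝ ((n + 1 : ℕ) : ℤ)).eval u -
            (Polynomial.Chebyshev.T ℝ (n : ℤ)).eval u := by
        push_cast
        rw [show (n : ℤ) + 1 + 1 = n + 2 by ring, Polynomial.Chebyshev.T_add_two]
        simp
      rw [h1, pow_succ (2 * u)]
      nlinarith [mul_le_mul_of_nonneg_left ih (by linarith : (0 : ℝ) ≤ 2 * u)]

theorem abs_chebyshev_le_two_mul_pow (n : ℕ) {u : ℝ} (hu : 1 ≤ |u|) :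
    |(Polynomial.Chebyshev.T ℝ (n : ℤ)).eval u| ≤ (2 * |u|) ^ n := by
  have h : |(Polynomial.Chebyshev.T ℝ (n : ℤ)).eval u| =
      |(Polynomial.Chebyshev.T ℝ (n : ℤ)).eval (|u|)| := by
    rcases abs_choice u with h | h
    · rw [h]
    · rw [h, Polynomial.Chebyshev.T_eval_neg, abs_mul]
      simp
  rw [h, abs_of_nonneg (zero_le_one.trans (Polynomial.Chebyshev.one_le_eval_T_real _ hu))]
  exact chebyshev_le_two_mul_pow n hu

/-- The polynomial `T_{2m+1}(u) / u`; its square is the kernel. -/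
def chebyshevQuot (m : ℕ) : ℝ[X] := (Polynomial.Chebyshev.T ℝ ((2 * m + 1 : ℕ) : ℤ)).divX

theorem X_mul_chebyshevQuot (m : ℕ) :
    Polynomial.X * chebyshevQuot m = Polynomial.Chebyshev.T ℝ ((2 * m + 1 : ℕ) : ℤ) := by
  have h := Polynomial.X_mul_divX_add (Polynomial.Chebyshev.T ℝ ((2 * m + 1 : ℕ) : ℤ))
  rw [Polynomial.coeff_zero_eq_eval_zero, Polynomial.Chebyshev.T_eval_zero_of_odd] at h
  · simpa [chebyshevQuot] using h
  · exact ⟨m, by push_cast; ring⟩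

theorem mul_eval_chebyshevQuot (m : ℕ) (u : ℝ) : u * (chebyshevQuot m).eval u =
    (Polynomial.Chebyshev.T ℝ ((2 * m + 1 : ℕ) : ℤ)).eval u := by
  rw [← X_mul_chebyshevQuot]; simp

theorem abs_eval_zero_chebyshevQuot (m : ℕ) : |(chebyshevQuot m).eval 0| = (2 * m + 1 : ℕ) := by
  have h := congrArg (fun p => (Polynomial.derivative p).eval 0) (X_mul_chebyshevQuot m)
  rw [Polynomial.Chebyshev.T_derivative_eq_U] at h
  have e : ((2 * m + 1 : ℕ) : ℤ) - 1 = 2 * m := by push_cast; ring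
  rw [e] at h
  simp only [Polynomial.derivative_mul, Polynomial.derivative_X, one_mul, Polynomial.eval_add,
    Polynomial.eval_mul, Polynomial.eval_X, zero_mul, add_zero,
    Polynomial.Chebyshev.U_eval_two_mul_zero] at h
  rw [h, abs_mul]
  simp
  positivity

theorem natDegree_chebyshevQuot (m : ℕ) : (chebyshevQuot m).natDegree = 2 * m := by
  rw [chebyshevQuot, Polynomial.natDegree_divX_eq_natDegree_tsub_one,
    Polynomial.Chebyshev.natDegree_T]
  omega

/-- On `[-1, 1]` the kernel is at most `2 N² / (1 + N² u²)`, `N = 2 m + 1`. -/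
theorem chebyshevQuot_sq_mul_le (m : ℕ) {u : ℝ} (hu : |u| ≤ 1) :
    (chebyshevQuot m).eval u ^ 2 * (1 + ((2 * m + 1 : ℕ) * u) ^ 2) ≤
      2 * ((2 * m + 1 : ℕ) : ℝ) ^ 2 := by
  set N : ℝ := ((2 * m + 1 : ℕ) : ℝ) with hN
  have hT := mul_eval_chebyshevQuot m u
  have h1 : (u * (chebyshevQuot m).eval u) ^ 2 ≤ 1 := by
    rw [hT, ← sq_abs]
    exact pow_le_one₀ (abs_nonneg _) (Polynomial.Chebyshev.abs_eval_T_real_le_one _ hu)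
  have h2 : (chebyshevQuot m).eval u ^ 2 ≤ N ^ 2 := by
    rw [← sq_abs]
    refine pow_le_pow_left₀ (abs_nonneg _) ?_ 2
    rcases eq_or_ne u 0 with rfl | h0
    · rw [abs_eval_zero_chebyshevQuot]
    · have h3 := abs_chebyshev_le_mul m hu
      rw [← hT, abs_mul, mul_comm] at h3
      exact le_of_mul_le_mul_right h3 (abs_pos.2 h0)
  nlinarith [sq_nonneg N]

theorem chebyshevQuot_sq_le_pow (m : ℕ) {u : ℝ} (hu : 1 ≤ |u|) :
    (chebyshevQuot m).eval u ^ 2 ≤ ((2 * u) ^ 2) ^ (2 * m + 1) := by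
  have h := abs_chebyshev_le_two_mul_pow (2 * m + 1) hu
  rw [← mul_eval_chebyshevQuot, abs_mul] at h
  have h2 : |(chebyshevQuot m).eval u| ≤ (2 * |u|) ^ (2 * m + 1) :=
    (le_mul_of_one_le_left (abs_nonneg _) hu).trans h
  calc (chebyshevQuot m).eval u ^ 2 = |(chebyshevQuot m).eval u| ^ 2 := (sq_abs _).symm
    _ ≤ ((2 * |u|) ^ (2 * m + 1)) ^ 2 := pow_le_pow_left₀ (abs_nonneg _) h2 2
    _ = ((2 * u) ^ 2) ^ (2 * m + 1) := by
      rw [← pow_mul, mul_comm _ 2, pow_mul, mul_pow, mul_pow 2 u, sq_abs]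

theorem le_chebyshevQuot_sq (m : ℕ) {u : ℝ} (hu : (2 * m + 1 : ℕ) * |u| ≤ 1) :
    ((2 * m + 1 : ℕ) : ℝ) ^ 2 / 4 ≤ (chebyshevQuot m).eval u ^ 2 := by
  set N : ℝ := ((2 * m + 1 : ℕ) : ℝ) with hN
  have hN0 : 0 ≤ N := by positivity
  have h : N / 2 ≤ |(chebyshevQuot m).eval u| := by
    rcases eq_or_ne u 0 with rfl | h0
    · rw [abs_eval_zero_chebyshevQuot]; linarith
    · have h3 := mul_le_abs_chebyshev m hu
      rw [← mul_eval_chebyshevQuot, abs_mul, ← mul_assoc, mul_comm |u|] at h3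
      refine le_trans ?_ (le_of_mul_le_mul_right h3 (abs_pos.2 h0))
      have : (1 : ℝ) / 2 ≤ 2 / Real.pi := by
        rw [div_le_div_iff₀ (by norm_num) Real.pi_pos]; linarith [Real.pi_le_four]
      calc N / 2 = 1 / 2 * N := by ring
        _ ≤ _ := mul_le_mul_of_nonneg_right this hN0
  calc N ^ 2 / 4 = (N / 2) ^ 2 := by ring
    _ ≤ |(chebyshevQuot m).eval u| ^ 2 := pow_le_pow_left₀ (by positivity) h 2
    _ = _ := sq_abs _

/-! ### Local mass of the Gauss–Hermite rule -/

/-- The loss in replacing `exp z` by `1 + z` is of second order. -/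
theorem exp_sub_sq_le_one_add {z : ℝ} (hz : 0 ≤ z) : Real.exp (z - z ^ 2) ≤ 1 + z := by
  have h1 : z - z ^ 2 ≤ z / (1 + z) := by
    rw [le_div_iff₀ (by positivity)]; nlinarith [pow_nonneg hz 3]
  have h2 : 1 - z / (1 + z) ≤ Real.exp (-(z / (1 + z))) := by
    linarith [Real.add_one_le_exp (-(z / (1 + z)))]
  have h3 : 1 - z / (1 + z) = (1 + z)⁻¹ := by field_simp; ring
  rw [h3, Real.exp_neg] at h2
  exact (Real.exp_le_exp.2 h1).trans ((inv_le_inv₀ (by positivity) (Real.exp_pos _)).1 h2)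

/-- A nonnegative polynomial of degree less than `2 n`, `n = 4 m + 3`. For `s⁴ ≤ n`, and up to the
factor `(2 m + 1)²` and constants, it is at least `exp (3 s² / 4)` at distance at most `n^(-1/2)` from
`s` and has Gaussian integral at most `n^(-1/2)`. The factor `(1 + 3 t² / (4 L))^L`, `L = 2 m + 2`,
replaces `exp (3 t² / 4)`. The argument of the kernel is divided by `16 √n`, so that it has modulus
greater than `1` only for `|t - s| > 16 √n`, where the Gaussian weight absorbs the growth of the
kernel. -/
def bumpPoly (m : ℕ) (s : ℝ) : ℝ[X] :=
  ((chebyshevQuot m).comp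
      (Polynomial.C (16 * √((4 * m + 3 : ℕ) : ℝ))⁻¹ * (Polynomial.X - Polynomial.C s))) ^ 2 *
    (1 + Polynomial.C (3 / 4 / (2 * (m : ℝ) + 2)) * Polynomial.X ^ 2) ^ (2 * m + 2)

theorem eval_bumpPoly (m : ℕ) (s t : ℝ) : (bumpPoly m s).eval t =
    (chebyshevQuot m).eval ((16 * √((4 * m + 3 : ℕ) : ℝ))⁻¹ * (t - s)) ^ 2 *
      (1 + 3 / 4 / (2 * (m : ℝ) + 2) * t ^ 2) ^ (2 * m + 2) := by
  simp [bumpPoly, Polynomial.eval_comp]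

theorem eval_bumpPoly_nonneg (m : ℕ) (s t : ℝ) : 0 ≤ (bumpPoly m s).eval t := by
  rw [eval_bumpPoly]; positivity

theorem degree_bumpPoly (m : ℕ) (s : ℝ) : (bumpPoly m s).degree < (2 * (4 * m + 3) : ℕ) := by
  refine Polynomial.degree_le_natDegree.trans_lt ?_
  have h1 : (Polynomial.C (16 * √((4 * m + 3 : ℕ) : ℝ))⁻¹ *
      (Polynomial.X - Polynomial.C s)).natDegree ≤ 1 := by compute_degree
  have h2 : ((1 : ℝ[X]) + Polynomial.C (3 / 4 / (2 * (m : ℝ) + 2)) *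
      Polynomial.X ^ 2).natDegree ≤ 2 := by compute_degree
  have h3 : (bumpPoly m s).natDegree ≤ 2 * (2 * m * 1) + (2 * m + 2) * 2 := by
    refine Polynomial.natDegree_mul_le.trans (add_le_add ?_ ?_)
    · refine Polynomial.natDegree_pow_le.trans (Nat.mul_le_mul_left _ ?_)
      refine Polynomial.natDegree_comp_le.trans ?_
      rw [natDegree_chebyshevQuot]
      exact Nat.mul_le_mul_left _ h1
    · exact Polynomial.natDegree_pow_le.trans (Nat.mul_le_mul_left _ h2)
  exact_mod_cast (by omega : (bumpPoly m s).natDegree < 2 * (4 * m + 3))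

theorem le_eval_bumpPoly (m : ℕ) {s t : ℝ} (hs : s ^ 4 ≤ (4 * m + 3 : ℕ))
    (ht : |t - s| ≤ (√((4 * m + 3 : ℕ) : ℝ))⁻¹) :
    ((2 * m + 1 : ℕ) : ℝ) ^ 2 / 4 * (Real.exp (-20) * Real.exp (3 / 4 * s ^ 2)) ≤
      (bumpPoly m s).eval t := by
  rw [eval_bumpPoly]
  set ν := √((4 * m + 3 : ℕ) : ℝ) with hν
  have hνsq : ν ^ 2 = 4 * m + 3 := by rw [hν, Real.sq_sqrt (by positivity)]; push_cast; ring
  have hm0 : (0 : ℝ) ≤ m := by positivity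
  have hν0 : 0 ≤ ν := Real.sqrt_nonneg _
  have hν1 : 1 ≤ ν := by nlinarith
  have hνi : ν⁻¹ ≤ 1 := inv_le_one_of_one_le₀ hν1
  have hνi0 : 0 ≤ ν⁻¹ := by positivity
  have hνν : ν * ν⁻¹ = 1 := mul_inv_cancel₀ (by positivity)
  have hs' : s ^ 4 ≤ 4 * m + 3 := by exact_mod_cast hs
  have hs2 : s ^ 2 ≤ ν := by
    refine abs_le_of_sq_le_sq' ?_ hν0 |>.2
    rw [hνsq]; nlinarith
  have habs : |s| ≤ ν := by
    refine abs_le_of_sq_le_sq ?_ hν0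
    nlinarith
  set d := t - s with hd
  have htd : t = s + d := by rw [hd]; ring
  have hd1 : |d| ≤ 1 := ht.trans hνi
  have hsd : |s| * |d| ≤ 1 := by
    calc |s| * |d| ≤ ν * ν⁻¹ := mul_le_mul habs ht (abs_nonneg _) hν0
      _ = 1 := hνν
  have hsd' := abs_le.1 ((abs_mul s d).trans_le hsd)
  have hd2 : d ^ 2 ≤ 1 := by rw [← sq_abs]; exact pow_le_one₀ (abs_nonneg _) hd1
  have ht_lo : s ^ 2 - 2 ≤ t ^ 2 := by rw [htd]; nlinarith [sq_nonneg d]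
  have ht_hi : t ^ 2 ≤ s ^ 2 + 3 := by rw [htd]; nlinarith
  have hu : ((2 * m + 1 : ℕ) : ℝ) * |(16 * ν)⁻¹ * d| ≤ 1 := by
    rw [abs_mul, abs_of_nonneg (by positivity), mul_inv]
    calc ((2 * m + 1 : ℕ) : ℝ) * (16⁻¹ * ν⁻¹ * |d|)
        ≤ ((2 * m + 1 : ℕ) : ℝ) * (16⁻¹ * ν⁻¹ * ν⁻¹) := by gcongr
      _ = ((2 * m + 1 : ℕ) : ℝ) * 16⁻¹ * (ν ^ 2)⁻¹ := by rw [← inv_pow]; ring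
      _ ≤ 1 := by
        rw [hνsq, ← div_eq_mul_inv, div_le_one (by positivity)]; push_cast; linarith
  have hF := le_chebyshevQuot_sq m hu
  set z := 3 / 4 / (2 * (m : ℝ) + 2) * t ^ 2 with hz
  have hz0 : 0 ≤ z := by positivity
  have hL : (2 * (m : ℝ) + 2) * z = 3 / 4 * t ^ 2 := by rw [hz]; field_simp
  have hexp : Real.exp (-20) * Real.exp (3 / 4 * s ^ 2) ≤ (1 + z) ^ (2 * m + 2) := by
    refine le_trans ?_ (pow_le_pow_left₀ (Real.exp_pos _).le (exp_sub_sq_le_one_add hz0) _)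
    rw [← Real.exp_add, ← Real.exp_nat_mul, Real.exp_le_exp]
    push_cast
    -- this is where `s⁴ ≤ n` is needed: the second-order loss, `L` times, is bounded
    have hLz : (2 * (m : ℝ) + 2) * z ^ 2 ≤ 18 := by
      have h4 : (3 / 4 * t ^ 2) ^ 2 ≤ 18 * (2 * (m : ℝ) + 2) := by
        have : (t ^ 2) ^ 2 ≤ (s ^ 2 + 3) ^ 2 := pow_le_pow_left₀ (sq_nonneg t) ht_hi 2
        nlinarith [sq_nonneg (s ^ 2 - 3)]
      rw [← hL, mul_pow, pow_two (2 * (m : ℝ) + 2), mul_assoc, mul_comm 18] at h4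
      exact le_of_mul_le_mul_left h4 (by positivity)
    nlinarith
  exact mul_le_mul hF hexp (by positivity) (sq_nonneg _)

theorem eval_bumpPoly_mul_exp_le (m : ℕ) {s : ℝ} (hs : s ^ 4 ≤ (4 * m + 3 : ℕ)) (t : ℝ) :
    (bumpPoly m s).eval t * Real.exp (-t ^ 2) ≤ ((2 * m + 1 : ℕ) : ℝ) ^ 2 *
      (2 * (1 + (((2 * m + 1 : ℕ) : ℝ) * (16 * √((4 * m + 3 : ℕ) : ℝ))⁻¹ * (t - s)) ^ 2)⁻¹ +
        (2⁻¹) ^ (2 * m + 1) * Real.exp (-(1 / 8) * t ^ 2)) := by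
  rw [eval_bumpPoly]
  set ν := √((4 * m + 3 : ℕ) : ℝ) with hν
  have hνsq : ν ^ 2 = 4 * m + 3 := by rw [hν, Real.sq_sqrt (by positivity)]; push_cast; ring
  have hm0 : (0 : ℝ) ≤ m := by positivity
  have hν0 : 0 ≤ ν := Real.sqrt_nonneg _
  have hν1 : 1 ≤ ν := by nlinarith
  have hs' : s ^ 4 ≤ 4 * m + 3 := by exact_mod_cast hs
  have habs : |s| ≤ ν := by
    refine abs_le_of_sq_le_sq ?_ hν0
    have hs2 : s ^ 2 ≤ ν := by
      refine abs_le_of_sq_le_sq' ?_ hν0 |>.2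
      rw [hνsq]; nlinarith
    nlinarith
  have hexp : (1 + 3 / 4 / (2 * (m : ℝ) + 2) * t ^ 2) ^ (2 * m + 2) ≤ Real.exp (3 / 4 * t ^ 2) := by
    have h1 : 1 + 3 / 4 / (2 * (m : ℝ) + 2) * t ^ 2 ≤
        Real.exp (3 / 4 / (2 * (m : ℝ) + 2) * t ^ 2) := by
      rw [add_comm]; exact Real.add_one_le_exp _
    refine (pow_le_pow_left₀ (by positivity) h1 _).trans (le_of_eq ?_)
    rw [← Real.exp_nat_mul]
    congr 1
    push_cast
    field_simp
  set u := (16 * ν)⁻¹ * (t - s) with hu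
  set N : ℝ := ((2 * m + 1 : ℕ) : ℝ) with hN
  have hN0 : 0 < N := by rw [hN]; positivity
  have hstep : (chebyshevQuot m).eval u ^ 2 *
      (1 + 3 / 4 / (2 * (m : ℝ) + 2) * t ^ 2) ^ (2 * m + 2) * Real.exp (-t ^ 2) ≤
      (chebyshevQuot m).eval u ^ 2 * Real.exp (-(1 / 4) * t ^ 2) := by
    rw [mul_assoc]
    refine mul_le_mul_of_nonneg_left ?_ (sq_nonneg _)
    refine (mul_le_mul_of_nonneg_right hexp (Real.exp_pos _).le).trans (le_of_eq ?_)
    rw [← Real.exp_add]; ring_nf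
  refine hstep.trans ?_
  rw [mul_assoc N, ← hu, mul_add]
  -- the first summand of the bound accounts for `|u| ≤ 1`, the second one for `|u| ≥ 1`
  rcases le_total |u| 1 with h | h
  · have h1 := chebyshevQuot_sq_mul_le m h
    rw [← hN] at h1
    have h2 : (chebyshevQuot m).eval u ^ 2 ≤ N ^ 2 * (2 * (1 + (N * u) ^ 2)⁻¹) := by
      rw [← mul_assoc, ← div_eq_mul_inv, le_div_iff₀ (by positivity), mul_comm (N ^ 2)]
      exact h1
    have h3 : Real.exp (-(1 / 4) * t ^ 2) ≤ 1 := by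
      rw [Real.exp_le_one_iff]; nlinarith [sq_nonneg t]
    refine ((mul_le_of_le_one_right (sq_nonneg _) h3).trans h2).trans
      (le_add_of_nonneg_right (by positivity))
  · refine le_trans ?_ (le_add_of_nonneg_left (by positivity))
    have hts : |t - s| = 16 * ν * |u| := by
      rw [hu, abs_mul, abs_of_nonneg (by positivity : 0 ≤ (16 * ν)⁻¹)]; field_simp
    have h2t : |t - s| ≤ 2 * |t| := by
      have h1 : 16 * ν ≤ |t - s| := by rw [hts]; exact le_mul_of_one_le_right (by positivity) h
      have h2 := abs_sub t s
      linarith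
    have hsq : (2 * u) ^ 2 ≤ 2⁻¹ * (t ^ 2 / (8 * ν ^ 2)) := by
      have h1 : (t - s) ^ 2 ≤ 4 * t ^ 2 := by
        rw [← sq_abs (t - s), ← sq_abs t]; nlinarith [abs_nonneg (t - s)]
      rw [hu, mul_pow, mul_pow, inv_pow, mul_pow]
      calc (2 : ℝ) ^ 2 * ((16 ^ 2 * ν ^ 2)⁻¹ * (t - s) ^ 2)
          ≤ 2 ^ 2 * ((16 ^ 2 * ν ^ 2)⁻¹ * (4 * t ^ 2)) := by gcongr
        _ = _ := by field_simp; ring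
    -- `(y / (8 ν²))^(2 m + 1) ≤ exp ((2 m + 1) y / (8 ν²)) ≤ exp (y / 8)` for `y = t²`
    have hpow : ((2 * u) ^ 2) ^ (2 * m + 1) ≤
        (2⁻¹) ^ (2 * m + 1) * Real.exp (1 / 8 * t ^ 2) := by
      refine (pow_le_pow_left₀ (sq_nonneg _) hsq _).trans ?_
      rw [mul_pow]
      refine mul_le_mul_of_nonneg_left ?_ (by positivity)
      have h1 : t ^ 2 / (8 * ν ^ 2) ≤ Real.exp (t ^ 2 / (8 * ν ^ 2)) :=
        (le_add_of_nonneg_right zero_le_one).trans (Real.add_one_le_exp _)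
      refine (pow_le_pow_left₀ (by positivity) h1 _).trans ?_
      rw [← Real.exp_nat_mul, Real.exp_le_exp, hνsq, ← mul_div_assoc,
        div_le_iff₀ (by positivity)]
      push_cast
      nlinarith [sq_nonneg t, mul_nonneg hm0 (sq_nonneg t)]
    have hN1 : 1 ≤ N ^ 2 := by
      have : (1 : ℝ) ≤ N := by rw [hN]; exact_mod_cast (by omega : 1 ≤ 2 * m + 1)
      exact one_le_pow₀ this
    calc (chebyshevQuot m).eval u ^ 2 * Real.exp (-(1 / 4) * t ^ 2)
        ≤ (2⁻¹) ^ (2 * m + 1) * Real.exp (1 / 8 * t ^ 2) * Real.exp (-(1 / 4) * t ^ 2) :=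
          mul_le_mul_of_nonneg_right ((chebyshevQuot_sq_le_pow m h).trans hpow)
            (Real.exp_pos _).le
      _ = (2⁻¹) ^ (2 * m + 1) * Real.exp (-(1 / 8) * t ^ 2) := by
          rw [mul_assoc, ← Real.exp_add]; ring_nf
      _ ≤ N ^ 2 * ((2⁻¹) ^ (2 * m + 1) * Real.exp (-(1 / 8) * t ^ 2)) :=
          le_mul_of_one_le_left (by positivity) hN1

theorem integral_inv_one_add_sq_affine {κ : ℝ} (hκ : 0 < κ) (s : ℝ) :
    ∫ t : ℝ, (1 + (κ * (t - s)) ^ 2)⁻¹ = Real.pi / κ := by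
  rw [integral_sub_right_eq_self (fun t => (1 + (κ * t) ^ 2)⁻¹) s,
    Measure.integral_comp_mul_left (fun t => (1 + t ^ 2)⁻¹) κ, integral_univ_inv_one_add_sq,
    abs_of_pos (inv_pos.2 hκ), smul_eq_mul, div_eq_inv_mul]

theorem integrable_inv_one_add_sq_affine {κ : ℝ} (hκ : 0 < κ) (s : ℝ) :
    Integrable fun t : ℝ => (1 + (κ * (t - s)) ^ 2)⁻¹ :=
  (integrable_inv_one_add_sq.comp_mul_left' hκ.ne').comp_sub_right s

theorem gaussInt_bumpPoly_le (m : ℕ) {s : ℝ} (hs : s ^ 4 ≤ (4 * m + 3 : ℕ)) :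
    gaussInt (fun t => (bumpPoly m s).eval t) ≤ ((2 * m + 1 : ℕ) : ℝ) ^ 2 *
      ((96 * Real.pi + 3 * √(8 * Real.pi)) * (√((4 * m + 3 : ℕ) : ℝ))⁻¹) := by
  set ν := √((4 * m + 3 : ℕ) : ℝ) with hν
  have hνsq : ν ^ 2 = 4 * m + 3 := by rw [hν, Real.sq_sqrt (by positivity)]; push_cast; ring
  have hm0 : (0 : ℝ) ≤ m := by positivity
  have hν0 : 0 ≤ ν := Real.sqrt_nonneg _
  have hν1 : 1 ≤ ν := by nlinarith
  set N : ℝ := ((2 * m + 1 : ℕ) : ℝ) with hN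
  have hN0 : 0 < N := by rw [hN]; positivity
  have hN3 : ν ^ 2 ≤ 3 * N := by rw [hνsq, hN]; push_cast; linarith
  set κ := N * (16 * ν)⁻¹ with hκ
  have hκ0 : 0 < κ := by positivity
  have hi1 : Integrable fun t : ℝ => 2 * (1 + (κ * (t - s)) ^ 2)⁻¹ :=
    (integrable_inv_one_add_sq_affine hκ0 s).const_mul 2
  have hi2 : Integrable fun t : ℝ => (2⁻¹ : ℝ) ^ (2 * m + 1) * Real.exp (-(1 / 8) * t ^ 2) :=
    (integrable_exp_neg_mul_sq (by norm_num)).const_mul _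
  have h1 : gaussInt (fun t => (bumpPoly m s).eval t) ≤ ∫ t, N ^ 2 *
      (2 * (1 + (κ * (t - s)) ^ 2)⁻¹ + (2⁻¹) ^ (2 * m + 1) * Real.exp (-(1 / 8) * t ^ 2)) :=
    integral_mono (Tame.eval _).integrable ((hi1.add hi2).const_mul _)
      fun t => eval_bumpPoly_mul_exp_le m hs t
  refine h1.trans ?_
  rw [integral_const_mul, integral_add hi1 hi2, integral_const_mul, integral_const_mul,
    integral_inv_one_add_sq_affine hκ0, integral_gaussian]
  refine mul_le_mul_of_nonneg_left ?_ (sq_nonneg _)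
  rw [add_mul]
  have hνi : ν * ν⁻¹ = 1 := mul_inv_cancel₀ (by positivity)
  refine add_le_add ?_ ?_
  · have : Real.pi / κ ≤ 48 * Real.pi * ν⁻¹ := by
      rw [div_le_iff₀ hκ0, hκ, mul_inv]
      have h3 : 1 ≤ 3 * N * (ν⁻¹ * ν⁻¹) := by
        calc (1 : ℝ) = ν ^ 2 * (ν⁻¹ * ν⁻¹) := by rw [pow_two]; linear_combination (-(ν * ν⁻¹) - 1) * hνi
          _ ≤ _ := mul_le_mul_of_nonneg_right hN3 (by positivity)
      calc Real.pi = Real.pi * 1 := (mul_one _).symm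
        _ ≤ Real.pi * (3 * N * (ν⁻¹ * ν⁻¹)) := mul_le_mul_of_nonneg_left h3 Real.pi_pos.le
        _ = _ := by ring
    linarith
  · have h2N : (2⁻¹ : ℝ) ^ (2 * m + 1) ≤ 3 * ν⁻¹ := by
      have h3 : N ≤ 2 ^ (2 * m + 1) := by
        rw [hN]; exact_mod_cast Nat.lt_two_pow_self.le
      rw [inv_pow]
      calc ((2 : ℝ) ^ (2 * m + 1))⁻¹ ≤ N⁻¹ := inv_anti₀ hN0 h3
        _ ≤ 3 * ν⁻¹ := by
          rw [inv_le_iff_one_le_mul₀' hN0, ← mul_assoc, ← div_eq_mul_inv, le_div_iff₀ (by positivity)]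
          nlinarith
    have h8 : Real.pi / (1 / 8) = 8 * Real.pi := by ring
    rw [h8]
    calc _ ≤ 3 * ν⁻¹ * √(8 * Real.pi) := mul_le_mul_of_nonneg_right h2N (Real.sqrt_nonneg _)
      _ = _ := by ring

/-- The Gauss–Hermite rule with `n = 4 m + 3` nodes gives mass `O(n^(-1/2) exp (-3 s² / 4))` to the
interval of radius `n^(-1/2)` around `s`. -/
theorem exists_hermiteQuad_local_le : ∃ C : ℝ, 0 ≤ C ∧ ∀ (m : ℕ) (s : ℝ),
    hermiteQuad (4 * m + 3)
      (fun t => if |t - s| ≤ (√((4 * m + 3 : ℕ) : ℝ))⁻¹ then 1 else 0) ≤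
      C * (√((4 * m + 3 : ℕ) : ℝ))⁻¹ * Real.exp (-(3 / 4 * s ^ 2)) := by
  set K₁ := 4 * Real.exp 20 * (96 * Real.pi + 3 * √(8 * Real.pi)) with hK₁
  set K₂ := 16 * Real.exp (49 / 4) * √(Real.pi / (1 - 7 / 8)) with hK₂
  have hK₁0 : 0 ≤ K₁ := by have := Real.pi_pos; positivity
  have hK₂0 : 0 ≤ K₂ := by positivity
  refine ⟨K₁ + K₂, by positivity, fun m s => ?_⟩
  set ν := √((4 * m + 3 : ℕ) : ℝ) with hν
  have hνsq : ν ^ 2 = (4 * m + 3 : ℕ) := by rw [hν, Real.sq_sqrt (by positivity)]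
  have hm0 : (0 : ℝ) ≤ m := by positivity
  have hν0 : 0 ≤ ν := Real.sqrt_nonneg _
  have hν1 : 1 ≤ ν := by
    have : (1 : ℝ) ≤ ν ^ 2 := by rw [hνsq]; push_cast; linarith
    nlinarith
  have hνi : ν⁻¹ ≤ 1 := inv_le_one_of_one_le₀ hν1
  have hνi0 : 0 < ν⁻¹ := by positivity
  rcases le_total (s ^ 4) (4 * m + 3 : ℕ) with hs | hs
  -- near the origin: the indicator function is dominated by a multiple of the bump polynomial
  · set N : ℝ := ((2 * m + 1 : ℕ) : ℝ) with hN
    have hN0 : 0 < N := by rw [hN]; positivity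
    set c := N ^ 2 / 4 * (Real.exp (-20) * Real.exp (3 / 4 * s ^ 2)) with hc
    have hc0 : 0 < c := by positivity
    have h1 : hermiteQuad (4 * m + 3) (fun t => if |t - s| ≤ ν⁻¹ then 1 else 0) ≤
        hermiteQuad (4 * m + 3) (fun t => c⁻¹ * (bumpPoly m s).eval t) := by
      refine hermiteQuad_mono _ fun t _ => ?_
      split_ifs with h
      · have := le_eval_bumpPoly m hs h
        rw [inv_mul_eq_div, le_div_iff₀ hc0, one_mul]
        exact this
      · exact mul_nonneg (by positivity) (eval_bumpPoly_nonneg m s t)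
    rw [hermiteQuad_const_mul, hermiteQuad_eq_gaussInt _ _ (degree_bumpPoly m s)] at h1
    have h2 := mul_le_mul_of_nonneg_left (gaussInt_bumpPoly_le m hs) (inv_nonneg.2 hc0.le)
    refine (h1.trans h2).trans ?_
    rw [← hν, ← hN]
    have h3 : c⁻¹ * (N ^ 2 * ((96 * Real.pi + 3 * √(8 * Real.pi)) * ν⁻¹)) =
        K₁ * ν⁻¹ * Real.exp (-(3 / 4 * s ^ 2)) := by
      rw [hc, hK₁, Real.exp_neg, Real.exp_neg]
      field_simp
    rw [h3]
    gcongr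
    linarith
  -- far from the origin: the indicator function is dominated by a multiple of `exp (7 t² / 8)`, and
  -- the surplus `exp (s² / 8)` over `exp (3 s² / 4)` is worth a factor `n^(1/2)` as `s² ≥ n^(1/2)`
  · have hs2 : ν ≤ s ^ 2 := by
      refine abs_le_of_sq_le_sq' ?_ (sq_nonneg s) |>.2
      rw [hνsq]; linarith [hs, (by ring : s ^ 4 = (s ^ 2) ^ 2)]
    set c := 16 * Real.exp (49 / 4) * (ν⁻¹ * Real.exp (-(3 / 4 * s ^ 2))) with hc
    have h1 : hermiteQuad (4 * m + 3) (fun t => if |t - s| ≤ ν⁻¹ then 1 else 0) ≤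
        hermiteQuad (4 * m + 3) (fun t => c * Real.exp (7 / 8 * t ^ 2)) := by
      refine hermiteQuad_mono _ fun t _ => ?_
      split_ifs with h
      · have hd1 : |t - s| ≤ 1 := h.trans hνi
        have ht : s ^ 2 - 2 * |s| ≤ t ^ 2 := by
          have h4 : |s * (t - s)| ≤ |s| := by
            rw [abs_mul]; exact mul_le_of_le_one_right (abs_nonneg _) hd1
          nlinarith [(abs_le.1 h4).1, sq_nonneg (t - s)]
        have h5 : (1 : ℝ) ≤ 16 * ν⁻¹ * Real.exp (ν / 16) := by
          have := Real.add_one_le_exp (ν / 16)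
          calc (1 : ℝ) = 16 * ν⁻¹ * (ν / 16) := by field_simp
            _ ≤ _ := mul_le_mul_of_nonneg_left (by linarith) (by positivity)
        refine h5.trans ?_
        have h6 : Real.exp (ν / 16) ≤
            Real.exp (49 / 4) * (Real.exp (-(3 / 4 * s ^ 2)) * Real.exp (7 / 8 * t ^ 2)) := by
          rw [← Real.exp_add, ← Real.exp_add, Real.exp_le_exp]
          nlinarith [sq_nonneg (|s| / 4 - 7 / 2), sq_abs s]
        calc 16 * ν⁻¹ * Real.exp (ν / 16) ≤ 16 * ν⁻¹ * (Real.exp (49 / 4) *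
              (Real.exp (-(3 / 4 * s ^ 2)) * Real.exp (7 / 8 * t ^ 2))) := by gcongr
          _ = _ := by rw [hc]; ring
      · positivity
    rw [hermiteQuad_const_mul] at h1
    have h2 := mul_le_mul_of_nonneg_left (hermiteQuad_exp_le (4 * m + 3)
      (by norm_num : (0 : ℝ) ≤ 7 / 8) (by norm_num)) (by positivity : 0 ≤ c)
    refine (h1.trans h2).trans ?_
    have h3 : c * √(Real.pi / (1 - 7 / 8)) = K₂ * ν⁻¹ * Real.exp (-(3 / 4 * s ^ 2)) := by
      rw [hc, hK₂]; ring
    rw [h3]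
    gcongr
    linarith

/-! ### Completeness of the Hermite polynomials -/

/-- An integrable function with vanishing Fourier transform vanishes almost everywhere: its positive
and negative parts are densities of measures with the same characteristic function. -/
theorem ae_eq_zero_of_integral_mul_cexp_eq_zero {φ : ℝ → ℝ} (hφ : Integrable φ)
    (h : ∀ t : ℝ, ∫ x, (φ x : ℂ) * Complex.exp (t * x * Complex.I) = 0) : φ =ᵐ[volume] 0 := by
  have hfin₁ : IsFiniteMeasure (volume.withDensity fun x => ((φ x).toNNReal : ENNReal)) :=
    isFiniteMeasure_withDensity_ofReal hφ.2
  have hfin₂ : IsFiniteMeasure (volume.withDensity fun x => ((-φ x).toNNReal : ENNReal)) :=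
    isFiniteMeasure_withDensity_ofReal hφ.neg.2
  have hm₁ : AEMeasurable (fun x => (φ x).toNNReal) := hφ.aemeasurable.real_toNNReal
  have hm₂ : AEMeasurable (fun x => (-φ x).toNNReal) := hφ.neg.aemeasurable.real_toNNReal
  have hint : ∀ (ψ : ℝ → ℝ), Integrable ψ → ∀ t : ℝ,
      Integrable fun x => (ψ x).toNNReal • Complex.exp (t * x * Complex.I) := by
    intro ψ hψ t
    have h1 : Integrable fun x => (((ψ x).toNNReal : ℝ) : ℂ) := hψ.real_toNNReal.ofReal
    refine (h1.mul_bdd (c := 1) (g := fun x : ℝ => Complex.exp (t * x * Complex.I))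
      (by fun_prop) (ae_of_all _ fun x => ?_)).congr (ae_of_all _ fun x => ?_)
    · rw [← Complex.ofReal_mul, Complex.norm_exp_ofReal_mul_I]
    · simp [NNReal.smul_def]
  have heq : (volume.withDensity fun x => ((φ x).toNNReal : ENNReal)) =
      volume.withDensity fun x => ((-φ x).toNNReal : ENNReal) := by
    refine Measure.ext_of_charFun (funext fun t => ?_)
    rw [charFun_apply_real, charFun_apply_real, integral_withDensity_eq_integral_smul₀ hm₁,
      integral_withDensity_eq_integral_smul₀ hm₂, ← sub_eq_zero,
      ← integral_sub (hint φ hφ t) (hint (fun x => -φ x) hφ.neg t), ← h t]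
    refine integral_congr_ae (ae_of_all _ fun x => ?_)
    dsimp only
    rw [NNReal.smul_def, NNReal.smul_def, ← sub_smul, Complex.real_smul]
    congr 2
    simp only [Real.coe_toNNReal']
    rcases le_total 0 (φ x) with h0 | h0
    · rw [max_eq_left h0, max_eq_right (by linarith)]; ring
    · rw [max_eq_right h0, max_eq_left (by linarith)]; ring
  have h2 := (withDensity_eq_iff_of_sigmaFinite hm₁.coe_nnreal_ennreal
    hm₂.coe_nnreal_ennreal).1 heq
  filter_upwards [h2] with x hx
  have hx' : (φ x).toNNReal = (-φ x).toNNReal := by exact_mod_cast hx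
  have hx2 := congrArg NNReal.toReal hx'
  simp only [Real.coe_toNNReal'] at hx2
  rcases le_total 0 (φ x) with h0 | h0
  · rw [max_eq_left h0, max_eq_right (by linarith)] at hx2; simpa using hx2
  · rw [max_eq_right h0, max_eq_left (by linarith)] at hx2
    simp only [Pi.zero_apply]; linarith

theorem Tame.memLp {g : ℝ → ℝ} (hg : Tame g) :
    MemLp (fun x => g x * Real.exp (-x ^ 2 / 2)) 2 := by
  have hc : Continuous fun x => g x * Real.exp (-x ^ 2 / 2) := hg.continuous.mul (by fun_prop)
  rw [memLp_two_iff_integrable_sq hc.aestronglyMeasurable]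
  refine (hg.pow 2).integrable.congr (ae_of_all _ fun x => ?_)
  dsimp only
  rw [mul_pow, ← Real.exp_nat_mul]
  congr 2
  push_cast; ring

/-- The element `g(x) exp (-x²/2)` of `L²(ℝ)`. -/
def gaussLp (g : ℝ → ℝ) (hg : Tame g) : Lp ℝ 2 (volume : Measure ℝ) := hg.memLp.toLp

theorem inner_gaussLp {f g : ℝ → ℝ} (hf : Tame f) (hg : Tame g) :
    inner ℝ (gaussLp f hf) (gaussLp g hg) = gaussInt fun x => f x * g x := by
  rw [L2.inner_def]
  refine integral_congr_ae ?_
  filter_upwards [hf.memLp.coeFn_toLp, hg.memLp.coeFn_toLp] with x h1 h2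
  simp only [gaussLp]
  rw [h1, h2]
  simp only [RCLike.inner_apply, conj_trivial]
  have : Real.exp (-x ^ 2) = Real.exp (-x ^ 2 / 2) * Real.exp (-x ^ 2 / 2) := by
    rw [← Real.exp_add]; ring_nf
  rw [this]; ring

/-- A function of `L²(ℝ)` that is orthogonal to all `P(x) exp (-x²/2)` with `P` a monomial is zero:
the Fourier transform of its product with `exp (-x²/2)` has vanishing Taylor series. -/
theorem eq_zero_of_forall_inner_pow_eq_zero (F : Lp ℝ 2 (volume : Measure ℝ))
    (h : ∀ l : ℕ, ∫ x, F x * (x ^ l * Real.exp (-x ^ 2 / 2)) = 0) : F = 0 := by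
  have hF : MemLp F 2 := Lp.memLp F
  have hmem : ∀ t : ℝ, MemLp (fun x : ℝ => Real.exp (-x ^ 2 / 2) * Real.exp |t * x|) 2 := by
    intro t
    have hc : Continuous fun x : ℝ => Real.exp (-x ^ 2 / 2) * Real.exp |t * x| := by fun_prop
    rw [memLp_two_iff_integrable_sq hc.aestronglyMeasurable]
    refine ((integrable_exp_neg_mul_sq (by norm_num : (0 : ℝ) < 1 / 2)).const_mul
      (Real.exp (2 * t ^ 2))).mono' (hc.pow 2).aestronglyMeasurable (ae_of_all _ fun x => ?_)
    rw [Real.norm_eq_abs, abs_of_nonneg (by positivity), mul_pow, ← Real.exp_nat_mul,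
      ← Real.exp_nat_mul, ← Real.exp_add, ← Real.exp_add, Real.exp_le_exp]
    push_cast
    have h1 := sq_nonneg (2 * |t| - |x|)
    rw [abs_mul]
    nlinarith [sq_abs t, sq_abs x]
  have hφ : Integrable fun x => F x * Real.exp (-x ^ 2 / 2) := by
    have := hF.integrable_mul (hmem 0)
    simpa [Pi.mul_def] using this
  have hzero := ae_eq_zero_of_integral_mul_cexp_eq_zero hφ ?_
  · refine (Lp.eq_zero_iff_ae_eq_zero).2 ?_
    filter_upwards [hzero] with x hx
    exact (mul_eq_zero.1 hx).resolve_right (Real.exp_pos _).ne'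
  · intro t
    have hsum := hasSum_integral_of_dominated_convergence
      (μ := (volume : Measure ℝ))
      (F := fun (l : ℕ) (x : ℝ) => ((F x * Real.exp (-x ^ 2 / 2) : ℝ) : ℂ) *
        ((t * x * Complex.I) ^ l / l.factorial))
      (f := fun x => ((F x * Real.exp (-x ^ 2 / 2) : ℝ) : ℂ) * Complex.exp (t * x * Complex.I))
      (fun l x => |F x * Real.exp (-x ^ 2 / 2)| * (|t * x| ^ l / l.factorial))
      (fun l => ?_) (fun l => ae_of_all _ fun x => ?_) (ae_of_all _ fun x => ?_) ?_
      (ae_of_all _ fun x => ?_)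
    · have hterm : ∀ l : ℕ, ∫ x, ((F x * Real.exp (-x ^ 2 / 2) : ℝ) : ℂ) *
          ((t * x * Complex.I) ^ l / l.factorial) = 0 := by
        intro l
        have : ∀ x : ℝ, ((F x * Real.exp (-x ^ 2 / 2) : ℝ) : ℂ) *
            ((t * x * Complex.I) ^ l / l.factorial) =
            ((t * Complex.I) ^ l / l.factorial) *
              ((F x * (x ^ l * Real.exp (-x ^ 2 / 2)) : ℝ) : ℂ) := by
          intro x; push_cast; rw [mul_right_comm (t : ℂ) x, mul_pow _ (x : ℂ)]; ring
        simp only [this]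
        rw [integral_const_mul, integral_complex_ofReal, h l]
        simp
      simp only [hterm] at hsum
      exact hsum.unique hasSum_zero
    · refine (Complex.continuous_ofReal.comp_aestronglyMeasurable hφ.aestronglyMeasurable).mul ?_
      exact (by fun_prop : Continuous fun x : ℝ =>
        ((t : ℂ) * x * Complex.I) ^ l / l.factorial).aestronglyMeasurable
    · rw [norm_mul, Complex.norm_real, Real.norm_eq_abs]
      simp [abs_mul]
    · exact ((NormedSpace.expSeries_div_summable |t * x|).mul_left _)
    · have h1 : ∀ x : ℝ, ∑' l : ℕ, |F x * Real.exp (-x ^ 2 / 2)| * (|t * x| ^ l / l.factorial) =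
          |F x * (Real.exp (-x ^ 2 / 2) * Real.exp |t * x|)| := by
        intro x
        rw [tsum_mul_left, (NormedSpace.expSeries_div_hasSum_exp |t * x|).tsum_eq,
          ← Real.exp_eq_exp_ℝ, ← mul_assoc, abs_mul _ (Real.exp |t * x|), Real.abs_exp]
      simp only [h1]
      have := (hF.integrable_mul (hmem t)).abs
      simpa [Pi.mul_def] using this
    · rw [Complex.exp_eq_exp_ℂ]
      exact (NormedSpace.expSeries_div_hasSum_exp (t * x * Complex.I)).mul_left _

/-- The Hermite coefficient `∫ g H_j exp (-x²)`. -/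
def hermiteCoeff (g : ℝ → ℝ) (j : ℕ) : ℝ := gaussInt fun x => g x * (hermiteH j).eval x

/-- The normalized Hermite functions. -/
def hermiteLp (j : ℕ) : Lp ℝ 2 (volume : Measure ℝ) :=
  gaussLp (fun x => (√(hermiteNorm j))⁻¹ * (hermiteH j).eval x) ((Tame.eval _).const_mul _)

theorem inner_gaussLp_hermiteLp {g : ℝ → ℝ} (hg : Tame g) (j : ℕ) :
    inner ℝ (gaussLp g hg) (hermiteLp j) = (√(hermiteNorm j))⁻¹ * hermiteCoeff g j := by
  rw [hermiteLp, inner_gaussLp, hermiteCoeff, ← gaussInt_const_mul]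
  congr 1; ext x; ring

theorem orthonormal_hermiteLp : Orthonormal ℝ hermiteLp := by
  rw [orthonormal_iff_ite]
  intro i j
  rw [hermiteLp, inner_gaussLp_hermiteLp, hermiteCoeff]
  have : (fun x => (√(hermiteNorm i))⁻¹ * (hermiteH i).eval x * (hermiteH j).eval x) =
      fun x => (√(hermiteNorm i))⁻¹ * ((hermiteH i).eval x * (hermiteH j).eval x) := by
    ext x; ring
  rw [this, gaussInt_const_mul]
  split_ifs with h
  · subst h
    rw [gaussInt_hermiteH_mul_self, ← mul_assoc, ← mul_inv,
      Real.mul_self_sqrt (hermiteNorm_pos i).le, inv_mul_cancel₀ (hermiteNorm_pos i).ne']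
  · rw [gaussInt_hermiteH_mul_of_ne h]; simp

theorem span_hermiteLp_orthogonal : (Submodule.span ℝ (Set.range hermiteLp))ᗮ = ⊥ := by
  rw [Submodule.eq_bot_iff]
  intro F hF
  rw [Submodule.mem_orthogonal'] at hF
  have hinner : ∀ (g : ℝ → ℝ) (hg : Tame g), inner ℝ F (gaussLp g hg) =
      ∫ x, F x * (g x * Real.exp (-x ^ 2 / 2)) := by
    intro g hg
    rw [L2.inner_def]
    refine integral_congr_ae ?_
    filter_upwards [hg.memLp.coeFn_toLp] with x h1
    simp only [gaussLp]
    rw [h1]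
    simp [mul_comm]
  have hint : ∀ (g : ℝ → ℝ), Tame g →
      Integrable fun x => F x * (g x * Real.exp (-x ^ 2 / 2)) := fun g hg =>
    (Lp.memLp F).integrable_mul hg.memLp
  have hH : ∀ j : ℕ, ∫ x, F x * ((hermiteH j).eval x * Real.exp (-x ^ 2 / 2)) = 0 := by
    intro j
    have h1 := hF _ (Submodule.subset_span ⟨j, rfl⟩)
    rw [hermiteLp, hinner] at h1
    have h2 : ∀ x, F x * ((√(hermiteNorm j))⁻¹ * (hermiteH j).eval x * Real.exp (-x ^ 2 / 2)) =
        (√(hermiteNorm j))⁻¹ * (F x * ((hermiteH j).eval x * Real.exp (-x ^ 2 / 2))) := by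
      intro x; ring
    simp only [h2] at h1
    rw [integral_const_mul] at h1
    exact (mul_eq_zero.1 h1).resolve_left
      (inv_ne_zero (Real.sqrt_ne_zero'.2 (hermiteNorm_pos j)))
  refine eq_zero_of_forall_inner_pow_eq_zero F fun l => ?_
  -- only the expansion of `x ^ l` itself matters here, so the modulus `H_0` is arbitrary
  obtain ⟨a, -, -, -, -, -, ha, -⟩ := exists_hermite_coeffs 0 l
  have h3 : ∀ x, F x * (x ^ l * Real.exp (-x ^ 2 / 2)) = ∑ j ∈ Finset.range (l + 1),
      a j * (F x * ((hermiteH j).eval x * Real.exp (-x ^ 2 / 2))) := by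
    intro x
    rw [ha x, Finset.sum_mul, Finset.mul_sum]
    exact Finset.sum_congr rfl fun j _ => by ring
  simp only [h3]
  rw [integral_finsetSum _ fun j _ => (hint _ (Tame.eval _)).const_mul _]
  exact Finset.sum_eq_zero fun j _ => by rw [integral_const_mul, hH, mul_zero]

/-- Parseval's identity for Hermite expansions. -/
theorem hasSum_hermiteCoeff_sq {g : ℝ → ℝ} (hg : Tame g) :
    HasSum (fun j => hermiteCoeff g j ^ 2 / hermiteNorm j) (gaussInt fun x => g x ^ 2) := by
  let b := HilbertBasis.mkOfOrthogonalEqBot orthonormal_hermiteLp span_hermiteLp_orthogonal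
  have hb : ∀ j, b j = hermiteLp j := fun j =>
    congrFun (HilbertBasis.coe_mkOfOrthogonalEqBot orthonormal_hermiteLp _) j
  have h := b.hasSum_inner_mul_inner (gaussLp g hg) (gaussLp g hg)
  rw [inner_gaussLp] at h
  simp only [pow_two]
  refine h.congr_fun fun j => ?_
  rw [hb, inner_gaussLp_hermiteLp, real_inner_comm, inner_gaussLp_hermiteLp]
  have := Real.mul_self_sqrt (hermiteNorm_pos j).le
  rw [mul_mul_mul_comm, ← mul_inv, this]
  ring

/-! ### Hermite expansions and derivatives -/

/-- The mean value inequality on the interval between `0` and `x`. -/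
theorem abs_le_of_hasDerivAt {g g' : ℝ → ℝ} (hd : ∀ x, HasDerivAt g (g' x) x) {x B : ℝ}
    (hB : ∀ y, |y| ≤ |x| → |g' y| ≤ B) : |g x| ≤ |g 0| + B * |x| := by
  have h2 : ‖g x - g 0‖ ≤ B * ‖x - 0‖ := by
    refine Convex.norm_image_sub_le_of_norm_hasDerivWithin_le (f := g) (f' := g')
      (fun y _ => (hd y).hasDerivWithinAt) (fun y hy => hB y ?_) (convex_uIcc 0 x)
      Set.left_mem_uIcc Set.right_mem_uIcc
    rcases Set.mem_uIcc.1 hy with ⟨h3, h4⟩ | ⟨h3, h4⟩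
    · rw [abs_of_nonneg h3, abs_of_nonneg (h3.trans h4)]; exact h4
    · rw [abs_of_nonpos h4, abs_of_nonpos (h3.trans h4)]; linarith
  rw [Real.norm_eq_abs, sub_zero, Real.norm_eq_abs] at h2
  have := abs_add_le (g 0) (g x - g 0)
  rw [add_sub_cancel] at this
  linarith

theorem abs_le_one_add_sq (x : ℝ) : |x| ≤ 1 + x ^ 2 := by
  nlinarith [sq_nonneg (|x| - 1), sq_abs x, abs_nonneg x]

theorem Tame.of_hasDerivAt {g g' : ℝ → ℝ} (hd : ∀ x, HasDerivAt g (g' x) x) (hg' : Tame g') :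
    Tame g := by
  obtain ⟨C, d, hC, h⟩ := hg'.growth_nonneg
  refine ⟨continuous_iff_continuousAt.2 fun x => (hd x).continuousAt, ?_⟩
  refine ⟨|g 0| + C, d + 1, fun x => ?_⟩
  have h1 : (1 : ℝ) ≤ 1 + x ^ 2 := by nlinarith [sq_nonneg x]
  have h2 : |g x| ≤ |g 0| + C * (1 + x ^ 2) ^ d * |x| := by
    refine abs_le_of_hasDerivAt hd fun y hy => ?_
    refine (h y).trans (mul_le_mul_of_nonneg_left ?_ hC)
    refine pow_le_pow_left₀ (by positivity) ?_ d
    have := sq_le_sq.2 hy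
    linarith
  calc |g x| ≤ |g 0| + C * (1 + x ^ 2) ^ d * |x| := h2
    _ ≤ |g 0| * (1 + x ^ 2) ^ (d + 1) + C * (1 + x ^ 2) ^ d * (1 + x ^ 2) := by
        refine add_le_add (le_mul_of_one_le_right (abs_nonneg _) (one_le_pow₀ h1)) ?_
        exact mul_le_mul_of_nonneg_left (abs_le_one_add_sq x) (by positivity)
    _ = _ := by ring

/-- The functions `G 0, …, G k` are tame and each is the derivative of the preceding one. -/
structure TameChain (k : ℕ) (G : ℕ → ℝ → ℝ) : Prop where
  hasDerivAt : ∀ a < k, ∀ x, HasDerivAt (G a) (G (a + 1) x) x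
  tame : ∀ a ≤ k, Tame (G a)

theorem TameChain.of_bounded {k : ℕ} {G : ℕ → ℝ → ℝ}
    (hd : ∀ a < k, ∀ x, HasDerivAt (G a) (G (a + 1) x) x) (hc : Continuous (G k)) {M : ℝ}
    (hM : ∀ x, |G k x| ≤ M) : TameChain k G := by
  refine ⟨hd, fun a ha => ?_⟩
  induction ha using Nat.decreasingInduction with
  | self => exact ⟨hc, M, 0, by simpa using hM⟩
  | of_succ a ha ih => exact Tame.of_hasDerivAt (hd a ha) ih

/-- Differentiation shifts the Hermite coefficients. -/
theorem TameChain.hermiteCoeff_eq {k : ℕ} {G : ℕ → ℝ → ℝ} (hG : TameChain k G) (j : ℕ) :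
    ∀ a ≤ k, hermiteCoeff (G a) j = hermiteCoeff (G 0) (j + a) := by
  intro a
  induction a generalizing j with
  | zero => intro _; rfl
  | succ a ih =>
    intro ha
    have h := gaussInt_mul_hermiteH_succ j (hG.hasDerivAt a (by omega)) (hG.tame a (by omega))
      (hG.tame (a + 1) ha)
    rw [hermiteCoeff, ← h]
    have h2 := ih (j + 1) (by omega)
    rw [hermiteCoeff] at h2
    rw [h2]; congr 1; omega

theorem tameChain_poly (k : ℕ) (P : ℝ[X]) :
    TameChain k fun a x => (Polynomial.derivative^[a] P).eval x :=
  ⟨fun a _ x => by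
    rw [Function.iterate_succ_apply']; exact Polynomial.hasDerivAt _ x, fun a _ => Tame.eval _⟩

theorem TameChain.sub {k : ℕ} {F G : ℕ → ℝ → ℝ} (hF : TameChain k F) (hG : TameChain k G) :
    TameChain k fun a x => F a x - G a x :=
  ⟨fun a ha x => (hF.hasDerivAt a ha x).sub (hG.hasDerivAt a ha x),
    fun a ha => (hF.tame a ha).sub (hG.tame a ha)⟩

/-- The Gaussian Poincaré inequality for functions orthogonal to polynomials of degree `< m`. -/
theorem gaussInt_sq_le_of_hermiteCoeff_eq_zero {g g' : ℝ → ℝ}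
    (hd : ∀ x, HasDerivAt g (g' x) x) (hg : Tame g) (hg' : Tame g') {m : ℕ} (hm : 0 < m)
    (h : ∀ j < m, hermiteCoeff g j = 0) :
    gaussInt (fun x => g x ^ 2) ≤ (m : ℝ)⁻¹ * gaussInt (fun x => g' x ^ 2) := by
  have h1 := (hasSum_nat_add_iff' 1).2 (hasSum_hermiteCoeff_sq hg)
  simp only [Finset.sum_range_one, h 0 hm] at h1
  simp only [ne_eq, OfNat.ofNat_ne_zero, not_false_eq_true, zero_pow, zero_div, sub_zero] at h1
  refine hasSum_le (fun j => ?_) h1 ((hasSum_hermiteCoeff_sq hg').mul_left (m : ℝ)⁻¹)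
  have hmr : (0 : ℝ) < m := by exact_mod_cast hm
  have hN := hermiteNorm_pos j
  by_cases hj : j + 1 < m
  · rw [h _ hj]; simp; positivity
  · have h2 : hermiteCoeff g (j + 1) = hermiteCoeff g' j := gaussInt_mul_hermiteH_succ j hd hg hg'
    rw [h2, hermiteNorm_succ, mul_comm _ (hermiteNorm j), ← div_div, div_eq_inv_mul _ (2 * _)]
    refine mul_le_mul_of_nonneg_right (inv_anti₀ hmr ?_) (by positivity)
    have : (m : ℝ) ≤ j + 1 := by exact_mod_cast (by omega : m ≤ j + 1)
    linarith

theorem hermiteCoeff_eq_zero_of_degree_lt {P : ℝ[X]} {j : ℕ} (h : P.degree < j) :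
    hermiteCoeff (fun x => P.eval x) j = 0 :=
  gaussInt_poly_mul_hermiteH_eq_zero j P h

/-- The partial sum of degree `< m` of the Hermite expansion. -/
def hermitePartialSum (g : ℝ → ℝ) (m : ℕ) : ℝ[X] :=
  ∑ j ∈ Finset.range m, Polynomial.C (hermiteCoeff g j / hermiteNorm j) * hermiteH j

theorem degree_hermitePartialSum (g : ℝ → ℝ) (m : ℕ) : (hermitePartialSum g m).degree < m := by
  refine Polynomial.degree_sum_le _ _ |>.trans_lt ?_
  rw [Finset.sup_lt_iff (WithBot.bot_lt_coe _)]
  intro j hj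
  by_cases hc : hermiteCoeff g j / hermiteNorm j = 0
  · simp [hc]
  rw [Polynomial.degree_C_mul hc, Polynomial.degree_eq_natDegree (hermiteH_ne_zero j), natDegree_hermiteH]
  exact_mod_cast Finset.mem_range.1 hj

theorem hermiteCoeff_sub_hermitePartialSum {g : ℝ → ℝ} (hg : Tame g) {m j : ℕ} (hj : j < m) :
    hermiteCoeff (fun x => g x - (hermitePartialSum g m).eval x) j = 0 := by
  have h1 : hermiteCoeff (fun x => (hermitePartialSum g m).eval x) j = hermiteCoeff g j := by
    have h2 : ∀ x, (hermitePartialSum g m).eval x * (hermiteH j).eval x =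
        ∑ i ∈ Finset.range m, hermiteCoeff g i / hermiteNorm i *
          ((hermiteH i).eval x * (hermiteH j).eval x) := by
      intro x
      rw [hermitePartialSum, Polynomial.eval_finsetSum, Finset.sum_mul]
      refine Finset.sum_congr rfl fun i _ => ?_
      simp; ring
    conv_lhs => rw [hermiteCoeff, show (fun x => _) = _ from funext h2]
    rw [gaussInt_sum _ fun i _ => ((Tame.eval _).mul (Tame.eval _)).const_mul _,
      Finset.sum_eq_single j]
    · rw [gaussInt_const_mul, gaussInt_hermiteH_mul_self, div_mul_cancel₀]
      exact (hermiteNorm_pos j).ne'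
    · intro i _ hij
      rw [gaussInt_const_mul, gaussInt_hermiteH_mul_of_ne hij, mul_zero]
    · intro h; exact absurd (Finset.mem_range.2 hj) h
  have h3 : hermiteCoeff (fun x => g x - (hermitePartialSum g m).eval x) j =
      hermiteCoeff g j - hermiteCoeff (fun x => (hermitePartialSum g m).eval x) j := by
    simp only [hermiteCoeff, sub_mul]
    exact gaussInt_sub (hg.mul (Tame.eval _)) ((Tame.eval _).mul (Tame.eval _))
  rw [h3, h1, sub_self]

/-- The remainder of the Hermite expansion of degree `< 2 n`, with its derivatives: the Poincaré
inequality applies `k - a` times to the `a`-th derivative, and the `k`-th derivative has no greater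
norm than `G k`, being a remainder of its expansion. -/
theorem TameChain.exists_hermite_remainder {k n : ℕ} {G : ℕ → ℝ → ℝ} (hG : TameChain k G)
    (hn : 0 < n) (hkn : k ≤ n) : ∃ (P : ℝ[X]) (R : ℕ → ℝ → ℝ), P.degree < (2 * n : ℕ) ∧
      TameChain k R ∧ (∀ x, G 0 x = R 0 x + P.eval x) ∧
      ∀ a ≤ k, gaussInt (fun x => R a x ^ 2) ≤
        ((n : ℝ)⁻¹) ^ (k - a) * gaussInt (fun x => G k x ^ 2) := by
  set P := hermitePartialSum (G 0) (2 * n) with hP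
  set R : ℕ → ℝ → ℝ := fun a x => G a x - (Polynomial.derivative^[a] P).eval x with hR
  have hPc := tameChain_poly k P
  have hRc : TameChain k R := hG.sub hPc
  have hzero : ∀ a ≤ k, ∀ j < 2 * n - a, hermiteCoeff (R a) j = 0 := by
    intro a ha j hj
    rw [hRc.hermiteCoeff_eq j a ha]
    exact hermiteCoeff_sub_hermitePartialSum (hG.tame 0 (Nat.zero_le _)) (by omega)
  refine ⟨P, R, degree_hermitePartialSum _ _, hRc, fun x => by simp [hR], fun a ha => ?_⟩
  induction ha using Nat.decreasingInduction with
  | self =>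
    rw [Nat.sub_self, pow_zero, one_mul]
    refine hasSum_le (fun j => ?_) (hasSum_hermiteCoeff_sq (hRc.tame k le_rfl))
      (hasSum_hermiteCoeff_sq (hG.tame k le_rfl))
    refine div_le_div_of_nonneg_right ?_ (hermiteNorm_pos j).le
    by_cases hj : j < 2 * n - k
    · rw [hzero k le_rfl j hj, zero_pow two_ne_zero]; positivity
    · have h1 : hermiteCoeff (fun x => (Polynomial.derivative^[k] P).eval x) j = 0 := by
        rw [hPc.hermiteCoeff_eq j k le_rfl]
        refine hermiteCoeff_eq_zero_of_degree_lt ((degree_hermitePartialSum _ _).trans_le ?_)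
        exact_mod_cast (by omega : 2 * n ≤ j + k)
      have h2 : hermiteCoeff (R k) j = hermiteCoeff (G k) j -
          hermiteCoeff (fun x => (Polynomial.derivative^[k] P).eval x) j := by
        simp only [hermiteCoeff, hR, sub_mul]
        exact gaussInt_sub ((hG.tame k le_rfl).mul (Tame.eval _)) ((Tame.eval _).mul (Tame.eval _))
      rw [h2, h1, sub_zero]
  | of_succ a ha ih =>
    have h1 := gaussInt_sq_le_of_hermiteCoeff_eq_zero (hRc.hasDerivAt a ha)
      (hRc.tame a ha.le) (hRc.tame (a + 1) ha) (m := 2 * n - a) (by omega) (hzero a ha.le)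
    have hnr : (0 : ℝ) < n := by exact_mod_cast hn
    have h2 : (((2 * n - a : ℕ) : ℝ))⁻¹ ≤ (n : ℝ)⁻¹ :=
      inv_anti₀ hnr (by exact_mod_cast (by omega : n ≤ 2 * n - a))
    have h3 : 0 ≤ gaussInt (fun x => R (a + 1) x ^ 2) := gaussInt_nonneg fun x => sq_nonneg _
    calc gaussInt (fun x => R a x ^ 2)
        ≤ (n : ℝ)⁻¹ * gaussInt (fun x => R (a + 1) x ^ 2) :=
          h1.trans (mul_le_mul_of_nonneg_right h2 h3)
      _ ≤ (n : ℝ)⁻¹ * (((n : ℝ)⁻¹) ^ (k - (a + 1)) * gaussInt (fun x => G k x ^ 2)) :=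
          mul_le_mul_of_nonneg_left ih (by positivity)
      _ = _ := by rw [← mul_assoc, ← pow_succ']; congr 2; omega

/-! ### The error of Gauss–Hermite quadrature -/

/-- The Cauchy–Schwarz inequality, in the form `2 |r| p v ≤ A⁻¹ (r p)² + A v²` with
`p = exp (-x²/2)` and `v = exp (-x²/4)`. -/
theorem integral_abs_mul_exp_le {r : ℝ → ℝ} (hr : Tame r) {A : ℝ} (hA : 0 ≤ A)
    (h : gaussInt (fun x => r x ^ 2) ≤ A ^ 2) :
    ∫ x, |r x| * Real.exp (-(3 / 4 * x ^ 2)) ≤ 2 * A := by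
  rcases hA.eq_or_lt with rfl | hA
  · have h0 : gaussInt (fun x => r x ^ 2) = 0 :=
      le_antisymm (by simpa using h) (gaussInt_nonneg fun x => sq_nonneg _)
    have h1 : ∀ x, r x = 0 := fun x => by
      simpa using eq_zero_of_gaussInt_eq_zero (hr.pow 2) (fun x => sq_nonneg _) h0 x
    simp [h1]
  · have hi1 : Integrable fun x => (2 * A)⁻¹ * (r x ^ 2 * Real.exp (-x ^ 2)) :=
      (hr.pow 2).integrable.const_mul _
    have hi2 : Integrable fun x : ℝ => A / 2 * Real.exp (-(1 / 2) * x ^ 2) :=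
      (integrable_exp_neg_mul_sq (by norm_num)).const_mul _
    have h1 : ∫ x, |r x| * Real.exp (-(3 / 4 * x ^ 2)) ≤
        ∫ x, ((2 * A)⁻¹ * (r x ^ 2 * Real.exp (-x ^ 2)) +
          A / 2 * Real.exp (-(1 / 2) * x ^ 2)) := by
      refine integral_mono (hr.abs.integrable_exp (by norm_num)) (hi1.add hi2) fun x => ?_
      have e1 : Real.exp (-x ^ 2) = Real.exp (-x ^ 2 / 2) ^ 2 := by
        rw [← Real.exp_nat_mul]; push_cast; ring_nf
      have e2 : Real.exp (-(1 / 2) * x ^ 2) = Real.exp (-x ^ 2 / 4) ^ 2 := by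
        rw [← Real.exp_nat_mul]; push_cast; ring_nf
      have e3 : Real.exp (-(3 / 4 * x ^ 2)) = Real.exp (-x ^ 2 / 2) * Real.exp (-x ^ 2 / 4) := by
        rw [← Real.exp_add]; ring_nf
      dsimp only
      rw [e1, e2, e3, ← sq_abs (r x)]
      generalize |r x| = w
      generalize Real.exp (-x ^ 2 / 2) = p
      generalize Real.exp (-x ^ 2 / 4) = v
      have : (2 * A)⁻¹ * (w ^ 2 * p ^ 2) + A / 2 * v ^ 2 - w * (p * v) =
          (2 * A)⁻¹ * (w * p - A * v) ^ 2 := by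
        field_simp; ring
      nlinarith [mul_nonneg (inv_nonneg.2 (by positivity : 0 ≤ 2 * A)) (sq_nonneg (w * p - A * v))]
    refine h1.trans ?_
    rw [integral_add hi1 hi2, integral_const_mul, integral_const_mul, integral_gaussian]
    have h2 : √(Real.pi / (1 / 2)) ≤ 3 := by
      rw [Real.sqrt_le_left (by norm_num)]; linarith [Real.pi_le_four]
    have h3 : (2 * A)⁻¹ * gaussInt (fun x => r x ^ 2) ≤ A / 2 := by
      calc _ ≤ (2 * A)⁻¹ * A ^ 2 := mul_le_mul_of_nonneg_left h (by positivity)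
        _ = _ := by field_simp
    have h4 : A / 2 * √(Real.pi / (1 / 2)) ≤ A / 2 * 3 :=
      mul_le_mul_of_nonneg_left h2 (by positivity)
    have h5 : (2 * A)⁻¹ * ∫ x, r x ^ 2 * Real.exp (-x ^ 2) ≤ A / 2 := h3
    linarith

/-- A value of `r` is bounded by the average of `|r| + h |r'|` over an interval of length `h`. -/
theorem mul_abs_le_integral {r r' : ℝ → ℝ} (hd : ∀ x, HasDerivAt r (r' x) x)
    (hc : Continuous r) (hc' : Continuous r') {h : ℝ} (hh : 0 < h) (x : ℝ) :
    h * |r x| ≤ ∫ s, (if |x - s| ≤ h then 1 else 0) * (|r s| + h * |r' s|) := by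
  set J := ∫ s in x..x + h, |r' s| with hJ
  have hxh : x ≤ x + h := by linarith
  have hii : ∀ {g : ℝ → ℝ}, Continuous g → ∀ a b, IntervalIntegrable g volume a b :=
    fun hg a b => hg.intervalIntegrable a b
  have h1 : ∀ s ∈ Set.Icc x (x + h), |r x| ≤ |r s| + J := by
    intro s hs
    have h2 : r s - r x = ∫ t in x..s, r' t :=
      (intervalIntegral.integral_eq_sub_of_hasDerivAt (fun t _ => hd t) (hii hc' _ _)).symm
    have h3 : |r s - r x| ≤ J := by
      rw [h2]
      refine (intervalIntegral.abs_integral_le_integral_abs hs.1).trans ?_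
      exact intervalIntegral.integral_mono_interval le_rfl hs.1 hs.2
        (ae_of_all _ fun t => abs_nonneg _) (hii hc'.abs _ _)
    have := abs_sub_abs_le_abs_sub (r x) (r s)
    rw [abs_sub_comm] at h3
    linarith
  have h4 : ∫ _s in x..x + h, |r x| ≤ ∫ s in x..x + h, (|r s| + J) :=
    intervalIntegral.integral_mono_on hxh (hii continuous_const _ _)
      (hii (hc.abs.add continuous_const) _ _) h1
  have h5 : ∫ s in x..x + h, (|r s| + J) = ∫ s in x..x + h, (|r s| + h * |r' s|) := by
    rw [intervalIntegral.integral_add (hii hc.abs _ _) (hii continuous_const _ _),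
      intervalIntegral.integral_add (hii hc.abs _ _) (hii (show Continuous fun s => h * |r' s| from continuous_const.mul hc'.abs) _ _),
      intervalIntegral.integral_const_mul, ← hJ]
    simp
  have h6 : ∫ _s in x..x + h, |r x| = h * |r x| := by simp
  rw [← h6]
  refine h4.trans ?_
  rw [h5, intervalIntegral.integral_of_le hxh]
  have hρ : Continuous fun s => |r s| + h * |r' s| := hc.abs.add (continuous_const.mul hc'.abs)
  have h7 : ∀ s, (if |x - s| ≤ h then 1 else 0) * (|r s| + h * |r' s|) =
      (Set.Icc (x - h) (x + h)).indicator (fun s => |r s| + h * |r' s|) s := by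
    intro s
    rw [Set.indicator_apply]
    have : |x - s| ≤ h ↔ s ∈ Set.Icc (x - h) (x + h) := by
      rw [abs_le, Set.mem_Icc]; constructor <;> rintro ⟨_, _⟩ <;> constructor <;> linarith
    simp only [this]
    split_ifs <;> simp
  simp only [h7]
  rw [integral_indicator measurableSet_Icc]
  refine setIntegral_mono_set (hρ.integrableOn_Icc) (ae_of_all _ fun s => ?_) ?_
  · dsimp only; positivity
  · refine LE.le.eventuallyLE fun s hs => ?_
    exact ⟨by linarith [hs.1], hs.2⟩

theorem integrable_ite_mul {ρ : ℝ → ℝ} (hρ : Continuous ρ) (h x : ℝ) :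
    Integrable fun s => (if |x - s| ≤ h then 1 else 0) * ρ s := by
  have h7 : (fun s => (if |x - s| ≤ h then 1 else 0) * ρ s) =
      (Set.Icc (x - h) (x + h)).indicator ρ := by
    ext s
    rw [Set.indicator_apply]
    have : |x - s| ≤ h ↔ s ∈ Set.Icc (x - h) (x + h) := by
      rw [abs_le, Set.mem_Icc]; constructor <;> rintro ⟨_, _⟩ <;> constructor <;> linarith
    simp only [this]
    split_ifs <;> simp
  rw [h7]
  exact hρ.integrableOn_Icc.integrable_indicator measurableSet_Icc

/-- The error of Gauss–Hermite quadrature with `n = 4 m + 3` nodes is `O(n^(-k/2))` for functions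
with bounded `k`-th derivative. The numbers `2 ^ i - 1`, `i ≥ 2`, are of the form `4 m + 3`. -/
theorem exists_hermiteQuad_error_le : ∃ C : ℝ, 0 ≤ C ∧ ∀ (k m : ℕ), 0 < k → k ≤ 4 * m + 3 →
    ∀ (G : ℕ → ℝ → ℝ) (M : ℝ), (∀ a < k, ∀ x, HasDerivAt (G a) (G (a + 1) x) x) →
      Continuous (G k) → (∀ x, |G k x| ≤ M) →
      |gaussInt (G 0) - hermiteQuad (4 * m + 3) (G 0)| ≤
        C * M * ((√((4 * m + 3 : ℕ) : ℝ))⁻¹) ^ k := by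
  obtain ⟨C, hC, hloc⟩ := exists_hermiteQuad_local_le
  refine ⟨4 + 8 * C, by positivity, fun k m hk hkn G M hd hc hM => ?_⟩
  have hM0 : 0 ≤ M := (abs_nonneg _).trans (hM 0)
  have hG := TameChain.of_bounded hd hc hM
  set n := 4 * m + 3 with hn
  set h := (√(n : ℝ))⁻¹ with hh
  have hn0 : (0 : ℝ) < n := by rw [hn]; positivity
  have hh0 : 0 < h := by rw [hh]; positivity
  have hh2 : h ^ 2 = (n : ℝ)⁻¹ := by rw [hh, inv_pow, Real.sq_sqrt hn0.le]
  obtain ⟨P, R, hP, hR, hGR, hbound⟩ := hG.exists_hermite_remainder (n := n) (by omega) hkn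
  have hGk : gaussInt (fun x => G k x ^ 2) ≤ (2 * M) ^ 2 := by
    have h1 : gaussInt (fun x => G k x ^ 2) ≤ gaussInt (fun _ => M ^ 2) :=
      gaussInt_mono ((hG.tame k le_rfl).pow 2) (Tame.const _) fun x => by
        rw [← sq_abs]; exact pow_le_pow_left₀ (abs_nonneg _) (hM x) 2
    rw [gaussInt_const] at h1
    have h2 : √Real.pi ≤ 4 := by
      rw [Real.sqrt_le_left (by norm_num)]; linarith [Real.pi_le_four]
    nlinarith [sq_nonneg M]
  have hRa : ∀ a ≤ k, gaussInt (fun x => R a x ^ 2) ≤ (h ^ (k - a) * (2 * M)) ^ 2 := by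
    intro a ha
    refine (hbound a ha).trans ?_
    rw [mul_pow, ← pow_mul, mul_comm (k - a), pow_mul, hh2]
    exact mul_le_mul_of_nonneg_left hGk (by positivity)
  have hR0 := hR.tame 0 (Nat.zero_le _)
  have hR1 := hR.tame 1 hk
  have hI0 := integral_abs_mul_exp_le hR0 (by positivity) (hRa 0 (Nat.zero_le _))
  have hI1 := integral_abs_mul_exp_le hR1 (by positivity) (hRa 1 hk)
  rw [Nat.sub_zero] at hI0
  -- the rule is exact on the polynomial part
  have herr : gaussInt (G 0) - hermiteQuad n (G 0) = gaussInt (R 0) - hermiteQuad n (R 0) := by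
    rw [show G 0 = fun x => R 0 x + P.eval x from funext hGR,
      gaussInt_add hR0 (Tame.eval _), hermiteQuad_add, hermiteQuad_eq_gaussInt n P hP]
    ring
  have hgauss : |gaussInt (R 0)| ≤ 2 * (h ^ k * (2 * M)) := by
    refine (abs_gaussInt_le _).trans (le_trans ?_ hI0)
    refine integral_mono hR0.abs.integrable (hR0.abs.integrable_exp (by norm_num)) fun x => ?_
    refine mul_le_mul_of_nonneg_left (Real.exp_le_exp.2 ?_) (abs_nonneg _)
    nlinarith [sq_nonneg x]
  have hρ : Continuous fun s => |R 0 s| + h * |R 1 s| :=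
    hR0.continuous.abs.add (continuous_const.mul hR1.continuous.abs)
  have hquad : |hermiteQuad n (R 0)| ≤ C * (4 * (h ^ k * (2 * M))) := by
    refine (abs_hermiteQuad_le n _).trans ?_
    -- average over `s`, then exchange the rule with the integral over `s`
    have h1 : h * hermiteQuad n (fun x => |R 0 x|) ≤
        ∫ s, hermiteQuad n (fun x => if |x - s| ≤ h then 1 else 0) *
          (|R 0 s| + h * |R 1 s|) := by
      rw [← hermiteQuad_const_mul]
      refine (hermiteQuad_mono n fun x _ => mul_abs_le_integral (hR.hasDerivAt 0 hk)
        hR0.continuous hR1.continuous hh0 x).trans (le_of_eq ?_)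
      simp only [hermiteQuad, Finset.sum_mul]
      rw [integral_finsetSum]
      · refine Finset.sum_congr rfl fun x _ => ?_
        rw [← integral_const_mul]
        congr 1; ext s; ring
      · intro x _
        simp only [mul_assoc]
        exact (integrable_ite_mul hρ h x).const_mul _
    have hi0 : Integrable fun s => |R 0 s| * Real.exp (-(3 / 4 * s ^ 2)) :=
      hR0.abs.integrable_exp (by norm_num)
    have hi1 : Integrable fun s => |R 1 s| * Real.exp (-(3 / 4 * s ^ 2)) :=
      hR1.abs.integrable_exp (by norm_num)
    have h2 : ∫ s, hermiteQuad n (fun x => if |x - s| ≤ h then 1 else 0) *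
          (|R 0 s| + h * |R 1 s|) ≤
        ∫ s, C * h * (|R 0 s| * Real.exp (-(3 / 4 * s ^ 2)) +
          h * (|R 1 s| * Real.exp (-(3 / 4 * s ^ 2)))) := by
      refine integral_mono_of_nonneg (ae_of_all _ fun s => ?_)
        ((hi0.add (hi1.const_mul h)).const_mul _) (ae_of_all _ fun s => ?_)
      · refine mul_nonneg (Finset.sum_nonneg fun x hx =>
          mul_nonneg (hermiteWeight_nonneg n hx) ?_) (by positivity)
        dsimp only; split_ifs <;> norm_num
      · refine (mul_le_mul_of_nonneg_right (hloc m s) (by positivity)).trans (le_of_eq ?_)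
        dsimp only
        ring
    have h3 := h1.trans h2
    rw [integral_const_mul, integral_add hi0 (hi1.const_mul h), integral_const_mul] at h3
    have h4 : h * hermiteQuad n (fun x => |R 0 x|) ≤ h * (C * (4 * (h ^ k * (2 * M)))) := by
      refine h3.trans ?_
      have h5 : h * ∫ s, |R 1 s| * Real.exp (-(3 / 4 * s ^ 2)) ≤ 2 * (h ^ k * (2 * M)) := by
        refine (mul_le_mul_of_nonneg_left hI1 hh0.le).trans (le_of_eq ?_)
        obtain ⟨k, rfl⟩ := Nat.exists_eq_succ_of_ne_zero hk.ne'
        simp only [Nat.succ_eq_add_one, Nat.add_sub_cancel, pow_succ]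
        ring
      calc _ ≤ C * h * (2 * (h ^ k * (2 * M)) + 2 * (h ^ k * (2 * M))) :=
            mul_le_mul_of_nonneg_left (add_le_add hI0 h5) (by positivity)
        _ = _ := by ring
    exact le_of_mul_le_mul_left h4 hh0
  rw [herr]
  refine (abs_sub _ _).trans ((add_le_add hgauss hquad).trans (le_of_eq ?_))
  ring

/-! ### Splitting off the last variable -/

theorem partialDeriv_castSucc_snoc {q : ℕ} (j : Fin q) (g : (Fin (q + 1) → ℝ) → ℝ) (t : ℝ) :
    (fun y : Fin q → ℝ => partialDeriv j.castSucc g (Fin.snoc y t : Fin (q + 1) → ℝ)) =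
      partialDeriv j fun y : Fin q → ℝ => g (Fin.snoc y t : Fin (q + 1) → ℝ) := by
  ext y
  simp only [partialDeriv]
  rw [Fin.snoc_castSucc (α := fun _ => ℝ)]
  congr 1
  ext s
  rw [Fin.snoc_update (α := fun _ => ℝ)]

theorem iterate_partialDeriv_castSucc_snoc {q : ℕ} (j : Fin q) (g : (Fin (q + 1) → ℝ) → ℝ)
    (t : ℝ) (a : ℕ) :
    (fun y : Fin q → ℝ => (partialDeriv j.castSucc)^[a] g (Fin.snoc y t : Fin (q + 1) → ℝ)) =
      (partialDeriv j)^[a] fun y : Fin q → ℝ => g (Fin.snoc y t : Fin (q + 1) → ℝ) := by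
  induction a with
  | zero => rfl
  | succ a ih =>
    rw [Function.iterate_succ_apply', Function.iterate_succ_apply', ← ih,
      partialDeriv_castSucc_snoc]

/-- The derivatives in the last variable are taken first, so those in the other variables are
derivatives of slices. -/
theorem mixedPartial_snoc {q : ℕ} (α : Fin (q + 1) → ℕ) (f : (Fin (q + 1) → ℝ) → ℝ)
    (y : Fin q → ℝ) (t : ℝ) :
    mixedPartial α f (Fin.snoc y t : Fin (q + 1) → ℝ) =
      mixedPartial (fun j => α j.castSucc) (fun y : Fin q → ℝ =>
        (partialDeriv (Fin.last q))^[α (Fin.last q)] f (Fin.snoc y t : Fin (q + 1) → ℝ)) y := by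
  have key : ∀ (l : List (Fin q)) (g : (Fin (q + 1) → ℝ) → ℝ),
      (fun y : Fin q → ℝ => l.foldr (fun j g => (partialDeriv j.castSucc)^[α j.castSucc] g) g
        (Fin.snoc y t : Fin (q + 1) → ℝ)) =
      l.foldr (fun j g => (partialDeriv j)^[α j.castSucc] g)
        (fun y : Fin q → ℝ => g (Fin.snoc y t : Fin (q + 1) → ℝ)) := by
    intro l g
    induction l with
    | nil => rfl
    | cons j l ih =>
      simp only [List.foldr_cons]
      rw [← ih, iterate_partialDeriv_castSucc_snoc]
  rw [mixedPartial, List.finRange_succ_last, List.foldr_append, List.foldr_map]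
  exact congrFun (key _ _) y

theorem mixedPartial_zero {q : ℕ} (f : (Fin q → ℝ) → ℝ) : mixedPartial 0 f = f := by
  unfold mixedPartial
  generalize List.finRange q = l
  induction l with
  | nil => rfl
  | cons j l ih => rw [List.foldr_cons, ih]; rfl

/-- The multi-index `(0, …, 0, a)`. -/
def lastIndex (q a : ℕ) : Fin (q + 1) → ℕ := (Fin.snoc (0 : Fin q → ℕ) a : Fin (q + 1) → ℕ)

theorem lastIndex_castSucc {q : ℕ} (a : ℕ) (j : Fin q) : lastIndex q a j.castSucc = 0 := by
  simp [lastIndex]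

theorem lastIndex_last (q a : ℕ) : lastIndex q a (Fin.last q) = a := by
  simp [lastIndex]

theorem lastIndex_le {q a k : ℕ} (h : a ≤ k) (i : Fin (q + 1)) : lastIndex q a i ≤ k := by
  induction i using Fin.lastCases with
  | last => rwa [lastIndex_last]
  | cast j => rw [lastIndex_castSucc]; exact Nat.zero_le _

theorem mixedPartial_lastIndex {q : ℕ} (a : ℕ) (f : (Fin (q + 1) → ℝ) → ℝ) :
    mixedPartial (lastIndex q a) f = (partialDeriv (Fin.last q))^[a] f := by
  ext x
  rw [← Fin.snoc_init_self (α := fun _ => ℝ) x, mixedPartial_snoc, lastIndex_last]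
  simp only [lastIndex_castSucc]
  exact congrFun (mixedPartial_zero _) _

/-- The slice at height `t` in the last variable of the `a`-th derivative in that variable. -/
def lastSlice {q : ℕ} (f : (Fin (q + 1) → ℝ) → ℝ) (a : ℕ) (t : ℝ) (y : Fin q → ℝ) : ℝ :=
  (partialDeriv (Fin.last q))^[a] f (Fin.snoc y t : Fin (q + 1) → ℝ)

theorem mixedPartial_lastSlice {q : ℕ} (f : (Fin (q + 1) → ℝ) → ℝ) (a : ℕ) (t : ℝ)
    (α : Fin q → ℕ) (y : Fin q → ℝ) : mixedPartial α (lastSlice f a t) y =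
      mixedPartial (Fin.snoc α a : Fin (q + 1) → ℕ) f (Fin.snoc y t : Fin (q + 1) → ℝ) := by
  rw [mixedPartial_snoc]
  simp only [Fin.snoc_castSucc, Fin.snoc_last]
  rfl

theorem snoc_le {q a k : ℕ} {α : Fin q → ℕ} (hα : ∀ i, α i ≤ k) (ha : a ≤ k) (i : Fin (q + 1)) :
    (Fin.snoc α a : Fin (q + 1) → ℕ) i ≤ k := by
  induction i using Fin.lastCases with
  | last => simpa using ha
  | cast j => simpa using hα j

theorem MemF.lastSlice {q k : ℕ} {f : (Fin (q + 1) → ℝ) → ℝ} (hf : MemF (q + 1) k f) {a : ℕ}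
    (ha : a ≤ k) (t : ℝ) : MemF q k (lastSlice f a t) := by
  refine ⟨fun α hα => ?_, fun α hα j hj y => ?_⟩
  · rw [show mixedPartial α (SparseGH.lastSlice f a t) = _ from
      funext (mixedPartial_lastSlice f a t α)]
    exact (hf.continuous_mixedPartial _ (snoc_le hα ha)).comp
      (Continuous.finSnoc (A := fun _ => ℝ) continuous_id continuous_const)
  · simp only [mixedPartial_lastSlice]
    have h := hf.hasDerivAt_mixedPartial _ (snoc_le hα ha) j.castSucc (by simpa using hj)
      (Fin.snoc y t : Fin (q + 1) → ℝ)
    simp only [Fin.snoc_castSucc, ← Fin.snoc_update (α := fun _ => ℝ),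
      ← Fin.snoc_update (α := fun _ => ℕ)] at h
    exact h

theorem MemF.hasDerivAt_lastSlice {q k : ℕ} {f : (Fin (q + 1) → ℝ) → ℝ} (hf : MemF (q + 1) k f)
    {a : ℕ} (ha : a < k) (y : Fin q → ℝ) (t : ℝ) :
    HasDerivAt (fun t => SparseGH.lastSlice f a t y) (SparseGH.lastSlice f (a + 1) t y) t := by
  have h := hf.hasDerivAt_mixedPartial (lastIndex q a) (lastIndex_le ha.le) (Fin.last q)
    (by rwa [lastIndex_last]) (Fin.snoc y t : Fin (q + 1) → ℝ)
  rw [lastIndex_last] at h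
  have h2 : Function.update (lastIndex q a) (Fin.last q) (a + 1) = lastIndex q (a + 1) := by
    rw [lastIndex, Fin.update_snoc_last (α := fun _ => ℕ)]; rfl
  rw [h2, mixedPartial_lastIndex, mixedPartial_lastIndex] at h
  simp only [Fin.update_snoc_last, Fin.snoc_last] at h
  exact h

theorem MemF.continuous_lastSlice {q k : ℕ} {f : (Fin (q + 1) → ℝ) → ℝ} (hf : MemF (q + 1) k f)
    {a : ℕ} (ha : a ≤ k) (y : Fin q → ℝ) : Continuous fun t => SparseGH.lastSlice f a t y := by
  have h := hf.continuous_mixedPartial (lastIndex q a) (lastIndex_le ha)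
  rw [mixedPartial_lastIndex] at h
  exact h.comp (Continuous.finSnoc (A := fun _ => ℝ) continuous_const continuous_id)

/-! ### Tensor products of finite functionals -/

/-- The tensor product of the functionals `g ↦ ∑ t ∈ S, u j t * g t`. -/
def tensorSum {q : ℕ} (S : Finset ℝ) (u : Fin q → ℝ → ℝ) (f : (Fin q → ℝ) → ℝ) : ℝ :=
  ∑ x ∈ Fintype.piFinset fun _ : Fin q => S, (∏ j, u j (x j)) * f x

theorem sum_piFinset_snoc {q : ℕ} (S : Fin (q + 1) → Finset ℝ) (F : (Fin (q + 1) → ℝ) → ℝ) :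
    ∑ x ∈ Fintype.piFinset S, F x = ∑ t ∈ S (Fin.last q),
      ∑ y ∈ Fintype.piFinset fun j : Fin q => S j.castSucc,
        F (Fin.snoc y t : Fin (q + 1) → ℝ) := by
  rw [← Finset.sum_product' (f := fun t y => F (Fin.snoc y t : Fin (q + 1) → ℝ))]
  refine Finset.sum_nbij' (fun x => (x (Fin.last q), Fin.init x))
    (fun z => (Fin.snoc z.2 z.1 : Fin (q + 1) → ℝ)) ?_ ?_ ?_ ?_ ?_
  · intro x hx
    rw [Fintype.mem_piFinset] at hx
    rw [Finset.mem_product, Fintype.mem_piFinset]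
    exact ⟨hx _, fun j => hx _⟩
  · rintro ⟨t, y⟩ hz
    rw [Finset.mem_product, Fintype.mem_piFinset] at hz
    rw [Fintype.mem_piFinset]
    intro i
    induction i using Fin.lastCases with
    | last => simpa using hz.1
    | cast j => simpa using hz.2 j
  · intro x _
    exact Fin.snoc_init_self (α := fun _ => ℝ) x
  · rintro ⟨t, y⟩ _
    simp [Fin.init_snoc (α := fun _ => ℝ)]
  · intro x _
    exact congrArg F (Fin.snoc_init_self (α := fun _ => ℝ) x).symm

theorem tensorSum_succ {q : ℕ} (S : Finset ℝ) (u : Fin (q + 1) → ℝ → ℝ)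
    (f : (Fin (q + 1) → ℝ) → ℝ) : tensorSum S u f = ∑ t ∈ S, u (Fin.last q) t *
      tensorSum S (fun j => u j.castSucc) fun y => f (Fin.snoc y t : Fin (q + 1) → ℝ) := by
  rw [tensorSum, sum_piFinset_snoc]
  refine Finset.sum_congr rfl fun t _ => ?_
  rw [tensorSum, Finset.mul_sum]
  refine Finset.sum_congr rfl fun y _ => ?_
  rw [Fin.prod_univ_castSucc]
  simp only [Fin.snoc_castSucc, Fin.snoc_last]
  ring

/-- The functional `g ↦ ∑ t ∈ S, u t * g t` is bounded by `b sup |g^(k)|`. The function `g` and its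
derivatives are `G 0, …, G k`. -/
def DerivBound (k : ℕ) (S : Finset ℝ) (u : ℝ → ℝ) (b : ℝ) : Prop :=
  ∀ (G : ℕ → ℝ → ℝ) (M : ℝ), (∀ a < k, ∀ x, HasDerivAt (G a) (G (a + 1) x) x) →
    Continuous (G k) → (∀ x, |G k x| ≤ M) → |∑ t ∈ S, u t * G 0 t| ≤ b * M

/-- Functionals bounded by the `α j`-th derivatives have a tensor product that is bounded by the
mixed derivative `D^α`. -/
theorem abs_tensorSum_le {q k : ℕ} (S : Finset ℝ) (u : Fin q → ℝ → ℝ) (b : Fin q → ℝ)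
    (α : Fin q → ℕ) (hα : ∀ j, α j ≤ k) (hu : ∀ j, DerivBound (α j) S (u j) (b j))
    {f : (Fin q → ℝ) → ℝ} (hf : MemF q k f) {M : ℝ} (hM : ∀ x, |mixedPartial α f x| ≤ M) :
    |tensorSum S u f| ≤ (∏ j, b j) * M := by
  induction q with
  | zero =>
    have h : ∀ x, |f x| ≤ M := fun x => hM x
    simp only [tensorSum, Fintype.piFinset_of_isEmpty, Finset.univ_unique, Finset.sum_singleton,
      Finset.univ_eq_empty, Finset.prod_empty, one_mul]
    exact h _
  | succ q ih =>
    -- the tensor product in the other variables, as a function of the last variable; its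
    -- derivatives are obtained by applying the functional to the derivatives of `f`
    set G : ℕ → ℝ → ℝ := fun a t =>
      tensorSum S (fun j => u j.castSucc) (lastSlice f a t) with hG
    rw [tensorSum_succ, Fin.prod_univ_castSucc, mul_comm (∏ j : Fin q, _), mul_assoc]
    refine hu (Fin.last q) G _ (fun a ha t => ?_) ?_ fun t => ?_
    · simp only [hG, tensorSum]
      exact HasDerivAt.fun_sum fun y _ =>
        (hf.hasDerivAt_lastSlice (ha.trans_le (hα _)) y t).const_mul _
    · simp only [hG, tensorSum]
      exact continuous_finsetSum _ fun y _ =>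
        continuous_const.mul (hf.continuous_lastSlice (hα _) y)
    · refine ih _ _ (fun j => α j.castSucc) (fun j => hα _) (fun j => hu _)
        (hf.lastSlice (hα _) t) fun y => ?_
      rw [mixedPartial_lastSlice]
      have : (Fin.snoc (fun j : Fin q => α j.castSucc) (α (Fin.last q)) : Fin (q + 1) → ℕ) = α :=
        Fin.snoc_init_self (α := fun _ => ℕ) α
      rw [this]
      exact hM _

/-! ### Difference rules and the combination formula -/

/-- The weights of the level-`i` rule, extended by zero outside of its grid. The rule of level `0`
has no nodes and is zero. -/
def ghCoeff (i : ℕ) (t : ℝ) : ℝ := if t ∈ grid i then weight i t else 0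

/-- The weights of the difference of the rules of the levels `i` and `i - 1`. -/
def diffCoeff (i : ℕ) (t : ℝ) : ℝ := ghCoeff i t - ghCoeff (i - 1) t

/-- A finite set containing the grids of level at most `N`. -/
def gridUnion (N : ℕ) : Finset ℝ := (Finset.range (N + 1)).biUnion grid

theorem grid_subset_gridUnion {i N : ℕ} (h : i ≤ N) : grid i ⊆ gridUnion N :=
  Finset.subset_biUnion_of_mem grid (Finset.mem_range.2 (by omega))

theorem grid_zero : grid 0 = ∅ := by simp [grid, hermiteH]

theorem ghCoeff_zero (t : ℝ) : ghCoeff 0 t = 0 := by simp [ghCoeff, grid_zero]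

theorem tensorSum_ghCoeff {q : ℕ} {S : Finset ℝ} (i : Fin q → ℕ) (h : ∀ j, grid (i j) ⊆ S)
    (f : (Fin q → ℝ) → ℝ) : tensorSum S (fun j => ghCoeff (i j)) f = tensorQuad i f := by
  rw [tensorSum, tensorQuad, tensorGrid]
  symm
  refine Finset.sum_subset_zero_on_sdiff (Fintype.piFinset_subset _ _ h) (fun x hx => ?_)
    fun x hx => ?_
  · rw [Finset.mem_sdiff, Fintype.mem_piFinset, Fintype.mem_piFinset] at hx
    have := hx.2
    push Not at this
    obtain ⟨j, hj⟩ := this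
    rw [Finset.prod_eq_zero (Finset.mem_univ j) (by simp [ghCoeff, hj]), zero_mul]
  · rw [Fintype.mem_piFinset] at hx
    congr 1
    exact Finset.prod_congr rfl fun j _ => by simp [ghCoeff, hx j]

theorem tensorQuad_eq_zero {q : ℕ} {i : Fin q → ℕ} {j : Fin q} (h : i j = 0)
    (f : (Fin q → ℝ) → ℝ) : tensorQuad i f = 0 := by
  have : tensorGrid i = ∅ := by
    rw [tensorGrid, Fintype.piFinset_eq_empty]
    exact ⟨j, by rw [h, grid_zero]⟩
  rw [tensorQuad, this, Finset.sum_empty]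

/-- The difference rule `Δ^{i_1} ⊗ ⋯ ⊗ Δ^{i_q}`, `Δ^i = Q^i - Q^{i-1}`; the set of nodes is large
enough for the levels at most `N`. -/
def diffQuad {q : ℕ} (N : ℕ) (i : Fin q → ℕ) (f : (Fin q → ℝ) → ℝ) : ℝ :=
  tensorSum (gridUnion N) (fun j => diffCoeff (i j)) f

theorem diffQuad_eq_sum {q N : ℕ} (i : Fin q → ℕ) (hi : ∀ j, i j ≤ N) (f : (Fin q → ℝ) → ℝ) :
    diffQuad N i f = ∑ t ∈ (Finset.univ : Finset (Fin q)).powerset, (-1 : ℝ) ^ t.card *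
      tensorQuad (fun j => i j - if j ∈ t then 1 else 0) f := by
  have h1 : ∀ t : Finset (Fin q), tensorQuad (fun j => i j - if j ∈ t then 1 else 0) f =
      tensorSum (gridUnion N) (fun j => ghCoeff (i j - if j ∈ t then 1 else 0)) f := fun t =>
    (tensorSum_ghCoeff _ (fun j => grid_subset_gridUnion ((Nat.sub_le _ _).trans (hi j))) f).symm
  simp only [h1, diffQuad, tensorSum, Finset.mul_sum]
  rw [Finset.sum_comm]
  refine Finset.sum_congr rfl fun x _ => ?_
  simp only [diffCoeff]
  rw [Finset.prod_sub, Finset.sum_mul]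
  refine Finset.sum_congr rfl fun t _ => ?_
  have h2 : ∏ j, ghCoeff (i j - if j ∈ t then 1 else 0) (x j) =
      (∏ j ∈ Finset.univ \ t, ghCoeff (i j) (x j)) * ∏ j ∈ t, ghCoeff (i j - 1) (x j) := by
    rw [← Finset.prod_sdiff (Finset.subset_univ t)]
    congr 1
    · refine Finset.prod_congr rfl fun j hj => ?_
      rw [if_neg (Finset.mem_sdiff.1 hj).2, Nat.sub_zero]
    · exact Finset.prod_congr rfl fun j hj => by rw [if_pos hj]
  rw [h2]; ring

/-- The multi-indices `i` with `i_j ≥ 1` and `|i| ≤ p`. -/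
def simplexIndex (q p : ℕ) : Finset (Fin q → ℕ) :=
  (Fintype.piFinset fun _ : Fin q => Finset.Icc 1 p).filter fun i => ∑ j, i j ≤ p

theorem le_sum_index {q : ℕ} (i : Fin q → ℕ) (j : Fin q) : i j ≤ ∑ j, i j :=
  Finset.single_le_sum (f := i) (fun _ _ => Nat.zero_le _) (Finset.mem_univ j)

theorem mem_simplexIndex {q p : ℕ} {i : Fin q → ℕ} :
    i ∈ simplexIndex q p ↔ (∀ j, 1 ≤ i j) ∧ ∑ j, i j ≤ p := by
  rw [simplexIndex, Finset.mem_filter, Fintype.mem_piFinset]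
  refine ⟨fun h => ⟨fun j => (Finset.mem_Icc.1 (h.1 j)).1, h.2⟩, fun h => ⟨fun j => ?_, h.2⟩⟩
  exact Finset.mem_Icc.2 ⟨h.1 j, (le_sum_index i j).trans h.2⟩

theorem mem_levels {q p : ℕ} {i : Fin q → ℕ} :
    i ∈ levels q p ↔ (∀ j, 1 ≤ i j) ∧ p < (∑ j, i j) + q ∧ ∑ j, i j ≤ p := by
  rw [levels, Finset.mem_filter, Fintype.mem_piFinset]
  refine ⟨fun h => ⟨fun j => (Finset.mem_Icc.1 (h.1 j)).1, h.2⟩, fun h => ⟨fun j => ?_, h.2⟩⟩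
  exact Finset.mem_Icc.2 ⟨h.1 j, (le_sum_index i j).trans h.2.2⟩

/-- The partial alternating sums of binomial coefficients, as a sum over sets. -/
theorem sum_powerset_neg_one_pow_card {q : ℕ} (hq : 1 ≤ q) (m : ℕ) :
    ∑ t ∈ (Finset.univ : Finset (Fin q)).powerset, (if t.card ≤ m then (-1 : ℝ) ^ t.card else 0) =
      (-1) ^ m * ((q - 1).choose m : ℝ) := by
  obtain ⟨n, rfl⟩ : ∃ n, q = n + 1 := ⟨q - 1, by omega⟩
  rw [Finset.sum_powerset_apply_card (fun s => if s ≤ m then (-1 : ℝ) ^ s else 0)]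
  have h := congrArg (Int.cast (R := ℝ)) (Int.alternating_sum_range_choose_eq_choose (n := n) (m := m))
  push_cast at h
  rw [Nat.add_sub_cancel, ← h]
  simp only [Finset.card_univ, Fintype.card_fin, nsmul_eq_mul, mul_ite, mul_zero]
  rw [← Finset.sum_filter]
  have h2 : ∑ s ∈ Finset.range (m + 1), (-1 : ℝ) ^ s * ((n + 1).choose s : ℝ) =
      ∑ s ∈ (Finset.range (m + 1)).filter (fun s => s < n + 1 + 1),
        (-1 : ℝ) ^ s * ((n + 1).choose s : ℝ) := by
    rw [Finset.sum_filter]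
    refine Finset.sum_congr rfl fun s _ => ?_
    split_ifs with hs
    · rfl
    · rw [Nat.choose_eq_zero_of_lt (by omega)]; simp
  rw [h2]
  refine Finset.sum_congr ?_ fun s _ => mul_comm _ _
  ext s
  simp only [Finset.mem_filter, Finset.mem_range]
  omega

/-- The combination formula: the Smolyak rule is the sum of the difference rules over `|i| ≤ p`. -/
theorem sum_diffQuad_simplexIndex {q p N : ℕ} (hq : 1 ≤ q) (hN : p ≤ N) (f : (Fin q → ℝ) → ℝ) :
    ∑ i ∈ simplexIndex q p, diffQuad N i f = sparseQuad q p f := by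
  have h1 : ∀ i ∈ simplexIndex q p, diffQuad N i f =
      ∑ t ∈ (Finset.univ : Finset (Fin q)).powerset, (-1 : ℝ) ^ t.card *
        tensorQuad (fun j => i j - if j ∈ t then 1 else 0) f := by
    intro i hi
    rw [mem_simplexIndex] at hi
    exact diffQuad_eq_sum i (fun j => ((le_sum_index i j).trans hi.2).trans hN) f
  rw [Finset.sum_congr rfl h1, Finset.sum_comm]
  have h2 : ∀ t : Finset (Fin q), ∑ i ∈ simplexIndex q p, (-1 : ℝ) ^ t.card *
        tensorQuad (fun j => i j - if j ∈ t then 1 else 0) f =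
      ∑ l ∈ simplexIndex q p, (if t.card ≤ p - ∑ j, l j then (-1 : ℝ) ^ t.card else 0) *
        tensorQuad l f := by
    intro t
    have hcard : ∑ j : Fin q, (if j ∈ t then 1 else 0) = t.card := by simp
    simp only [ite_mul, zero_mul]
    rw [← Finset.sum_filter]
    symm
    -- substitute `i = l + 1_t`; an `i` that is not of this form has a zero component of `i - 1_t`,
    -- and its term vanishes since the grid of level `0` is empty
    refine Finset.sum_of_injOn (fun l j => l j + if j ∈ t then 1 else 0) ?_ ?_ ?_ ?_
    · intro l _ l' _ h
      funext j
      have := congrFun h j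
      simpa using this
    · intro l hl
      rw [Finset.mem_coe, Finset.mem_filter, mem_simplexIndex] at hl
      rw [Finset.mem_coe, mem_simplexIndex]
      refine ⟨fun j => (hl.1.1 j).trans (Nat.le_add_right _ _), ?_⟩
      rw [Finset.sum_add_distrib, hcard]
      have := hl.1.2
      have := hl.2
      omega
    · intro i hi hnot
      rw [mem_simplexIndex] at hi
      by_cases hz : ∃ j, i j - (if j ∈ t then 1 else 0) = 0
      · obtain ⟨j, hj⟩ := hz
        rw [tensorQuad_eq_zero (j := j) hj, mul_zero]
      · push Not at hz
        exfalso
        apply hnot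
        have hi2 : ∀ j, i j - (if j ∈ t then 1 else 0) + (if j ∈ t then 1 else 0) = i j := by
          intro j
          have h3 := hz j
          split_ifs at h3 ⊢ <;> omega
        refine ⟨fun j => i j - if j ∈ t then 1 else 0, ?_, funext hi2⟩
        rw [Finset.mem_coe, Finset.mem_filter, mem_simplexIndex]
        have h4 : ∑ j, (i j - if j ∈ t then 1 else 0) + t.card = ∑ j, i j := by
          rw [← hcard, ← Finset.sum_add_distrib]
          exact Finset.sum_congr rfl fun j _ => hi2 j
        have := hi.2
        refine ⟨⟨fun j => Nat.one_le_iff_ne_zero.2 (hz j), ?_⟩, ?_⟩ <;> beta_reduce <;> omega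
    · intro l _
      congr 2
      funext j
      simp
  rw [Finset.sum_congr rfl fun t _ => h2 t, Finset.sum_comm, sparseQuad]
  simp only [← Finset.sum_mul]
  simp only [sum_powerset_neg_one_pow_card hq]
  symm
  -- the coefficient `choose (q - 1) (p - |i|)` vanishes for `|i| ≤ p - q`
  refine Finset.sum_subset (fun i hi => ?_) fun i hi hi2 => ?_
  · rw [mem_levels] at hi
    exact mem_simplexIndex.2 ⟨hi.1, hi.2.2⟩
  · rw [mem_simplexIndex] at hi
    rw [mem_levels] at hi2
    have : ¬ p < (∑ j, i j) + q := fun h => hi2 ⟨hi.1, h, hi.2⟩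
    rw [Nat.choose_eq_zero_of_lt (by omega)]
    simp

theorem sum_diffCoeff (N : ℕ) (t : ℝ) : ∑ i ∈ Finset.Icc 1 N, diffCoeff i t = ghCoeff N t := by
  induction N with
  | zero => simp [ghCoeff_zero]
  | succ N ih => rw [Finset.sum_Icc_succ_top (by omega), ih]; simp [diffCoeff]

theorem sum_diffQuad_piFinset {q : ℕ} (N : ℕ) (f : (Fin q → ℝ) → ℝ) :
    ∑ i ∈ Fintype.piFinset fun _ : Fin q => Finset.Icc 1 N, diffQuad N i f =
      tensorQuad (fun _ => N) f := by
  rw [← tensorSum_ghCoeff (S := gridUnion N) _ fun _ => grid_subset_gridUnion le_rfl]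
  simp only [diffQuad, tensorSum]
  rw [Finset.sum_comm]
  refine Finset.sum_congr rfl fun x _ => ?_
  rw [← Finset.sum_mul]
  congr 1
  simp only [← sum_diffCoeff N]
  rw [Finset.prod_univ_sum]

/-- The full tensor rule minus the Smolyak rule is the sum of the remaining difference rules. -/
theorem tensorQuad_sub_sparseQuad {q p N : ℕ} (hq : 1 ≤ q) (hN : p ≤ N) (f : (Fin q → ℝ) → ℝ) :
    tensorQuad (fun _ => N) f - sparseQuad q p f =
      ∑ i ∈ (Fintype.piFinset fun _ : Fin q => Finset.Icc 1 N).filter (fun i => p < ∑ j, i j),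
        diffQuad N i f := by
  rw [← sum_diffQuad_piFinset, ← sum_diffQuad_simplexIndex hq hN,
    ← Finset.sum_filter_add_sum_filter_not _ (fun i : Fin q → ℕ => p < ∑ j, i j)]
  have : (Fintype.piFinset fun _ : Fin q => Finset.Icc 1 N).filter
      (fun i => ¬ p < ∑ j, i j) = simplexIndex q p := by
    ext i
    rw [Finset.mem_filter, mem_simplexIndex, Fintype.mem_piFinset, not_lt]
    refine ⟨fun h => ⟨fun j => (Finset.mem_Icc.1 (h.1 j)).1, h.2⟩, fun h => ⟨fun j => ?_, h.2⟩⟩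
    exact Finset.mem_Icc.2 ⟨h.1 j, ((le_sum_index i j).trans h.2).trans hN⟩
  rw [this, add_sub_cancel_right]

/-! ### Bounds for the difference rules -/

theorem sum_ghCoeff_mul {i : ℕ} {S : Finset ℝ} (h : grid i ⊆ S) (g : ℝ → ℝ) :
    ∑ t ∈ S, ghCoeff i t * g t = hermiteQuad (2 ^ i - 1) g := by
  have h1 : ∑ t ∈ S, ghCoeff i t * g t = ∑ t ∈ grid i, ghCoeff i t * g t := by
    symm
    refine Finset.sum_subset h fun t _ ht => ?_
    simp [ghCoeff, ht]
  rw [h1, hermiteQuad]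
  refine Finset.sum_congr rfl fun t ht => ?_
  rw [ghCoeff, if_pos (show t ∈ grid i from ht)]
  rfl

theorem abs_hermiteQuad_le_of_bounded (n : ℕ) {g : ℝ → ℝ} {M : ℝ} (hM : ∀ x, |g x| ≤ M) :
    |hermiteQuad n g| ≤ √Real.pi * M := by
  have hM0 : 0 ≤ M := (abs_nonneg _).trans (hM 0)
  rcases Nat.eq_zero_or_pos n with rfl | hn
  · have : hermiteRoots 0 = ∅ := Finset.card_eq_zero.1 (card_hermiteRoots 0)
    rw [hermiteQuad, this, Finset.sum_empty, abs_zero]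
    positivity
  · refine (abs_hermiteQuad_le n g).trans ?_
    refine (hermiteQuad_mono n (g := fun _ => M * 1) fun x _ => by simpa using hM x).trans ?_
    rw [hermiteQuad_const_mul, hermiteQuad_one hn, mul_comm]

theorem inv_sqrt_le_pow {i : ℕ} (hi : 1 ≤ i) :
    (√((2 ^ i - 1 : ℕ) : ℝ))⁻¹ ≤ ((√2)⁻¹) ^ (i - 1) := by
  rw [inv_pow]
  refine inv_anti₀ (by positivity) ?_
  refine Real.le_sqrt_of_sq_le ?_
  rw [← pow_mul, mul_comm, pow_mul, Real.sq_sqrt (by norm_num)]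
  have h : 2 ^ (i - 1) ≤ 2 ^ i - 1 := by
    obtain ⟨j, rfl⟩ : ∃ j, i = j + 1 := ⟨i - 1, by omega⟩
    have : 1 ≤ 2 ^ j := Nat.one_le_two_pow
    rw [Nat.add_sub_cancel, pow_succ]; omega
  exact_mod_cast h

/-- The one-dimensional error estimate in terms of the level. -/
theorem exists_level_error_le : ∃ C : ℝ, 0 ≤ C ∧ ∀ (k i : ℕ), 0 < k → k + 2 ≤ i →
    ∀ (G : ℕ → ℝ → ℝ) (M : ℝ), (∀ a < k, ∀ x, HasDerivAt (G a) (G (a + 1) x) x) →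
      Continuous (G k) → (∀ x, |G k x| ≤ M) →
      |gaussInt (G 0) - hermiteQuad (2 ^ i - 1) (G 0)| ≤ C * M * ((√2)⁻¹) ^ (k * (i - 1)) := by
  obtain ⟨C, hC, h⟩ := exists_hermiteQuad_error_le
  refine ⟨C, hC, fun k i hk hi G M hd hc hM => ?_⟩
  have hM0 : 0 ≤ M := (abs_nonneg _).trans (hM 0)
  obtain ⟨j, rfl⟩ : ∃ j, i = j + 2 := ⟨i - 2, by omega⟩
  have h1 : 2 ^ (j + 2) - 1 = 4 * (2 ^ j - 1) + 3 := by
    have : 1 ≤ 2 ^ j := Nat.one_le_two_pow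
    rw [pow_add]; omega
  have h2 := Nat.lt_two_pow_self (n := j + 2)
  have h3 := h k (2 ^ j - 1) hk (by rw [← h1]; omega) G M hd hc hM
  rw [← h1] at h3
  refine h3.trans (mul_le_mul_of_nonneg_left ?_ (by positivity))
  rw [mul_comm k, pow_mul]
  exact pow_le_pow_left₀ (by positivity) (inv_sqrt_le_pow (by omega)) k

theorem inv_sqrt_two_pos : (0 : ℝ) < (√2)⁻¹ := by positivity

theorem inv_sqrt_two_lt_one : (√2 : ℝ)⁻¹ < 1 := by
  refine inv_lt_one_of_one_lt₀ ?_
  rw [Real.lt_sqrt (by norm_num)]; norm_num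

/-- The difference rules of high level are small for functions with bounded `k`-th derivative; those
of low level, which need not annihilate the polynomials of degree less than `k`, are only bounded
for bounded functions. -/
theorem exists_derivBound_diffCoeff {k : ℕ} (hk : 0 < k) : ∃ B : ℝ, 0 ≤ B ∧ ∀ (i : ℕ)
    (S : Finset ℝ), 1 ≤ i → grid i ⊆ S → grid (i - 1) ⊆ S →
      DerivBound (if k + 2 < i then k else 0) S (diffCoeff i) (B * ((√2)⁻¹) ^ (k * i)) := by
  obtain ⟨C, hC, h⟩ := exists_level_error_le
  set ρ : ℝ := (√2)⁻¹ with hρ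
  have hρ0 : 0 < ρ := inv_sqrt_two_pos
  have hρ1 : ρ ≤ 1 := inv_sqrt_two_lt_one.le
  have hρ2 : ρ ^ 2 = 2⁻¹ := by rw [hρ, inv_pow, Real.sq_sqrt (by norm_num)]
  refine ⟨2 * C * 2 ^ k + 4 * (ρ ^ (k * (k + 2)))⁻¹, by positivity,
    fun i S hi hS hS' G M hd hc hM => ?_⟩
  have hM0 : 0 ≤ M := (abs_nonneg _).trans (hM 0)
  have hsum : ∑ t ∈ S, diffCoeff i t * G 0 t =
      hermiteQuad (2 ^ i - 1) (G 0) - hermiteQuad (2 ^ (i - 1) - 1) (G 0) := by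
    rw [← sum_ghCoeff_mul hS, ← sum_ghCoeff_mul hS', ← Finset.sum_sub_distrib]
    exact Finset.sum_congr rfl fun t _ => by rw [diffCoeff, sub_mul]
  rw [hsum]
  split_ifs at hd hc hM with hik
  · have h1 := h k i hk (by omega) G M hd hc hM
    have h2 := h k (i - 1) hk (by omega) G M hd hc hM
    have hpow : ∀ l, i ≤ l + 2 → ρ ^ (k * l) ≤ 2 ^ k * ρ ^ (k * i) := by
      intro l hl
      have e : ρ ^ (k * l) = 2 ^ k * ρ ^ (k * (l + 2)) := by
        have h3 : (2 : ℝ) ^ k * (ρ ^ 2) ^ k = 1 := by rw [hρ2, ← mul_pow]; norm_num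
        rw [show k * (l + 2) = 2 * k + k * l by ring, pow_add, pow_mul ρ 2 k, ← mul_assoc, h3,
          one_mul]
      rw [e]
      exact mul_le_mul_of_nonneg_left
        (pow_le_pow_of_le_one hρ0.le hρ1 (Nat.mul_le_mul_left _ hl)) (by positivity)
    have h3 := hpow (i - 1) (by omega)
    have h4 := hpow (i - 1 - 1) (by omega)
    calc |hermiteQuad (2 ^ i - 1) (G 0) - hermiteQuad (2 ^ (i - 1) - 1) (G 0)|
        = |(gaussInt (G 0) - hermiteQuad (2 ^ (i - 1) - 1) (G 0)) -
            (gaussInt (G 0) - hermiteQuad (2 ^ i - 1) (G 0))| := by congr 1; ring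
      _ ≤ C * M * ρ ^ (k * (i - 1 - 1)) + C * M * ρ ^ (k * (i - 1)) :=
          (abs_sub _ _).trans (add_le_add h2 h1)
      _ ≤ C * M * (2 ^ k * ρ ^ (k * i)) + C * M * (2 ^ k * ρ ^ (k * i)) := by gcongr
      _ = 2 * C * 2 ^ k * ρ ^ (k * i) * M := by ring
      _ ≤ (2 * C * 2 ^ k + 4 * (ρ ^ (k * (k + 2)))⁻¹) * ρ ^ (k * i) * M := by
          gcongr
          exact le_add_of_nonneg_right (by positivity)
  · have h1 := abs_hermiteQuad_le_of_bounded (2 ^ i - 1) hM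
    have h2 := abs_hermiteQuad_le_of_bounded (2 ^ (i - 1) - 1) hM
    have hpi : √Real.pi ≤ 2 := by
      rw [Real.sqrt_le_left (by norm_num)]; linarith [Real.pi_le_four]
    have h3 : 1 ≤ (ρ ^ (k * (k + 2)))⁻¹ * ρ ^ (k * i) := by
      rw [inv_mul_eq_div, one_le_div (by positivity)]
      exact pow_le_pow_of_le_one hρ0.le hρ1 (Nat.mul_le_mul_left _ (by omega))
    calc |hermiteQuad (2 ^ i - 1) (G 0) - hermiteQuad (2 ^ (i - 1) - 1) (G 0)|
        ≤ √Real.pi * M + √Real.pi * M := (abs_sub _ _).trans (add_le_add h1 h2)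
      _ ≤ 2 * M + 2 * M := by gcongr
      _ = 4 * 1 * M := by ring
      _ ≤ 4 * ((ρ ^ (k * (k + 2)))⁻¹ * ρ ^ (k * i)) * M := by gcongr
      _ = 4 * (ρ ^ (k * (k + 2)))⁻¹ * ρ ^ (k * i) * M := by ring
      _ ≤ (2 * C * 2 ^ k + 4 * (ρ ^ (k * (k + 2)))⁻¹) * ρ ^ (k * i) * M := by
          gcongr
          exact le_add_of_nonneg_left (by positivity)

/-- `D^α f` is bounded by `M` whenever `max α = k`. -/
def TopBounded (q k : ℕ) (f : (Fin q → ℝ) → ℝ) (M : ℝ) : Prop :=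
  ∀ α : Fin q → ℕ, (∀ i, α i ≤ k) → (∃ i, α i = k) → ∀ x, |mixedPartial α f x| ≤ M

/-- A tensor product of difference rules at least one of which has high level: only the rules of
high level use derivatives. -/
theorem exists_abs_diffQuad_le (q : ℕ) {k : ℕ} (hk : 0 < k) : ∃ B : ℝ, 0 ≤ B ∧
    ∀ (f : (Fin q → ℝ) → ℝ) (M : ℝ), MemF q k f → TopBounded q k f M →
      ∀ (N : ℕ) (i : Fin q → ℕ), (∀ j, i j ∈ Finset.Icc 1 N) → (∃ j, k + 2 < i j) →
        |diffQuad N i f| ≤ B * (((√2)⁻¹) ^ k) ^ (∑ j, i j) * M := by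
  obtain ⟨B, hB, h⟩ := exists_derivBound_diffCoeff hk
  refine ⟨B ^ q, by positivity, fun f M hf hM N i hi hlarge => ?_⟩
  have h1 := abs_tensorSum_le (k := k) (gridUnion N) (fun j => diffCoeff (i j))
    (fun j => B * ((√2)⁻¹) ^ (k * i j)) (fun j => if k + 2 < i j then k else 0)
    (fun j => by split_ifs <;> omega)
    (fun j => by
      have hj := Finset.mem_Icc.1 (hi j)
      exact h (i j) _ hj.1 (grid_subset_gridUnion hj.2)
        (grid_subset_gridUnion ((Nat.sub_le _ _).trans hj.2))) hf
    (hM _ (fun j => by split_ifs <;> omega) (by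
      obtain ⟨j, hj⟩ := hlarge
      exact ⟨j, if_pos hj⟩))
  refine h1.trans (le_of_eq ?_)
  rw [Finset.prod_mul_distrib, Finset.prod_const, Finset.card_univ, Fintype.card_fin]
  simp only [pow_mul]
  rw [Finset.prod_pow_eq_pow_sum]

/-! ### Counting multi-indices -/

/-- The first `q - 1` components determine an index of given sum. -/
theorem card_index_le {q : ℕ} (hq : 1 ≤ q) (s : Finset (Fin q → ℕ)) {m : ℕ}
    (hs : ∀ i ∈ s, (∀ j, 1 ≤ i j) ∧ ∑ j, i j = m) : s.card ≤ m ^ (q - 1) := by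
  obtain ⟨n, rfl⟩ : ∃ n, q = n + 1 := ⟨q - 1, by omega⟩
  have h := Finset.card_le_card_of_injOn (s := s)
    (t := Fintype.piFinset fun _ : Fin n => Finset.Icc 1 m) (fun i j => i j.castSucc) ?_ ?_
  · refine h.trans (le_of_eq ?_)
    rw [Fintype.card_piFinset]
    simp
  · intro i hi
    rw [Finset.mem_coe, Fintype.mem_piFinset]
    intro j
    have h1 := hs i hi
    exact Finset.mem_Icc.2 ⟨h1.1 _, (le_sum_index i _).trans h1.2.le⟩
  · intro i hi i' hi' h
    have h1 := (hs i hi).2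
    have h2 := (hs i' hi').2
    rw [Fin.sum_univ_castSucc] at h1 h2
    have h3 : ∀ j : Fin n, i j.castSucc = i' j.castSucc := fun j => congrFun h j
    simp only [h3] at h1
    funext j
    induction j using Fin.lastCases with
    | last => omega
    | cast j => exact h3 j

/-- The geometric tail sum: there are at most `m^(q-1) ≤ p^(q-1) (m - p + 1)^(q-1)` indices with sum
`m`. -/
theorem exists_sum_pow_index_le {q : ℕ} (hq : 1 ≤ q) {r : ℝ} (hr0 : 0 < r) (hr1 : r < 1) :
    ∃ D : ℝ, 0 ≤ D ∧ ∀ p N : ℕ, 1 ≤ p →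
      ∑ i ∈ (Fintype.piFinset fun _ : Fin q => Finset.Icc 1 N).filter (fun i => p < ∑ j, i j),
        r ^ (∑ j, i j) ≤ D * (r ^ p * (p : ℝ) ^ (q - 1)) := by
  set h : ℕ → ℝ := fun s => ((s : ℝ) + 1) ^ (q - 1) * r ^ s with hh
  have hsum : Summable h := by
    have h0 : Summable fun n : ℕ => (n : ℝ) ^ (q - 1) * r ^ n :=
      summable_pow_mul_geometric_of_norm_lt_one (q - 1)
        (by rw [Real.norm_of_nonneg hr0.le]; exact hr1)
    refine (((summable_nat_add_iff 1).2 h0).mul_left r⁻¹).congr fun s => ?_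
    simp only [hh]
    push_cast
    rw [pow_succ]
    field_simp
  have hpos : ∀ s, 0 ≤ h s := fun s => by simp only [hh]; positivity
  refine ⟨∑' s, h s, tsum_nonneg hpos, fun p N hp => ?_⟩
  have hpr : (1 : ℝ) ≤ p := by exact_mod_cast hp
  set I := (Fintype.piFinset fun _ : Fin q => Finset.Icc 1 N).filter
    (fun i => p < ∑ j, i j) with hI
  have hmem : ∀ i ∈ I, (∀ j, 1 ≤ i j) ∧ p < ∑ j, i j := by
    intro i hi
    rw [hI, Finset.mem_filter, Fintype.mem_piFinset] at hi
    exact ⟨fun j => (Finset.mem_Icc.1 (hi.1 j)).1, hi.2⟩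
  set T := I.image fun i => ∑ j, i j with hT
  have hTp : ∀ m ∈ T, p < m := by
    intro m hm
    obtain ⟨i, hi, rfl⟩ := Finset.mem_image.1 hm
    exact (hmem i hi).2
  rw [← Finset.sum_fiberwise_of_maps_to (g := fun i : Fin q → ℕ => ∑ j, i j) (t := T)
    fun i hi => Finset.mem_image_of_mem _ hi]
  have h1 : ∀ m ∈ T, ∑ i ∈ I with ∑ j, i j = m, r ^ (∑ j, i j) ≤
      r ^ p * (p : ℝ) ^ (q - 1) * h (m - p) := by
    intro m hm
    have hpm := hTp m hm
    have e : ∑ i ∈ I with ∑ j, i j = m, r ^ (∑ j, i j) =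
        ((I.filter fun i => ∑ j, i j = m).card : ℝ) * r ^ m := by
      rw [Finset.sum_congr rfl fun i hi => by rw [(Finset.mem_filter.1 hi).2],
        Finset.sum_const, nsmul_eq_mul]
    rw [e]
    have hc : ((I.filter fun i => ∑ j, i j = m).card : ℝ) ≤ (m : ℝ) ^ (q - 1) := by
      exact_mod_cast card_index_le hq _ fun i hi => by
        rw [Finset.mem_filter] at hi
        exact ⟨(hmem i hi.1).1, hi.2⟩
    have hm2 : (m : ℝ) ≤ p * (((m - p : ℕ) : ℝ) + 1) := by
      rw [Nat.cast_sub hpm.le]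
      have : (p : ℝ) ≤ m := by exact_mod_cast hpm.le
      nlinarith
    calc ((I.filter fun i => ∑ j, i j = m).card : ℝ) * r ^ m
        ≤ (p * (((m - p : ℕ) : ℝ) + 1)) ^ (q - 1) * r ^ m :=
          mul_le_mul_of_nonneg_right (hc.trans (pow_le_pow_left₀ (by positivity) hm2 _))
            (by positivity)
      _ = r ^ p * (p : ℝ) ^ (q - 1) * h (m - p) := by
          have : r ^ m = r ^ p * r ^ (m - p) := by rw [← pow_add]; congr 1; omega
          rw [this, mul_pow]; simp only [hh]; ring
  refine (Finset.sum_le_sum h1).trans ?_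
  rw [← Finset.mul_sum, mul_comm]
  refine mul_le_mul_of_nonneg_right ?_ (by positivity)
  have hinj : Set.InjOn (fun m => m - p) (T : Set ℕ) := by
    intro a ha b hb hab
    have h2 := hTp a ha
    have h3 := hTp b hb
    simp only at hab
    omega
  rw [← Finset.sum_image (f := h) hinj]
  exact hsum.sum_le_tsum _ fun s _ => hpos s

/-- The Smolyak rule is close to the full tensor rules of high level. -/
theorem exists_abs_tensorQuad_sub_sparseQuad_le {q k : ℕ} (hq : 1 ≤ q) (hk : 0 < k) :
    ∃ A : ℝ, 0 ≤ A ∧ ∀ (f : (Fin q → ℝ) → ℝ) (M : ℝ), MemF q k f → TopBounded q k f M →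
      0 ≤ M → ∀ p N : ℕ, q * (k + 2) ≤ p → p ≤ N →
        |tensorQuad (fun _ => N) f - sparseQuad q p f| ≤
          A * M * ((((√2)⁻¹) ^ k) ^ p * (p : ℝ) ^ (q - 1)) := by
  obtain ⟨B, hB, h⟩ := exists_abs_diffQuad_le q hk
  obtain ⟨D, hD, hsum⟩ := exists_sum_pow_index_le hq (pow_pos inv_sqrt_two_pos k)
    (pow_lt_one₀ inv_sqrt_two_pos.le inv_sqrt_two_lt_one hk.ne')
  refine ⟨B * D, by positivity, fun f M hf hM hM0 p N hp hN => ?_⟩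
  have hp1 : 1 ≤ p := by nlinarith
  rw [tensorQuad_sub_sparseQuad hq hN]
  refine (Finset.abs_sum_le_sum_abs _ _).trans ?_
  have h1 : ∀ i ∈ (Fintype.piFinset fun _ : Fin q => Finset.Icc 1 N).filter
      (fun i => p < ∑ j, i j), |diffQuad N i f| ≤ B * M * (((√2)⁻¹) ^ k) ^ (∑ j, i j) := by
    intro i hi
    rw [Finset.mem_filter, Fintype.mem_piFinset] at hi
    refine (h f M hf hM N i hi.1 ?_).trans (le_of_eq (by ring))
    by_contra! hcon
    have : ∑ j, i j ≤ q * (k + 2) := by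
      refine (Finset.sum_le_sum fun j _ => hcon j).trans (le_of_eq ?_)
      simp
    omega
  refine (Finset.sum_le_sum h1).trans ?_
  rw [← Finset.mul_sum]
  refine (mul_le_mul_of_nonneg_left (hsum p N hp1) (by positivity)).trans (le_of_eq ?_)
  ring

/-! ### Growth and integrability -/

theorem TopBounded.lastSlice {q k : ℕ} {f : (Fin (q + 1) → ℝ) → ℝ} {M : ℝ}
    (hM : TopBounded (q + 1) k f M) {a : ℕ} (ha : a ≤ k) (t : ℝ) :
    TopBounded q k (lastSlice f a t) M := by
  rintro α hα ⟨i, hi⟩ y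
  rw [mixedPartial_lastSlice]
  exact hM _ (snoc_le hα ha) ⟨i.castSucc, by simpa using hi⟩ _

theorem TopBounded.abs_lastSlice_le {q k : ℕ} {f : (Fin (q + 1) → ℝ) → ℝ} {M : ℝ}
    (hM : TopBounded (q + 1) k f M) (t : ℝ) (y : Fin q → ℝ) :
    |SparseGH.lastSlice f k t y| ≤ M := by
  rw [SparseGH.lastSlice, ← mixedPartial_lastIndex]
  exact hM _ (lastIndex_le le_rfl) ⟨_, lastIndex_last q k⟩ _

/-- A function with bounded mixed derivatives of top order has at most polynomial growth. The
derivatives in the last variable are integrated one by one, and the functions of the other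
variables that occur at height `0` are of the same kind. -/
theorem MemF.exists_growth {q k : ℕ} {f : (Fin q → ℝ) → ℝ} (hf : MemF q k f) {M : ℝ}
    (hM : TopBounded q k f M) :
    ∃ (C : ℝ) (d : ℕ), 0 ≤ C ∧ ∀ x, |f x| ≤ C * (∏ j, (1 + x j ^ 2)) ^ d := by
  induction q with
  | zero =>
    refine ⟨|f 0|, 0, abs_nonneg _, fun x => ?_⟩
    rw [Subsingleton.elim x 0, pow_zero, mul_one]
  | succ q ih =>
    have hM0 : 0 ≤ M := (abs_nonneg _).trans (hM.abs_lastSlice_le 0 0)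
    have key : ∀ m a, a + m = k → ∃ (C : ℝ) (d : ℕ), 0 ≤ C ∧ ∀ (y : Fin q → ℝ) t,
        |SparseGH.lastSlice f a t y| ≤ C * ((∏ j, (1 + y j ^ 2)) * (1 + t ^ 2)) ^ d := by
      intro m
      induction m with
      | zero =>
        rintro a rfl
        exact ⟨M, 0, hM0, fun y t => by simpa using hM.abs_lastSlice_le t y⟩
      | succ m ihm =>
        intro a ha
        obtain ⟨C, d, hC, h⟩ := ihm (a + 1) (by omega)
        obtain ⟨C', d', hC', h'⟩ := ih (hf.lastSlice (show a ≤ k by omega) 0)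
          (hM.lastSlice (by omega) 0)
        refine ⟨C' + C, d' + (d + 1), by positivity, fun y t => ?_⟩
        have hW : (1 : ℝ) ≤ ∏ j, (1 + y j ^ 2) := by
          simpa using Finset.prod_le_prod (s := Finset.univ) (f := fun _ : Fin q => (1 : ℝ))
            (g := fun j => 1 + y j ^ 2) (fun _ _ => zero_le_one)
            fun j _ => le_add_of_nonneg_right (sq_nonneg (y j))
        have ht : (1 : ℝ) ≤ 1 + t ^ 2 := by nlinarith [sq_nonneg t]
        set W : ℝ := ∏ j, (1 + y j ^ 2)
        set X : ℝ := W * (1 + t ^ 2) with hX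
        have hWX : W ≤ X := le_mul_of_one_le_right (by linarith) ht
        have htX : 1 + t ^ 2 ≤ X := le_mul_of_one_le_left (by linarith) hW
        have hX1 : 1 ≤ X := hW.trans hWX
        have h1 := abs_le_of_hasDerivAt (x := t) (B := C * X ^ d)
          (hf.hasDerivAt_lastSlice (show a < k by omega) y) fun s hs => by
            refine (h y s).trans ?_
            have := sq_le_sq.2 hs
            gcongr
            rw [hX]
            gcongr
        calc |SparseGH.lastSlice f a t y|
            ≤ |SparseGH.lastSlice f a 0 y| + C * X ^ d * |t| := h1
          _ ≤ C' * X ^ d' + C * X ^ d * X := by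
              gcongr
              · exact (h' y).trans (by gcongr)
              · exact (abs_le_one_add_sq t).trans htX
          _ = C' * X ^ d' + C * X ^ (d + 1) := by ring
          _ ≤ C' * X ^ (d' + (d + 1)) + C * X ^ (d' + (d + 1)) := by
              have h2 : X ^ d' ≤ X ^ (d' + (d + 1)) := pow_le_pow_right₀ hX1 (by omega)
              have h3 : X ^ (d + 1) ≤ X ^ (d' + (d + 1)) := pow_le_pow_right₀ hX1 (by omega)
              gcongr
          _ = (C' + C) * X ^ (d' + (d + 1)) := by ring
    obtain ⟨C, d, hC, h⟩ := key k 0 (by omega)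
    refine ⟨C, d, hC, fun x => ?_⟩
    have h1 := h (Fin.init x) (x (Fin.last q))
    rw [Fin.prod_univ_castSucc]
    rw [SparseGH.lastSlice, Function.iterate_zero, id, Fin.snoc_init_self (α := fun _ => ℝ)] at h1
    exact h1

theorem MemF.continuous {q k : ℕ} {f : (Fin q → ℝ) → ℝ} (hf : MemF q k f) : Continuous f := by
  have h := hf.continuous_mixedPartial 0 fun _ => Nat.zero_le k
  rwa [mixedPartial_zero] at h

theorem exp_neg_sum_sq {q : ℕ} (x : Fin q → ℝ) :
    Real.exp (-∑ j, x j ^ 2) = ∏ j, Real.exp (-x j ^ 2) := by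
  rw [← Finset.sum_neg_distrib, Real.exp_sum]

theorem MemF.integrable {q k : ℕ} {f : (Fin q → ℝ) → ℝ} (hf : MemF q k f) {M : ℝ}
    (hM : TopBounded q k f M) :
    Integrable fun x : Fin q → ℝ => f x * Real.exp (-∑ j, x j ^ 2) := by
  obtain ⟨C, d, hC, h⟩ := hf.exists_growth hM
  have h1 : Integrable fun x : Fin q → ℝ => ∏ j, ((1 + x j ^ 2) ^ d * Real.exp (-x j ^ 2)) :=
    Integrable.fintype_prod (f := fun (_ : Fin q) (t : ℝ) => (1 + t ^ 2) ^ d * Real.exp (-t ^ 2))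
      fun _ => (((Tame.const 1).add (Tame.id.pow 2)).pow d).integrable
  have hc := hf.continuous
  refine (h1.const_mul C).mono' (by fun_prop) (ae_of_all _ fun x => ?_)
  rw [Finset.prod_mul_distrib, ← exp_neg_sum_sq, Finset.prod_pow, ← mul_assoc, norm_mul,
    Real.norm_eq_abs, Real.norm_of_nonneg (Real.exp_pos _).le]
  exact mul_le_mul_of_nonneg_right (h x) (Real.exp_pos _).le

/-! ### Convergence of the full tensor rules -/

/-- The integral of `f` against `exp (-xᵀx)`. -/
def gaussIntPi {q : ℕ} (f : (Fin q → ℝ) → ℝ) : ℝ :=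
  ∫ x : Fin q → ℝ, f x * Real.exp (-∑ j, x j ^ 2)

theorem integrable_exp_neg_sum_sq (q : ℕ) :
    Integrable fun x : Fin q → ℝ => Real.exp (-∑ j, x j ^ 2) := by
  simp only [exp_neg_sum_sq]
  exact Integrable.fintype_prod (f := fun (_ : Fin q) (t : ℝ) => Real.exp (-t ^ 2))
    fun _ => by simpa using (Tame.const 1).integrable

theorem integral_exp_neg_sum_sq (q : ℕ) :
    ∫ x : Fin q → ℝ, Real.exp (-∑ j, x j ^ 2) = √Real.pi ^ q := by
  simp only [exp_neg_sum_sq]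
  rw [integral_fintype_prod_volume_eq_pow (fun t : ℝ => Real.exp (-t ^ 2)), Fintype.card_fin,
    ← gaussInt_one, gaussInt]
  simp

theorem abs_gaussIntPi_le {q : ℕ} {f : (Fin q → ℝ) → ℝ} {M : ℝ} (hM : ∀ x, |f x| ≤ M) :
    |gaussIntPi f| ≤ √Real.pi ^ q * M := by
  rw [← integral_exp_neg_sum_sq, mul_comm, ← integral_const_mul]
  refine norm_integral_le_of_norm_le (G := ℝ) ((integrable_exp_neg_sum_sq q).const_mul M)
    (ae_of_all _ fun x => ?_)
  rw [norm_mul, Real.norm_of_nonneg (Real.exp_pos _).le]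
  exact mul_le_mul_of_nonneg_right (hM x) (Real.exp_pos _).le

theorem measurePreserving_snoc (q : ℕ) :
    MeasurePreserving (MeasurableEquiv.piFinSuccAbove (fun _ => ℝ) (Fin.last q)).symm :=
  (volume_preserving_piFinSuccAbove (fun _ => ℝ) (Fin.last q)).symm

theorem piFinSuccAbove_last_symm_apply {q : ℕ} (z : ℝ × (Fin q → ℝ)) :
    (MeasurableEquiv.piFinSuccAbove (fun _ => ℝ) (Fin.last q)).symm z =
      (Fin.snoc z.2 z.1 : Fin (q + 1) → ℝ) := by
  rw [MeasurableEquiv.piFinSuccAbove_symm_apply]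
  exact Fin.insertNth_last' z.1 z.2

theorem exp_neg_sum_sq_snoc {q : ℕ} (y : Fin q → ℝ) (t : ℝ) :
    Real.exp (-∑ j, (Fin.snoc y t : Fin (q + 1) → ℝ) j ^ 2) =
      Real.exp (-∑ j, y j ^ 2) * Real.exp (-t ^ 2) := by
  rw [Fin.sum_univ_castSucc, neg_add, Real.exp_add]
  simp

/-- Fubini's theorem for the weight `exp (-xᵀx)`, the last variable being integrated first. -/
theorem gaussIntPi_succ {q : ℕ} {f : (Fin (q + 1) → ℝ) → ℝ}
    (hf : Integrable fun x : Fin (q + 1) → ℝ => f x * Real.exp (-∑ j, x j ^ 2)) :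
    Integrable (fun y : Fin q → ℝ =>
      gaussInt (fun t => f (Fin.snoc y t : Fin (q + 1) → ℝ)) * Real.exp (-∑ j, y j ^ 2)) ∧
    gaussIntPi f =
      gaussIntPi fun y : Fin q → ℝ => gaussInt fun t => f (Fin.snoc y t : Fin (q + 1) → ℝ) := by
  have h1 := ((measurePreserving_snoc q).integrable_comp_emb
    (MeasurableEquiv.measurableEmbedding _)).2 hf
  have h2 := (measurePreserving_snoc q).integral_comp'
    (fun x : Fin (q + 1) → ℝ => f x * Real.exp (-∑ j, x j ^ 2))
  simp only [Function.comp_def, piFinSuccAbove_last_symm_apply, exp_neg_sum_sq_snoc] at h1 h2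
  have h3 : ∀ y : Fin q → ℝ, ∫ t, f (Fin.snoc y t : Fin (q + 1) → ℝ) *
      (Real.exp (-∑ j, y j ^ 2) * Real.exp (-t ^ 2)) =
      gaussInt (fun t => f (Fin.snoc y t : Fin (q + 1) → ℝ)) * Real.exp (-∑ j, y j ^ 2) := by
    intro y
    rw [gaussInt, ← integral_mul_const]
    refine integral_congr_ae (ae_of_all _ fun t => ?_)
    dsimp only
    ring
  constructor
  · exact h1.integral_prod_right.congr (ae_of_all _ h3)
  · rw [gaussIntPi, gaussIntPi, ← h2, Measure.volume_eq_prod, integral_prod_symm _ h1]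
    exact integral_congr_ae (ae_of_all _ h3)

theorem tensorQuad_const_succ {q : ℕ} (N : ℕ) (f : (Fin (q + 1) → ℝ) → ℝ) :
    tensorQuad (fun _ => N) f =
      ∑ t ∈ grid N, weight N t * tensorQuad (fun _ => N) (lastSlice f 0 t) := by
  rw [tensorQuad, tensorGrid, sum_piFinset_snoc]
  refine Finset.sum_congr rfl fun t _ => ?_
  rw [tensorQuad, Finset.mul_sum]
  refine Finset.sum_congr rfl fun y _ => ?_
  rw [Fin.prod_univ_castSucc]
  simp only [Fin.snoc_castSucc, Fin.snoc_last]
  rw [lastSlice, Function.iterate_zero, id]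
  ring

theorem one_le_sqrt_pi : 1 ≤ √Real.pi :=
  Real.one_le_sqrt.2 (by linarith [Real.pi_gt_three])

/-- A uniform error bound of the one-dimensional rule is inherited by the full tensor rule. -/
theorem abs_gaussIntPi_sub_tensorQuad_le {k N : ℕ} {M ε : ℝ} (hN : 1 ≤ N)
    (h : ∀ G : ℕ → ℝ → ℝ, (∀ a < k, ∀ x, HasDerivAt (G a) (G (a + 1) x) x) →
      Continuous (G k) → (∀ x, |G k x| ≤ M) →
        |gaussInt (G 0) - hermiteQuad (2 ^ N - 1) (G 0)| ≤ ε)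
    {q : ℕ} {f : (Fin q → ℝ) → ℝ} (hf : MemF q k f) (hM : TopBounded q k f M) :
    |gaussIntPi f - tensorQuad (fun _ => N) f| ≤ q * √Real.pi ^ q * ε := by
  induction q with
  | zero =>
    obtain ⟨c, rfl⟩ : ∃ c, f = fun _ => c :=
      ⟨f 0, funext fun x => congrArg f (Subsingleton.elim x 0)⟩
    have h1 : gaussIntPi (fun _ : Fin 0 → ℝ => c) = c := by
      rw [gaussIntPi, integral_const_mul, integral_exp_neg_sum_sq, pow_zero, mul_one]
    simp [h1, tensorQuad, tensorGrid]
  | succ q ih =>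
    have hslice : ∀ y : Fin q → ℝ,
        |gaussInt (fun t => f (Fin.snoc y t : Fin (q + 1) → ℝ)) -
          hermiteQuad (2 ^ N - 1) (fun t => f (Fin.snoc y t : Fin (q + 1) → ℝ))| ≤ ε :=
      fun y => h (fun a t => lastSlice f a t y) (fun a ha => hf.hasDerivAt_lastSlice ha y)
        (hf.continuous_lastSlice le_rfl y) fun t => hM.abs_lastSlice_le t y
    have hε : 0 ≤ ε := (abs_nonneg _).trans (hslice 0)
    obtain ⟨hint, hfub⟩ := gaussIntPi_succ (hf.integrable hM)
    have hn : 0 < 2 ^ N - 1 := by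
      have : 2 ^ 1 ≤ 2 ^ N := Nat.pow_le_pow_right (by norm_num) hN
      omega
    -- the rule in the last variable commutes with the integral over the other variables
    have hcomm : Integrable (fun y : Fin q → ℝ => hermiteQuad (2 ^ N - 1)
        (fun t => f (Fin.snoc y t : Fin (q + 1) → ℝ)) * Real.exp (-∑ j, y j ^ 2)) ∧
        (gaussIntPi fun y : Fin q → ℝ => hermiteQuad (2 ^ N - 1)
          (fun t => f (Fin.snoc y t : Fin (q + 1) → ℝ))) =
        hermiteQuad (2 ^ N - 1) fun t => gaussIntPi (lastSlice f 0 t) := by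
      have hI : ∀ t ∈ hermiteRoots (2 ^ N - 1), Integrable fun y : Fin q → ℝ =>
          hermiteWeight (2 ^ N - 1) t * (lastSlice f 0 t y * Real.exp (-∑ j, y j ^ 2)) :=
        fun t _ => ((hf.lastSlice (Nat.zero_le k) t).integrable
          (hM.lastSlice (Nat.zero_le k) t)).const_mul _
      have e : ∀ y : Fin q → ℝ, hermiteQuad (2 ^ N - 1)
          (fun t => f (Fin.snoc y t : Fin (q + 1) → ℝ)) * Real.exp (-∑ j, y j ^ 2) =
          ∑ t ∈ hermiteRoots (2 ^ N - 1),
            hermiteWeight (2 ^ N - 1) t * (lastSlice f 0 t y * Real.exp (-∑ j, y j ^ 2)) := by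
        intro y
        rw [hermiteQuad, Finset.sum_mul]
        refine Finset.sum_congr rfl fun t _ => ?_
        rw [lastSlice, Function.iterate_zero, id]
        ring
      rw [gaussIntPi]
      simp only [e]
      refine ⟨integrable_finsetSum _ hI, ?_⟩
      rw [integral_finsetSum _ hI, hermiteQuad]
      refine Finset.sum_congr rfl fun t _ => ?_
      rw [integral_const_mul, gaussIntPi]
    have h1 : |gaussIntPi f - hermiteQuad (2 ^ N - 1) fun t => gaussIntPi (lastSlice f 0 t)| ≤
        √Real.pi ^ q * ε := by
      rw [hfub, ← hcomm.2]
      have h2 := abs_gaussIntPi_le hslice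
      rw [gaussIntPi] at h2
      simp only [sub_mul] at h2
      rwa [integral_sub hint hcomm.1] at h2
    have h3 : |hermiteQuad (2 ^ N - 1) (fun t => gaussIntPi (lastSlice f 0 t)) -
        tensorQuad (fun _ => N) f| ≤ √Real.pi * (q * √Real.pi ^ q * ε) := by
      rw [tensorQuad_const_succ]
      have e : ∑ t ∈ grid N, weight N t * tensorQuad (fun _ => N) (lastSlice f 0 t) =
        hermiteQuad (2 ^ N - 1) fun t => tensorQuad (fun _ => N) (lastSlice f 0 t) := rfl
      rw [e, ← hermiteQuad_sub]
      exact abs_hermiteQuad_le_of_bounded _ fun t =>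
        ih (hf.lastSlice (Nat.zero_le k) t) (hM.lastSlice (Nat.zero_le k) t)
    have h4 : √Real.pi ^ q * ε ≤ √Real.pi ^ (q + 1) * ε :=
      mul_le_mul_of_nonneg_right (pow_le_pow_right₀ one_le_sqrt_pi (Nat.le_succ q)) hε
    refine (abs_sub_le _ _ _).trans ((add_le_add (h1.trans h4) h3).trans (le_of_eq ?_))
    push_cast
    ring

/-- The error estimate in terms of the level: let the level of the full tensor rule tend to
infinity. -/
theorem exists_quadError_le_of_pos {q k : ℕ} (hq : 1 ≤ q) (hk : 0 < k) :
    ∃ A : ℝ, 0 ≤ A ∧ ∀ (f : (Fin q → ℝ) → ℝ) (M : ℝ), MemF q k f → TopBounded q k f M →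
      0 ≤ M → ∀ p : ℕ, q * (k + 2) ≤ p →
        quadError q p f ≤ A * M * ((((√2)⁻¹) ^ k) ^ p * (p : ℝ) ^ (q - 1)) := by
  obtain ⟨A, hA, h⟩ := exists_abs_tensorQuad_sub_sparseQuad_le hq hk
  obtain ⟨C, hC, hC'⟩ := exists_level_error_le
  refine ⟨A, hA, fun f M hf hM hM0 p hp => ?_⟩
  have hlim : Tendsto (fun N : ℕ => (q : ℝ) * √Real.pi ^ q *
      (C * M * ((√2)⁻¹) ^ (k * (N - 1)))) atTop (𝓝 0) := by
    have h1 : Tendsto (fun N : ℕ => (((√2 : ℝ)⁻¹) ^ k) ^ (N - 1)) atTop (𝓝 0) :=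
      (tendsto_pow_atTop_nhds_zero_of_lt_one (pow_nonneg inv_sqrt_two_pos.le k)
        (pow_lt_one₀ inv_sqrt_two_pos.le inv_sqrt_two_lt_one hk.ne')).comp (tendsto_sub_atTop_nat 1)
    simpa [pow_mul] using ((h1.const_mul (C * M)).const_mul ((q : ℝ) * √Real.pi ^ q))
  have hconv : Tendsto (fun N : ℕ => tensorQuad (fun _ => N) f) atTop (𝓝 (gaussIntPi f)) := by
    rw [tendsto_iff_dist_tendsto_zero]
    refine squeeze_zero' (Eventually.of_forall fun _ => dist_nonneg) ?_ hlim
    filter_upwards [eventually_ge_atTop (k + 2)] with N hN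
    rw [dist_comm, Real.dist_eq]
    exact abs_gaussIntPi_sub_tensorQuad_le (by omega)
      (fun G h1 h2 h3 => hC' k N hk hN G M h1 h2 h3) hf hM
  refine le_of_tendsto ((hconv.sub_const (sparseQuad q p f)).abs) ?_
  filter_upwards [eventually_ge_atTop p] with N hN
  exact h f M hf hM hM0 p N hp hN

/-! ### Bounded functions -/

theorem abs_tensorQuad_le {q : ℕ} {f : (Fin q → ℝ) → ℝ} {M : ℝ} (hM : ∀ x, |f x| ≤ M)
    (i : Fin q → ℕ) (hi : ∀ j, 1 ≤ i j) : |tensorQuad i f| ≤ √Real.pi ^ q * M := by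
  have hw : ∀ j, ∑ t ∈ grid (i j), weight (i j) t = √Real.pi := by
    intro j
    have hn : 0 < 2 ^ i j - 1 := by
      have : 2 ^ 1 ≤ 2 ^ i j := Nat.pow_le_pow_right (by norm_num) (hi j)
      omega
    have := hermiteQuad_one hn
    simp only [hermiteQuad, mul_one] at this
    exact this
  have hsum : ∑ x ∈ tensorGrid i, ∏ j, weight (i j) (x j) = √Real.pi ^ q := by
    rw [tensorGrid, ← Finset.prod_univ_sum (f := fun j t => weight (i j) t)]
    simp [hw]
  rw [← hsum, Finset.sum_mul, tensorQuad]
  refine (Finset.abs_sum_le_sum_abs _ _).trans (Finset.sum_le_sum fun x hx => ?_)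
  have h0 : 0 ≤ ∏ j, weight (i j) (x j) :=
    Finset.prod_nonneg fun j _ => hermiteWeight_nonneg _ (Fintype.mem_piFinset.1 hx j)
  rw [abs_mul, abs_of_nonneg h0]
  exact mul_le_mul_of_nonneg_left (hM x) h0

/-- The sums `|i|` take at most `q` values, all at most `p`. -/
theorem card_levels_le {q p : ℕ} (hq : 1 ≤ q) : (levels q p).card ≤ q * p ^ (q - 1) := by
  rw [Finset.card_eq_sum_card_fiberwise (f := fun i : Fin q → ℕ => ∑ j, i j)
    (t := Finset.Ioc (p - q) p)]
  · refine (Finset.sum_le_card_nsmul _ _ (p ^ (q - 1)) fun m hm => ?_).trans ?_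
    · have hm' := Finset.mem_Ioc.1 hm
      refine (card_index_le hq _ (m := m) fun i hi => ?_).trans
        (Nat.pow_le_pow_left hm'.2 _)
      rw [Finset.mem_filter, mem_levels] at hi
      exact ⟨hi.1.1, hi.2⟩
    · rw [smul_eq_mul, Nat.card_Ioc]
      exact Nat.mul_le_mul_right _ (by omega)
  · intro i hi
    rw [Finset.mem_coe, mem_levels] at hi
    have : 1 ≤ ∑ j, i j := (hi.1 ⟨0, hq⟩).trans (le_sum_index i _)
    simp only [Finset.coe_Ioc, Set.mem_Ioc]
    omega

/-- For bounded functions the error is at most the number of terms, up to a constant. -/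
theorem quadError_le_of_bounded {q p : ℕ} (hq : 1 ≤ q) (hp : 1 ≤ p) {f : (Fin q → ℝ) → ℝ} {M : ℝ}
    (hM : ∀ x, |f x| ≤ M) :
    quadError q p f ≤ √Real.pi ^ q * (1 + q * 2 ^ (q - 1)) * M * (p : ℝ) ^ (q - 1) := by
  have hM0 : 0 ≤ M := (abs_nonneg _).trans (hM 0)
  have hp1 : (1 : ℝ) ≤ (p : ℝ) ^ (q - 1) := one_le_pow₀ (by exact_mod_cast hp)
  have h1 : |sparseQuad q p f| ≤ (q * (p : ℝ) ^ (q - 1)) * (2 ^ (q - 1) * (√Real.pi ^ q * M)) := by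
    refine (Finset.abs_sum_le_sum_abs _ _).trans ?_
    refine (Finset.sum_le_card_nsmul _ _ (2 ^ (q - 1) * (√Real.pi ^ q * M)) fun i hi => ?_).trans ?_
    · rw [abs_mul, abs_mul, abs_pow, abs_neg, abs_one, one_pow, one_mul, Nat.abs_cast]
      refine mul_le_mul ?_ (abs_tensorQuad_le hM i (mem_levels.1 hi).1) (abs_nonneg _)
        (by positivity)
      exact_mod_cast Nat.choose_le_two_pow (q - 1) _
    · rw [nsmul_eq_mul]
      refine mul_le_mul_of_nonneg_right ?_ (by positivity)
      exact_mod_cast card_levels_le hq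
  calc quadError q p f ≤ |gaussIntPi f| + |sparseQuad q p f| := abs_sub _ _
    _ ≤ √Real.pi ^ q * M * (p : ℝ) ^ (q - 1) +
        (q * (p : ℝ) ^ (q - 1)) * (2 ^ (q - 1) * (√Real.pi ^ q * M)) :=
        add_le_add ((abs_gaussIntPi_le hM).trans (le_mul_of_one_le_right (by positivity) hp1)) h1
    _ = _ := by ring

/-! ### The number of nodes -/

theorem card_tensorGrid {q : ℕ} (i : Fin q → ℕ) : (tensorGrid i).card = ∏ j, (2 ^ i j - 1) := by
  rw [tensorGrid, Fintype.card_piFinset]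
  exact Finset.prod_congr rfl fun j _ => card_hermiteRoots _

theorem numNodes_le {q p : ℕ} (hq : 1 ≤ q) : numNodes q p ≤ q * p ^ (q - 1) * 2 ^ p := by
  classical
  rw [numNodes, sparseNodes]
  refine (Finset.card_biUnion_le_card_mul _ _ (2 ^ p) fun i hi => ?_).trans
    (Nat.mul_le_mul_right _ (card_levels_le hq))
  rw [card_tensorGrid]
  refine (Finset.prod_le_prod' fun j _ => Nat.sub_le _ _).trans ?_
  rw [Finset.prod_pow_eq_pow_sum]
  exact Nat.pow_le_pow_right (by norm_num) (mem_levels.1 hi).2.2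

/-- The grid of the levels `(p - q + 1, 1, …, 1)` has `2 ^ (p - q + 1) - 1` points. -/
theorem two_pow_le_numNodes {q p : ℕ} (hq : 1 ≤ q) (hp : q ≤ p) : 2 ^ (p - q) ≤ numNodes q p := by
  classical
  set j₀ : Fin q := ⟨0, hq⟩
  set i : Fin q → ℕ := fun j => 1 + if j = j₀ then p - q else 0 with hi
  have hsum : ∑ j, i j = p := by
    simp only [hi, Finset.sum_add_distrib, Finset.sum_ite_eq', Finset.mem_univ, if_true]
    simp only [Finset.sum_const, Finset.card_univ, Fintype.card_fin, smul_eq_mul, mul_one]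
    omega
  have hmem : i ∈ levels q p :=
    mem_levels.2 ⟨fun j => Nat.le_add_right _ _, by rw [hsum]; omega, hsum.le⟩
  have hcard : (tensorGrid i).card = 2 ^ (1 + (p - q)) - 1 := by
    rw [card_tensorGrid, Finset.prod_eq_single j₀]
    · simp [hi]
    · intro j _ hj
      simp [hi, hj]
    · simp
  have h1 : (tensorGrid i).card ≤ numNodes q p :=
    Finset.card_le_card (Finset.subset_biUnion_of_mem tensorGrid hmem)
  have h2 : 1 ≤ 2 ^ (p - q) := Nat.one_le_two_pow
  rw [hcard, pow_add] at h1
  omega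

/-! ### The rate in terms of the level -/

theorem inv_sqrt_two_pow_pow (k p : ℕ) :
    (((√2 : ℝ)⁻¹) ^ k) ^ p = ((2 : ℝ) ^ p) ^ (-((k : ℝ) / 2)) := by
  rw [Real.rpow_neg (by positivity), Real.sqrt_eq_rpow, inv_pow, inv_pow,
    ← Real.rpow_natCast, ← Real.rpow_natCast, ← Real.rpow_natCast, ← Real.rpow_mul (by positivity),
    ← Real.rpow_mul (by norm_num), ← Real.rpow_mul (by norm_num)]
  congr 2
  ring

/-- The number of nodes is between `2 ^ (p - q)` and `q p^(q-1) 2^p`. Hence `log N_Q` is of order `p`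
and its power in the rate absorbs the power of `p` in `N_Q`. -/
theorem exists_le_rate {q : ℕ} (hq : 1 ≤ q) (k : ℕ) : ∃ c : ℝ, 0 < c ∧ ∀ p : ℕ, q ≤ p →
    (2 ≤ q → q < p) → c * ((((√2)⁻¹) ^ k) ^ p * (p : ℝ) ^ (q - 1)) ≤ rate q k p := by
  set e : ℝ := ((k : ℝ) / 2 + 1) * ((q : ℝ) - 1) with he
  have hq1 : (1 : ℝ) ≤ q := by exact_mod_cast hq
  have he0 : 0 ≤ e := mul_nonneg (by positivity) (by linarith)
  set c₁ : ℝ := Real.log 2 / (q + 1) with hc₁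
  have hlog2 : 0 < Real.log 2 := Real.log_pos (by norm_num)
  have hc₁0 : 0 < c₁ := by positivity
  refine ⟨(q : ℝ) ^ (-((k : ℝ) / 2)) * c₁ ^ e, by positivity, fun p hp hqp => ?_⟩
  have hp1 : (1 : ℝ) ≤ p := by exact_mod_cast hq.trans hp
  have hN : (2 : ℝ) ^ (p - q) ≤ numNodes q p := by exact_mod_cast two_pow_le_numNodes hq hp
  have hN0 : (0 : ℝ) < numNodes q p := lt_of_lt_of_le (by positivity) hN
  have h1 : ((q : ℝ) * (p : ℝ) ^ (q - 1) * 2 ^ p) ^ (-((k : ℝ) / 2)) ≤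
      (numNodes q p : ℝ) ^ (-((k : ℝ) / 2)) := by
    refine Real.rpow_le_rpow_of_nonpos hN0 (by exact_mod_cast numNodes_le hq) ?_
    have : (0 : ℝ) ≤ k := k.cast_nonneg
    linarith
  have h2 : (c₁ * p) ^ e ≤ Real.log (numNodes q p) ^ e := by
    rcases Nat.lt_or_ge q 2 with h | h
    · obtain rfl : q = 1 := by omega
      simp [he]
    · refine Real.rpow_le_rpow (by positivity) ?_ he0
      have h3 : ((p - q : ℕ) : ℝ) * Real.log 2 ≤ Real.log (numNodes q p) := by
        rw [← Real.log_pow]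
        exact Real.log_le_log (by positivity) hN
      refine le_trans ?_ h3
      have h4 : (q : ℝ) + 1 ≤ p := by exact_mod_cast hqp h
      rw [hc₁, Nat.cast_sub hp, div_mul_eq_mul_div, div_le_iff₀ (by positivity)]
      have h5 : (p : ℝ) ≤ (p - q) * (q + 1) := by nlinarith
      nlinarith
  have h3 : (p : ℝ) ^ (q - 1) = ((p : ℝ) ^ (q - 1)) ^ (-((k : ℝ) / 2)) * (p : ℝ) ^ e := by
    rw [← Real.rpow_natCast, ← Real.rpow_mul (by positivity), ← Real.rpow_add (by linarith),
      Nat.cast_sub hq, he]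
    congr 1
    push_cast
    ring
  calc (q : ℝ) ^ (-((k : ℝ) / 2)) * c₁ ^ e * ((((√2)⁻¹) ^ k) ^ p * (p : ℝ) ^ (q - 1))
      = ((q : ℝ) * (p : ℝ) ^ (q - 1) * 2 ^ p) ^ (-((k : ℝ) / 2)) * (c₁ * p) ^ e := by
        rw [Real.mul_rpow (by positivity) (by positivity),
          Real.mul_rpow (by positivity) (by positivity),
          Real.mul_rpow (by positivity) (by positivity), inv_sqrt_two_pow_pow]
        nth_rewrite 1 [h3]
        ring
    _ ≤ rate q k p := mul_le_mul h1 h2 (by positivity) (by positivity)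

/-! ### The error estimate -/

theorem TopBounded.nonneg {q k : ℕ} (hq : 1 ≤ q) {f : (Fin q → ℝ) → ℝ} {M : ℝ}
    (hM : TopBounded q k f M) : 0 ≤ M :=
  (abs_nonneg _).trans (hM (fun _ => k) (fun _ => le_rfl) ⟨⟨0, hq⟩, rfl⟩ 0)

theorem exists_quadError_le {q : ℕ} (hq : 1 ≤ q) (k : ℕ) :
    ∃ A : ℝ, 0 ≤ A ∧ ∀ (f : (Fin q → ℝ) → ℝ) (M : ℝ), MemF q k f → TopBounded q k f M →
      ∀ p : ℕ, q * (k + 2) ≤ p →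
        quadError q p f ≤ A * M * ((((√2)⁻¹) ^ k) ^ p * (p : ℝ) ^ (q - 1)) := by
  rcases Nat.eq_zero_or_pos k with rfl | hk
  · refine ⟨√Real.pi ^ q * (1 + q * 2 ^ (q - 1)), by positivity, fun f M _ hM p hp => ?_⟩
    have hbound : ∀ x, |f x| ≤ M := by
      have h := hM 0 (fun _ => le_rfl) ⟨⟨0, hq⟩, rfl⟩
      rwa [mixedPartial_zero] at h
    rw [pow_zero, one_pow, one_mul]
    exact quadError_le_of_bounded hq (by omega) hbound
  · obtain ⟨A, hA, h⟩ := exists_quadError_le_of_pos hq hk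
    exact ⟨A, hA, fun f M hf hM p hp => h f M hf hM (hM.nonneg hq) p hp⟩

end SparseGH

end

theorem theorem3p2 (q k : ℕ) (hq : 1 ≤ q) :
    ∃ p₀ : ℕ, ∀ M : ℝ, ∃ C : ℝ, ∀ f : (Fin q → ℝ) → ℝ, SparseGH.MemF q k f →
      (∀ α : Fin q → ℕ, (∀ i, α i ≤ k) → (∃ i, α i = k) →
        ∀ x, |SparseGH.mixedPartial α f x| ≤ M) →
      MeasureTheory.Integrable (fun x : Fin q → ℝ => f x * Real.exp (-∑ j, x j ^ 2)) ∧
      (∀ p : ℕ, q ≤ p → p₀ ≤ p →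
        SparseGH.quadError q p f ≤ C * SparseGH.rate q k p) ∧
      ((∀ x, |f x| ≤ M) → ∀ p : ℕ, q ≤ p → (2 ≤ q → q < p) →
        SparseGH.quadError q p f ≤ C * SparseGH.rate q k p) := by
  obtain ⟨A, hA, hlarge⟩ := SparseGH.exists_quadError_le hq k
  obtain ⟨c, hc, hrate⟩ := SparseGH.exists_le_rate hq k
  set r : ℝ := ((√2)⁻¹) ^ k with hr
  have hr0 : 0 < r := pow_pos SparseGH.inv_sqrt_two_pos k
  have hr1 : r ≤ 1 := pow_le_one₀ SparseGH.inv_sqrt_two_pos.le SparseGH.inv_sqrt_two_lt_one.le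
  set p₀ := q * (k + 2) with hp₀
  set A' : ℝ := √Real.pi ^ q * (1 + q * 2 ^ (q - 1)) with hA'
  have hA'0 : 0 ≤ A' := by positivity
  refine ⟨p₀, fun M => ⟨(A + A' * (r ^ p₀)⁻¹) * M / c, fun f hf hM => ?_⟩⟩
  have hM0 : 0 ≤ M := SparseGH.TopBounded.nonneg hq hM
  -- it suffices to bound the error by the rate in terms of `p`
  have hfinal : ∀ p : ℕ, q ≤ p → (2 ≤ q → q < p) →
      SparseGH.quadError q p f ≤ (A + A' * (r ^ p₀)⁻¹) * M * (r ^ p * (p : ℝ) ^ (q - 1)) →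
      SparseGH.quadError q p f ≤ (A + A' * (r ^ p₀)⁻¹) * M / c * SparseGH.rate q k p := by
    intro p hp hqp h
    refine h.trans ?_
    rw [div_mul_eq_mul_div, le_div_iff₀ hc, mul_assoc, mul_comm _ c]
    exact mul_le_mul_of_nonneg_left (hrate p hp hqp) (by positivity)
  have hge : ∀ p : ℕ, p₀ ≤ p →
      SparseGH.quadError q p f ≤ (A + A' * (r ^ p₀)⁻¹) * M * (r ^ p * (p : ℝ) ^ (q - 1)) := by
    intro p hp
    refine (hlarge f M hf hM p hp).trans ?_
    gcongr
    exact le_add_of_nonneg_right (by positivity)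
  refine ⟨hf.integrable hM, fun p hp hpp => hfinal p hp (fun h => ?_) (hge p hpp),
    fun hbound p hp hqp => hfinal p hp hqp ?_⟩
  · have : q * 2 ≤ q * (k + 2) := Nat.mul_le_mul_left q (by omega)
    omega
  · rcases le_total p₀ p with h | h
    · exact hge p h
    · -- for the finitely many `p ≤ p₀` the factor `r ^ p` is bounded below by `r ^ p₀`
      have h1 : 1 ≤ (r ^ p₀)⁻¹ * r ^ p := by
        rw [inv_mul_eq_div, one_le_div (by positivity)]
        exact pow_le_pow_of_le_one hr0.le hr1 h
      calc SparseGH.quadError q p f ≤ A' * M * (p : ℝ) ^ (q - 1) :=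
            SparseGH.quadError_le_of_bounded hq (hq.trans hp) hbound
        _ ≤ A' * M * (p : ℝ) ^ (q - 1) * ((r ^ p₀)⁻¹ * r ^ p) :=
            le_mul_of_one_le_right (by positivity) h1
        _ = A' * (r ^ p₀)⁻¹ * M * (r ^ p * (p : ℝ) ^ (q - 1)) := by ring
        _ ≤ (A + A' * (r ^ p₀)⁻¹) * M * (r ^ p * (p : ℝ) ^ (q - 1)) := by
            gcongr
            exact le_add_of_nonneg_left hA
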